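/- **Setting.** Let $\otimes$ be the Gödel ($\min\{d,e\}$), Łukasiewicz ($\max\{d+e-1,0\}$) or product ($d\cdot e$) t-norm on $[0,1]$, $\Rightarrow$ its residuum ($f\otimes d\le e$ iff $f\le d\Rightarrow e$) and $\ominus d:=d\Rightarrow 0$. Let $N_C,N_R,N_I$ be sets of concept, role and individual names, $N_I\neq\emptyset$. Basic roles are $Q::=P\mid P^-$, basic concepts $B::=A\mid\exists Q$. A fuzzy DL-Lite$_R$ TBox $\mathcal T$ is a finite set of axioms $\langle B\sqsubseteq C,d\rangle$, $\langle Q\sqsubseteq R,d\rangle$ with $C::=B\mid\neg B$, $R::=Q\mid\neg Q$, $d\in[0,1]$; an ABox $\mathcal A$ is a finite set of assertions $\langle B(a),d\rangle$, $\langle P(a,b),d\rangle$. An interpretation has a non-empty domain $\Delta$ and interprets individual names by elements, concept names by functions $\Delta\to[0,1]$ and role names by functions $\Delta^2\to[0,1]$, with $(P^-)(\delta,\eta)=P(\eta,\delta)$, $(\exists Q)(\delta)=\sup_{\eta}Q(\delta,\eta)$, $\neg$ interpreted by $\ominus$. It satisfies $\langle X\sqsubseteq Y,d\rangle$ if $X\Rightarrow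 Y$ is $\ge d$ everywhere, and an assertion if its degree is at least $d$. As usual in fuzzy description logic, models are witnessed: all the suprema $(\exists Q)(\delta)$ are attained. $\mathcal O=(\mathcal T,\mathcal A)$ is consistent if it has a model. A threshold query (TQ) $q(\mathbf x)=\exists\mathbf y.\phi(\mathbf x,\mathbf y)$ is a conjunction of threshold atoms $B(t)\ge d$ and $P(t_1,t_2)\ge d$ with $d\in[0,1]$, the terms being variables or individual names. A tuple $\mathbf a$ of individual names belongs to $\mathrm{ans}(q,\mathcal O)$ if in every model of $\mathcal O$ some assignment of domain elements to the variables, with $\mathbf x\mapsto\mathbf a$, satisfies all atoms of $q$ to at least their thresholds. **PerfectRef with raised thresholds.** A variable that is not an answer variable and occurs only once is written $\_$; the atom $(\exists P)(t)$ is read as $P(t,\_)$, $(\exists P^-)(t)$ as $P(\_,t)$, and $P^-(s,t)$ as $P(t,s)$. Starting from $\{q\}$, the algorithm adds to the current set, as long as it grows, all queries obtained from a query $p$ in it * by replacing a threshold atom $B'(t)\ge d$ of $p$ by $B(t)\ge d'$ for some $\langle B\sqsubseteq B',e\rangle\in\mathcal T$ with $d\le e$, or $Q'(s,t)\ge d$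 by $Q(s,t)\ge d'$ for some $\langle Q\sqsubseteq Q',e\rangle\in\mathcal T$ with $d\le e$, where the raised threshold is $d'=d$ for Gödel, $d'=d/e$ for product and $d'=\min\{1,d+1-e\}$ for Łukasiewicz; or * by applying to $p$ (including its answer tuple) a most general unifier of two atoms of $p$, where the two unified threshold atoms become a single one with the larger threshold. For a set $T$ of such queries, $\mathrm{ans}(db(\mathcal A),UCQ(T))$ is the set of tuples obtained by evaluating $T$ as a union of conjunctive queries over $\mathcal A$: a threshold atom $\alpha\ge d$ holds if $\mathcal A$ contains the corresponding assertion with some degree $e\ge d$ (for $P(t,\_)$ and $P(\_,t)$ an assertion of $\exists P$, respectively $\exists P^-$, about $t$ also counts). **Theorem.** Let $\mathcal T$ be a TBox and $q$ a TQ. 1. If all thresholds in $q$ are positive, then PerfectRef with raised thresholds terminates on $q,\mathcal T$ with a finite set $T$ of queries, and for every ABox $\mathcal A$ such that $\mathcal O=(\mathcal T,\mathcal A)$ is consistent, $\mathrm{ans}(q,\mathcal O)=\mathrm{ans}(db(\mathcal A),UCQ(T))$. 2. If the degrees in $\mathcal T$ and $q$ are rational (thresholds $0$ are allowed), then answering $q$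 with respect to consistent ontologies with TBox $\mathcal T$ is in $\mathrm{AC}^0$ in data complexity: there is a (uniform) family of circuits with AND and OR gates of unbounded fan-in, of constant depth and polynomial size, which, given the binary encoding of an ABox $\mathcal A$ with rational degrees such that $(\mathcal T,\mathcal A)$ is consistent, and of a tuple $\mathbf a$, decides whether $\mathbf a\in\mathrm{ans}(q,(\mathcal T,\mathcal A))$. Uniform means that the family computes a property of words definable in first-order logic with $<,+,\times$ on positions. -/

import Mathlib

universe u

namespace FuzzyDLLite

/-! ### The three fundamental continuous t-norms -/

/-- The Goedel, Lukasiewicz and product t-norms. -/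
inductive TNorm where
  | goedel
  | lukasiewicz
  | product

noncomputable section

namespace TNorm

/-- `d ⊗ e`, for degrees in `[0,1]`. -/
def conj : TNorm → ℝ → ℝ → ℝ
  | goedel, d, e => min d e
  | lukasiewicz, d, e => max (d + e - 1) 0
  | product, d, e => d * e

open Classical in
/-- The residuum `d ⇒ e`. -/
def residuum : TNorm → ℝ → ℝ → ℝ
  | goedel, d, e => if d ≤ e then 1 else e
  | lukasiewicz, d, e => min (1 - d + e) 1
  | product, d, e => if d ≤ e then 1 else e / d

/-- The residual negation `⊖ d = (d ⇒ 0)`. -/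
def neg (tn : TNorm) (d : ℝ) : ℝ := tn.residuum d 0

/-- The threshold required of the rewritten atom, when an atom with threshold `d` is rewritten
with an axiom of degree `e`. -/
def raise : TNorm → ℝ → ℝ → ℝ
  | goedel, d, _ => d
  | lukasiewicz, d, e => min 1 (d + 1 - e)
  | product, d, e => d / e

end TNorm

end

/-! ### Syntax of fuzzy DL-Lite_R -/

/-- `Q ::= P | P⁻`. -/
inductive BasicRole (NR : Type u) where
  | name (P : NR)
  | inv (P : NR)

/-- `R ::= Q | ¬ Q`. -/
inductive Role (NR : Type u) where
  | pos (Q : BasicRole NR)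
  | neg (Q : BasicRole NR)

/-- `B ::= A | ∃ Q`. -/
inductive BasicConcept (NC NR : Type u) where
  | name (A : NC)
  | ex (Q : BasicRole NR)

/-- `C ::= B | ¬ B`. -/
inductive Concept (NC NR : Type u) where
  | pos (B : BasicConcept NC NR)
  | neg (B : BasicConcept NC NR)

/-- Fuzzy axioms `⟨B ⊑ C, d⟩` and `⟨Q ⊑ R, d⟩`. -/
inductive FAxiom (NC NR : Type u) where
  | concept (B : BasicConcept NC NR) (C : Concept NC NR) (d : unitInterval)
  | role (Q : BasicRole NR) (R : Role NR) (d : unitInterval)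

/-- The degree of an axiom. -/
def FAxiom.degree {NC NR : Type u} : FAxiom NC NR → unitInterval
  | concept _ _ d => d
  | role _ _ d => d

/-- Fuzzy assertions `⟨B(a), d⟩` and `⟨P(a,b), d⟩`, with degrees from `D`. -/
inductive Assertion (NC NR NI : Type u) (D : Type) where
  | concept (B : BasicConcept NC NR) (a : NI) (d : D)
  | role (P : NR) (a b : NI) (d : D)

/-- Apply a function to the degree of an assertion. -/
def Assertion.mapDegree {NC NR NI : Type u} {D D' : Type} (f : D → D') :
    Assertion NC NR NI D → Assertion NC NR NI D'
  | concept B a d => concept B a (f d)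
  | role P a b d => role P a b (f d)

/-- A TBox is a finite set of axioms. -/
abbrev TBox (NC NR : Type u) := Finset (FAxiom NC NR)

/-- An ABox is a finite set of assertions with degrees in the real interval `[0,1]`. -/
abbrev ABox (NC NR NI : Type u) := Finset (Assertion NC NR NI unitInterval)

/-! ### Semantics -/

/-- Fuzzy interpretations (individual names need not be interpreted injectively). -/
structure Interp (NC NR NI : Type u) where
  Dom : Type u
  nonempty : Nonempty Dom
  ind : NI → Dom
  con : NC → Dom → unitInterval
  rol : NR → Dom → Dom → unitInterval

namespace Interp

variable {NC NR NI : Type u}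

/-- Degree of a basic role. -/
def basicRole (I : Interp NC NR NI) : BasicRole NR → I.Dom → I.Dom → ℝ
  | .name P, x, y => I.rol P x y
  | .inv P, x, y => I.rol P y x

noncomputable section

/-- Degree of a basic concept; `∃ Q` is a supremum. -/
def basicConcept (I : Interp NC NR NI) : BasicConcept NC NR → I.Dom → ℝ
  | .name A, x => I.con A x
  | .ex Q, x => ⨆ y : I.Dom, I.basicRole Q x y

/-- Degree of a general role. -/
def role (tn : TNorm) (I : Interp NC NR NI) : Role NR → I.Dom → I.Dom → ℝ
  | .pos Q, x, y => I.basicRole Q x y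
  | .neg Q, x, y => tn.neg (I.basicRole Q x y)

/-- Degree of a general concept. -/
def concept (tn : TNorm) (I : Interp NC NR NI) : Concept NC NR → I.Dom → ℝ
  | .pos B, x => I.basicConcept B x
  | .neg B, x => tn.neg (I.basicConcept B x)

end

/-- The interpretation is witnessed: every supremum that defines `∃ Q` is attained. -/
def Witnessed (I : Interp NC NR NI) : Prop :=
  ∀ (Q : BasicRole NR) (x : I.Dom), ∃ y : I.Dom,
    I.basicRole Q x y = I.basicConcept (.ex Q) x

/-- Satisfaction of an axiom. -/
def SatAxiom (tn : TNorm) (I : Interp NC NR NI) : FAxiom NC NR → Prop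
  | .concept B C d => ∀ x, (d : ℝ) ≤ tn.residuum (I.basicConcept B x) (I.concept tn C x)
  | .role Q R d => ∀ x y, (d : ℝ) ≤ tn.residuum (I.basicRole Q x y) (I.role tn R x y)

/-- Satisfaction of an assertion. -/
def SatAssertion (I : Interp NC NR NI) : Assertion NC NR NI unitInterval → Prop
  | .concept B a d => (d : ℝ) ≤ I.basicConcept B (I.ind a)
  | .role P a b d => d ≤ I.rol P (I.ind a) (I.ind b)

/-- (Witnessed) models of the ontology `(T, A)`. -/
structure IsModel (tn : TNorm) (T : TBox NC NR) (A : ABox NC NR NI)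
    (I : Interp NC NR NI) : Prop where
  witnessed : I.Witnessed
  tbox : ∀ α ∈ T, I.SatAxiom tn α
  abox : ∀ β ∈ A, I.SatAssertion β

end Interp

/-- The ontology `(T, A)` has a model. -/
def Consistent {NC NR NI : Type u} (tn : TNorm) (T : TBox NC NR) (A : ABox NC NR NI) : Prop :=
  ∃ I : Interp NC NR NI, I.IsModel tn T A

/-! ### Threshold queries and their certain answers -/

/-- A term is an individual name or a variable; variables are natural numbers. -/
inductive Term (NI : Type u) where
  | ind (a : NI)
  | var (v : ℕ)

/-- Query atoms `B(t)` and `P(s,t)`. -/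
inductive Atom (NC NR NI : Type u) where
  | concept (B : BasicConcept NC NR) (t : Term NI)
  | role (P : NR) (s t : Term NI)

/-- A threshold query: a tuple of answer variables and a conjunction of threshold atoms `α ≥ d`.
All variables that are not answer variables are existentially quantified. -/
structure TQ (NC NR NI : Type u) (k : ℕ) where
  answerVars : Fin k → ℕ
  body : Finset (Atom NC NR NI × unitInterval)

section Answers

variable {NC NR NI : Type u} {k : ℕ}

/-- The extension of a map on variables to terms. -/
def Term.eval {X : Type u} (ind : NI → X) (π : ℕ → X) : Term NI → X
  | .ind a => ind a
  | .var v => π v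

/-- The degree of an atom under a match. -/
noncomputable def Atom.degree (I : Interp NC NR NI) (π : ℕ → I.Dom) : Atom NC NR NI → ℝ
  | .concept B t => I.basicConcept B (t.eval I.ind π)
  | .role P s t => I.rol P (s.eval I.ind π) (t.eval I.ind π)

/-- `I ⊨ q(a)`: some match of `q` with respect to `a` satisfies every threshold atom of `q`. -/
def TQ.IsAnswer (q : TQ NC NR NI k) (I : Interp NC NR NI) (a : Fin k → NI) : Prop :=
  ∃ π : ℕ → I.Dom, (∀ i, π (q.answerVars i) = I.ind (a i)) ∧
    ∀ γ ∈ q.body, (γ.2 : ℝ) ≤ γ.1.degree I π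

/-- `ans(q, (T, A))`: the set of certain answers. -/
def TQ.certainAnswers (tn : TNorm) (T : TBox NC NR) (A : ABox NC NR NI)
    (q : TQ NC NR NI k) : Set (Fin k → NI) :=
  {a | ∀ I : Interp NC NR NI, I.IsModel tn T A → q.IsAnswer I a}

end Answers

/-! ### PerfectRef -/

/-- Terms in the queries handled by the rewriting; `none` is the anonymous variable `_`,
each occurrence of which stands for a different existential variable. -/
abbrev RTerm (NI : Type u) := Option (Term NI)

/-- Atoms `A(t)` and `P(s,t)` over concept names and role names. -/
inductive RAtom (NC NR NI : Type u) where
  | concept (A : NC) (t : RTerm NI)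
  | role (P : NR) (s t : RTerm NI)

/-- The queries handled by the rewriting.  The head is a tuple of terms, since unification may
identify answer variables with each other or with individual names. -/
structure RQuery (NC NR NI : Type u) (k : ℕ) where
  head : Fin k → Term NI
  body : Finset (RAtom NC NR NI × ℝ)

noncomputable section Rewriting

variable {NC NR NI : Type u} {k : ℕ}

/-- The atom that expresses `Q(s,t)`. -/
def BasicRole.atom (Q : BasicRole NR) (s t : RTerm NI) : RAtom NC NR NI :=
  match Q with
  | .name P => .role P s t
  | .inv P => .role P t s

/-- The atom that expresses `B(t)`, where `(∃ Q)(t)` is `Q(t,_)`. -/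
def BasicConcept.atom (B : BasicConcept NC NR) (t : RTerm NI) : RAtom NC NR NI :=
  match B with
  | .name A => .concept A t
  | .ex Q => Q.atom t none

/-- `Gr tn α γ η`: the positive axiom `α` is applicable to the threshold atom `γ`, with result
`η`.  Applicability of `⟨C ⊑ ∃ Q, e⟩` requires that the other argument of the atom is `_`. -/
inductive Gr (tn : TNorm) : FAxiom NC NR → RAtom NC NR NI × ℝ → RAtom NC NR NI × ℝ → Prop
  | concept (B B' : BasicConcept NC NR) (e : unitInterval) (t : RTerm NI) (d : ℝ)
      (h : d ≤ (e : ℝ)) :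
      Gr tn (.concept B (.pos B') e) (B'.atom t, d) (B.atom t, tn.raise d e)
  | role (Q Q' : BasicRole NR) (e : unitInterval) (s t : RTerm NI) (d : ℝ)
      (h : d ≤ (e : ℝ)) :
      Gr tn (.role Q (.pos Q') e) (Q'.atom s t, d) (Q.atom s t, tn.raise d e)

/-- Replace every (named) term of an atom by an `RTerm`. -/
def RAtom.bind (f : Term NI → RTerm NI) : RAtom NC NR NI → RAtom NC NR NI
  | .concept A t => .concept A (t.bind f)
  | .role P s t => .role P (s.bind f) (t.bind f)

open Classical in
/-- The number of occurrences of a variable in an atom. -/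
def RAtom.occ (v : ℕ) : RAtom NC NR NI → ℕ
  | .concept _ t => if t = some (.var v) then 1 else 0
  | .role _ s t => (if s = some (.var v) then 1 else 0) + (if t = some (.var v) then 1 else 0)

/-- The variable is neither distinguished nor shared. -/
def RQuery.Unbound (p : RQuery NC NR NI k) (v : ℕ) : Prop :=
  (∀ i, p.head i ≠ .var v) ∧ ∑ γ ∈ p.body, γ.1.occ v = 1

open Classical in
/-- Replace all undistinguished, unshared variables by `_`. -/
def RQuery.anon (p : RQuery NC NR NI k) : RQuery NC NR NI k where
  head := p.head
  body := p.body.image fun γ =>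
    (γ.1.bind fun t => if ∃ v, t = .var v ∧ p.Unbound v then none else some t, γ.2)

/-- Application of a substitution to a term. -/
def Term.subst (σ : ℕ → Term NI) (t : Term NI) : Term NI := t.eval Term.ind σ

/-- Application of a substitution to an atom. -/
def RAtom.subst (σ : ℕ → Term NI) (α : RAtom NC NR NI) : RAtom NC NR NI :=
  α.bind fun t => some (t.subst σ)

open Classical in
/-- Most general unifier of two terms. -/
def Term.mgu : Term NI → Term NI → Option (ℕ → Term NI)
  | .var v, t => some (Function.update Term.var v t)
  | .ind a, .var v => some (Function.update Term.var v (.ind a))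
  | .ind a, .ind b => if a = b then some Term.var else none

/-- Most general unifier of two terms or anonymous variables (only the effect on the named
variables is recorded). -/
def mguTerm : RTerm NI → RTerm NI → Option (ℕ → Term NI)
  | some s, some t => s.mgu t
  | _, _ => some Term.var

open Classical in
/-- Most general unifier of two atoms; `none` if they do not unify. -/
def RAtom.mgu : RAtom NC NR NI → RAtom NC NR NI → Option (ℕ → Term NI)
  | .concept A t, .concept A' t' => if A = A' then mguTerm t t' else none
  | .role P s t, .role P' s' t' =>
      if P = P' then
        (mguTerm s s').bind fun σ =>
          (mguTerm (t.map (Term.subst σ)) (t'.map (Term.subst σ))).map fun τ =>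
            fun v => (σ v).subst τ
      else none
  | _, _ => none

/-- The first atom, with its anonymous variables unified with the arguments of the second. -/
def RAtom.merge : RAtom NC NR NI → RAtom NC NR NI → RAtom NC NR NI
  | .concept A t, .concept _ t' => .concept A (t <|> t')
  | .role P s t, .role _ s' t' => .role P (s <|> s') (t <|> t')
  | α, _ => α

open Classical in
/-- The query `p[γ/η]`. -/
def RQuery.replace (p : RQuery NC NR NI k) (γ η : RAtom NC NR NI × ℝ) : RQuery NC NR NI k where
  head := p.head
  body := insert η (p.body.erase γ)

open Classical in
/-- Apply the unifier `σ` of `γ₁` and `γ₂` to `p`.  The two atoms become one, which keeps the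
larger of the two thresholds. -/
def RQuery.reduce (p : RQuery NC NR NI k) (γ₁ γ₂ : RAtom NC NR NI × ℝ) (σ : ℕ → Term NI) :
    RQuery NC NR NI k where
  head := fun i => (p.head i).subst σ
  body := insert ((γ₁.1.merge γ₂.1).subst σ, max γ₁.2 γ₂.2)
    (((p.body.erase γ₁).erase γ₂).image fun γ => (γ.1.subst σ, γ.2))

/-- One rewriting step of the algorithm, applied to one query. -/
inductive Step (tn : TNorm) (T : TBox NC NR) : RQuery NC NR NI k → RQuery NC NR NI k → Prop
  | apply (p : RQuery NC NR NI k) (α : FAxiom NC NR) (γ η : RAtom NC NR NI × ℝ)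
      (hα : α ∈ T) (hγ : γ ∈ p.body) (h : Gr tn α γ η) :
      Step tn T p (p.replace γ η).anon
  | reduce (p : RQuery NC NR NI k) (γ₁ γ₂ : RAtom NC NR NI × ℝ) (σ : ℕ → Term NI)
      (h₁ : γ₁ ∈ p.body) (h₂ : γ₂ ∈ p.body) (h : γ₁.1.mgu γ₂.1 = some σ) :
      Step tn T p (p.reduce γ₁ γ₂ σ).anon

/-- One pass through the main loop of the algorithm. -/
def pass (tn : TNorm) (T : TBox NC NR) (S : Set (RQuery NC NR NI k)) :
    Set (RQuery NC NR NI k) :=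
  S ∪ {p' | ∃ p ∈ S, Step tn T p p'}

/-- An atom of a threshold query as an `RAtom`. -/
def Atom.toRAtom : Atom NC NR NI → RAtom NC NR NI
  | .concept B t => B.atom (some t)
  | .role P s t => .role P (some s) (some t)

open Classical in
/-- The query from which the algorithm starts. -/
def TQ.toRQuery (q : TQ NC NR NI k) : RQuery NC NR NI k :=
  RQuery.anon
    { head := fun i => .var (q.answerVars i)
      body := q.body.image fun γ => (γ.1.toRAtom, (γ.2 : ℝ)) }

/-- The set of queries that the algorithm has computed after `n` passes on input `q`, `T`. -/
def perfectRef (tn : TNorm) (T : TBox NC NR) (q : TQ NC NR NI k) (n : ℕ) :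
    Set (RQuery NC NR NI k) :=
  (pass tn T)^[n] {q.toRQuery}

end Rewriting

/-! ### Evaluation of a union of threshold queries over the ABox as a database -/

section Database

variable {NC NR NI : Type u} {k : ℕ}

/-- Under the assignment `h`, the term may take the value `a` (which `_` always may). -/
def RTerm.Takes (h : ℕ → NI) (t : RTerm NI) (a : NI) : Prop :=
  ∀ s, t = some s → s.eval id h = a

/-- A threshold atom holds in the database `db(A)` under an assignment `h` of individual names to
the variables: there is a matching entry whose degree reaches the threshold.
An atom `P(t,_)` or `P(_,t)` is also matched by the entries for `∃ P` or `∃ P⁻`. -/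
def DBSat (A : ABox NC NR NI) (h : ℕ → NI) : RAtom NC NR NI × ℝ → Prop
  | (.concept N t, d) => ∃ (a : NI) (e : unitInterval), d ≤ (e : ℝ) ∧ RTerm.Takes h t a ∧
      Assertion.concept (.name N) a e ∈ A
  | (.role P s t, d) =>
      (∃ (a b : NI) (e : unitInterval), d ≤ (e : ℝ) ∧ RTerm.Takes h s a ∧ RTerm.Takes h t b ∧
        Assertion.role P a b e ∈ A) ∨
      (t = none ∧ ∃ (a : NI) (e : unitInterval), d ≤ (e : ℝ) ∧ RTerm.Takes h s a ∧
        Assertion.concept (.ex (.name P)) a e ∈ A) ∨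
      (s = none ∧ ∃ (b : NI) (e : unitInterval), d ≤ (e : ℝ) ∧ RTerm.Takes h t b ∧
        Assertion.concept (.ex (.inv P)) b e ∈ A)

/-- `ans(db(A), UCQ(S))`. -/
def dbAnswers (A : ABox NC NR NI) (S : Set (RQuery NC NR NI k)) : Set (Fin k → NI) :=
  {a | ∃ p ∈ S, ∃ h : ℕ → NI, (∀ i, (p.head i).eval id h = a i) ∧ ∀ γ ∈ p.body, DBSat A h γ}

end Database

/-! ### The complexity class AC⁰ -/

/-- Boolean circuits with `n` inputs, literals at the leaves and AND and OR gates of unbounded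
fan-in (in tree form, that is, with fan-out one; in constant depth this costs only a
polynomial). -/
inductive Circuit (n : ℕ) where
  | lit (i : Fin n) (b : Bool)
  | all (m : ℕ) (f : Fin m → Circuit n)
  | any (m : ℕ) (f : Fin m → Circuit n)

namespace Circuit

variable {n : ℕ}

/-- The value of the circuit; `lit i b` says that the `i`-th input is `b`. -/
def Accepts (w : Fin n → Bool) : Circuit n → Prop
  | lit i b => w i = b
  | all _ f => ∀ j, (f j).Accepts w
  | any _ f => ∃ j, (f j).Accepts w

/-- The number of gates. -/
def size : Circuit n → ℕ
  | lit _ _ => 1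
  | all _ f => 1 + ∑ j, (f j).size
  | any _ f => 1 + ∑ j, (f j).size

/-- The depth. -/
def depth : Circuit n → ℕ
  | lit _ _ => 0
  | all _ f => 1 + Finset.univ.sup fun j => (f j).depth
  | any _ f => 1 + Finset.univ.sup fun j => (f j).depth

end Circuit

/-- First-order formulas with `k` free variables over words, with the numerical predicates
`=`, `<`, `+` and `×` on positions. -/
inductive WordFormula : ℕ → Type where
  | bit {k : ℕ} (i : Fin k) : WordFormula k
  | eq {k : ℕ} (i j : Fin k) : WordFormula k
  | lt {k : ℕ} (i j : Fin k) : WordFormula k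
  | add {k : ℕ} (i j l : Fin k) : WordFormula k
  | mul {k : ℕ} (i j l : Fin k) : WordFormula k
  | not {k : ℕ} (φ : WordFormula k) : WordFormula k
  | and {k : ℕ} (φ ψ : WordFormula k) : WordFormula k
  | ex {k : ℕ} (φ : WordFormula (k + 1)) : WordFormula k

/-- Satisfaction in the word `w`, whose positions are `0, …, n - 1`. -/
def WordFormula.Holds {n : ℕ} (w : Fin n → Bool) :
    {k : ℕ} → WordFormula k → (Fin k → Fin n) → Prop
  | _, .bit i, v => w (v i) = true
  | _, .eq i j, v => v i = v j
  | _, .lt i j, v => v i < v j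
  | _, .add i j l, v => (v i : ℕ) + (v j : ℕ) = (v l : ℕ)
  | _, .mul i j l, v => (v i : ℕ) * (v j : ℕ) = (v l : ℕ)
  | _, .not φ, v => ¬ φ.Holds w v
  | _, .and φ ψ, v => φ.Holds w v ∧ ψ.Holds w v
  | _, .ex φ, v => ∃ x : Fin n, φ.Holds w (Fin.snoc v x)

/-- The promise problem with the given yes-instances and no-instances is in AC⁰: it is decided by
a family of circuits of constant depth and polynomial size.  The family is also required to be
uniform, in the form that it computes a property of words that is definable in first-order logic
with `<`, `+`, `×` (this is the same as DLOGTIME-uniformity, by Barrington, Immerman and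
Straubing). -/
def InAC0 (yes no : Set (List Bool)) : Prop :=
  ∃ (C : (n : ℕ) → Circuit n) (depth c : ℕ) (φ : WordFormula 0),
    (∀ n, (C n).depth ≤ depth) ∧
    (∀ n, (C n).size ≤ c * n ^ c + c) ∧
    (∀ (n : ℕ) (w : Fin n → Bool), (C n).Accepts w ↔ φ.Holds w Fin.elim0) ∧
    (∀ w ∈ yes, (C w.length).Accepts w.get) ∧
    (∀ w ∈ no, ¬ (C w.length).Accepts w.get)

/-! ### Inputs as bit strings

Words over the four symbols `0`, `1`, end of a number, start of an assertion, each written with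
two bits. -/

/-- A number in binary (least significant digit first), followed by an end mark. -/
def encodeNat (m : ℕ) : List Bool :=
  (Nat.bits m).flatMap (fun b => [true, b]) ++ [false, false]

/-- A rational degree, as numerator and denominator. -/
def encodeDegree (d : Set.Icc (0 : ℚ) 1) : List Bool :=
  encodeNat (d : ℚ).num.natAbs ++ encodeNat (d : ℚ).den

section Encoding

variable {NC NR NI : Type u} [Encodable NC] [Encodable NR] [Encodable NI]

/-- An assertion: start mark, kind of assertion, concept or role name, individual names, degree. -/
def encodeAssertion (β : Assertion NC NR NI (Set.Icc (0 : ℚ) 1)) : List Bool :=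
  [false, true] ++
  match β with
  | .concept (.name N) a d =>
      encodeNat 0 ++ encodeNat (Encodable.encode N) ++ encodeNat (Encodable.encode a) ++
        encodeDegree d
  | .concept (.ex (.name P)) a d =>
      encodeNat 1 ++ encodeNat (Encodable.encode P) ++ encodeNat (Encodable.encode a) ++
        encodeDegree d
  | .concept (.ex (.inv P)) a d =>
      encodeNat 2 ++ encodeNat (Encodable.encode P) ++ encodeNat (Encodable.encode a) ++
        encodeDegree d
  | .role P a b d =>
      encodeNat 3 ++ encodeNat (Encodable.encode P) ++ encodeNat (Encodable.encode a) ++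
        encodeNat (Encodable.encode b) ++ encodeDegree d

/-- The input: a candidate answer and a list of assertions. -/
def encodeInput {k : ℕ} (a : Fin k → NI) (L : List (Assertion NC NR NI (Set.Icc (0 : ℚ) 1))) :
    List Bool :=
  (List.ofFn a).flatMap (fun x => encodeNat (Encodable.encode x)) ++ L.flatMap encodeAssertion

end Encoding

/-- A rational degree as a real degree. -/
def ratDegree (d : Set.Icc (0 : ℚ) 1) : unitInterval :=
  ⟨((d : ℚ) : ℝ), by exact_mod_cast d.2.1, by exact_mod_cast d.2.2⟩

open Classical in
/-- The ABox given by a list of assertions with rational degrees. -/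
noncomputable def aboxOfList {NC NR NI : Type u}
    (L : List (Assertion NC NR NI (Set.Icc (0 : ℚ) 1))) : ABox NC NR NI :=
  (L.map (Assertion.mapDegree ratDegree)).toFinset

section DataComplexity

variable {NC NR NI : Type u} [Encodable NC] [Encodable NR] [Encodable NI] {k : ℕ}

/-- The encodings of those pairs of a candidate answer `a` and an ABox `A`, with `(T, A)`
consistent, for which `a` is a certain answer (`b = True`), or is not one (`b = False`). -/
def instances (tn : TNorm) (T : TBox NC NR) (q : TQ NC NR NI k) (b : Prop) : Set (List Bool) :=
  {w | ∃ (a : Fin k → NI) (L : List (Assertion NC NR NI (Set.Icc (0 : ℚ) 1))),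
    w = encodeInput a L ∧ Consistent tn T (aboxOfList L) ∧
    (a ∈ q.certainAnswers tn T (aboxOfList L) ↔ b)}

/-- Answering `q` with respect to consistent ontologies with the TBox `T` is in AC⁰ in data
complexity: the TBox and the query are fixed, the ABox and the candidate answer are the input. -/
def AnsweringInAC0 (tn : TNorm) (T : TBox NC NR) (q : TQ NC NR NI k) : Prop :=
  InAC0 (instances tn T q True) (instances tn T q False)

end DataComplexity

/-- The degree is a rational number. -/
def IsRat (d : unitInterval) : Prop := ∃ r : ℚ, (d : ℝ) = r

end FuzzyDLLite

/-! Everything rests on one adjunction: for a positive threshold `d ≤ e`, a degree `x` satisfies `d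
≤ x ⊗ e` iff it reaches the raised threshold (`le_conj_iff_raise_le`). An axiom of degree `e` can
thus be read backwards on thresholds exactly as it acts forwards on degrees.

Soundness needs no special model: in every witnessed model of the TBox, each rewriting step read
backwards preserves satisfaction (`RQuery.SatIn.of_step`), and an ABox match is a match in every
model.

For completeness, the chase over the individuals and a free `Q`-successor of each element yields a
canonical interpretation; the degree of a fact is the supremum of its derived degrees. These are
conjunctions of one ABox degree with axiom degrees, and only finitely many of them exceed any given
positive bound (`ConjClosure.finite_ge`). Hence every positive degree is reached by a finite
derivation, and the interpretation is witnessed. It maps homomorphically into every model, so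
negative axioms are inherited as soon as some model exists (`canonical_isModel`). A certain answer
therefore has a match there. Each atom of the match is weighed by one plus the number of its named
arguments plus the least height of a derivation; `RQuery.ChaseHolds.mem_dbAnswers` shows that while
some atom is not matched in the ABox, some rewriting step lowers the total weight. Undoing the last
chase rule is an axiom application; a variable mapped to a new element either occurs once and
becomes `_`, or permits a unification.

Termination: rewriting creates no new predicates beyond those of the TBox and no new terms, and the
reachable thresholds form a finite set (`RaiseClosure.finite`). Positivity matters here: a raise by
a degree below one then increases the threshold by a uniform amount (its logarithm, for product),
while thresholds stay at most one.

For the complexity bound, atoms with threshold zero hold trivially and are dropped. What remains is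
a fixed finite union of queries with rational thresholds, evaluated on the input word by a
first-order formula. The input code is self-synchronizing, so entries can be located locally. A
degree is compared with a fixed rational by cross-multiplication with constants, digit by digit with
carry look-ahead (`carryAt_testBit_iff`, `degreeAt_iff`). The comparison is valid only for words
long enough relative to the constants; the finitely many shorter words are tabulated. Order and
addition on positions suffice. A first-order formula unfolds to circuits of constant depth and
polynomial size (`inAC0_of_formula`). -/

namespace FuzzyDLLite

namespace TNorm

/-! ### Elementary properties of the t-norms -/

theorem conj_mono {tn : TNorm} {x x' e : ℝ} (he : 0 ≤ e) (h : x ≤ x') :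
    tn.conj x e ≤ tn.conj x' e := by
  cases tn
  · exact min_le_min_right e h
  · exact max_le_max (by linarith) le_rfl
  · exact mul_le_mul_of_nonneg_right h he

theorem conj_le_left {tn : TNorm} {x e : ℝ} (hx : 0 ≤ x) (he : e ≤ 1) : tn.conj x e ≤ x := by
  cases tn
  · exact min_le_left x e
  · exact max_le (by linarith) hx
  · exact mul_le_of_le_one_right hx he

theorem conj_le_right {tn : TNorm} {x e : ℝ} (hx : x ≤ 1) (he : 0 ≤ e) : tn.conj x e ≤ e := by
  cases tn
  · exact min_le_right x e
  · exact max_le (by linarith) he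
  · exact mul_le_of_le_one_left he hx

theorem conj_nonneg {tn : TNorm} {x e : ℝ} (hx : 0 ≤ x) (he : 0 ≤ e) : 0 ≤ tn.conj x e := by
  cases tn
  · exact le_min hx he
  · exact le_max_right _ _
  · exact mul_nonneg hx he

theorem conj_one {tn : TNorm} {x : ℝ} (hx : 0 ≤ x) (hx1 : x ≤ 1) : tn.conj x 1 = x := by
  cases tn
  · exact min_eq_left hx1
  · simpa [conj] using hx
  · exact mul_one x

/-- The residuation property. -/
theorem conj_le_iff {tn : TNorm} {x y e : ℝ} (hx : 0 ≤ x) (hy : 0 ≤ y) (he1 : e ≤ 1) : tn.conj x e ≤ y ↔ e ≤ tn.residuum x y := by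
  cases tn
  · simp only [conj, residuum]
    split_ifs with h
    · exact iff_of_true ((min_le_left _ _).trans h) he1
    · rw [min_le_iff]; exact or_iff_right h
  · simp only [conj, residuum, max_le_iff, le_min_iff]
    constructor
    · rintro ⟨h, -⟩; exact ⟨by linarith, he1⟩
    · rintro ⟨h, -⟩; exact ⟨by linarith, hy⟩
  · simp only [conj, residuum]
    split_ifs with h
    · exact iff_of_true ((mul_le_of_le_one_right hx he1).trans h) he1
    · rw [le_div_iff₀ (lt_of_le_of_lt hy (not_le.1 h)), mul_comm]

theorem residuum_anti {tn : TNorm} {x x' y : ℝ} (hx : 0 ≤ x) (h : x ≤ x') (hy : 0 ≤ y) (hy1 : y ≤ 1) :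
    tn.residuum x' y ≤ tn.residuum x y := by
  cases tn <;> simp only [residuum]
  · split_ifs with h₁ h₂ h₂
    · exact le_rfl
    · exact absurd (h.trans h₁) h₂
    · by_contra hc
      linarith
    · exact le_rfl
  · exact min_le_min_right 1 (by linarith)
  · split_ifs with h₁ h₂ h₂
    · exact le_rfl
    · exact absurd (h.trans h₁) h₂
    · exact div_le_one_of_le₀ (not_le.1 h₁).le (hx.trans h)
    · exact div_le_div_of_nonneg_left hy (lt_of_le_of_lt hy (not_le.1 h₂)) h

theorem residuum_mono {tn : TNorm} {x y y' : ℝ} (hx : 0 ≤ x) (hx1 : x ≤ 1) (h : y ≤ y') :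
    tn.residuum x y ≤ tn.residuum x y' := by
  cases tn <;> simp only [residuum]
  · split_ifs with h₁ h₂ h₂
    · exact le_rfl
    · exact absurd (h₁.trans h) h₂
    · by_contra hc
      linarith
    · exact h
  · exact min_le_min_right 1 (by linarith)
  · split_ifs with h₁ h₂ h₂
    · exact le_rfl
    · exact absurd (h₁.trans h) h₂
    · exact div_le_one_of_le₀ (not_le.1 h₁).le hx
    · exact div_le_div_of_nonneg_right h hx

theorem neg_anti {tn : TNorm} {x x' : ℝ} (hx : 0 ≤ x) (h : x ≤ x') : tn.neg x' ≤ tn.neg x :=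
  residuum_anti hx h le_rfl zero_le_one

theorem neg_mem_Icc {tn : TNorm} {x : ℝ} (hx1 : x ≤ 1) :
    tn.neg x ∈ Set.Icc (0 : ℝ) 1 := by
  cases tn <;> simp only [neg, residuum, Set.mem_Icc]
  · split_ifs <;> norm_num
  · exact ⟨le_min (by linarith) zero_le_one, min_le_right _ _⟩
  · split_ifs <;> norm_num

end TNorm

/-! ### Raised thresholds as adjoints of conjunction. -/

namespace TNorm

/-- The raised threshold is the least degree whose conjunction with `e` reaches `d`. Positivity of
`d` excludes the truncation at zero for Łukasiewicz and division by zero for product; `d ≤ e` makes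
the cap at one in the Łukasiewicz case harmless. -/
theorem le_conj_iff_raise_le {tn : TNorm} {x d e : ℝ} (hd : 0 < d) (hde : d ≤ e) : d ≤ tn.conj x e ↔ tn.raise d e ≤ x := by
  cases tn <;> simp only [conj, raise]
  · rw [le_min_iff]; exact and_iff_left hde
  · rw [le_max_iff, or_iff_left (not_le.2 hd), min_le_iff]
    constructor
    · intro h; exact Or.inr (by linarith)
    · rintro (h | h) <;> linarith
  · rw [div_le_iff₀ (hd.trans_le hde)]

theorem le_raise {tn : TNorm} {d e : ℝ} (hd : 0 < d) (hde : d ≤ e) (he : e ≤ 1) :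
    d ≤ tn.raise d e := by
  cases tn <;> simp only [raise]
  · exact le_rfl
  · exact le_min (hde.trans he) (by linarith)
  · rw [le_div_iff₀ (hd.trans_le hde)]; nlinarith

theorem raise_le_one {tn : TNorm} {d e : ℝ} (hd : 0 < d) (hde : d ≤ e) (he : e ≤ 1) :
    tn.raise d e ≤ 1 := by
  cases tn <;> simp only [raise]
  · exact hde.trans he
  · exact min_le_left _ _
  · rw [div_le_one (hd.trans_le hde)]; exact hde

theorem raise_one {tn : TNorm} {d : ℝ} (hd : d ≤ 1) : tn.raise d 1 = d := by
  cases tn <;> simp [raise, hd]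

end TNorm

/-! ### Finiteness of sets of degrees -/

/-- A set of numbers is finite if its elements arise from finitely many by finitely many
functions that increase a potential that is bounded on the set by at least a fixed amount. -/
theorem finite_of_potential {ι : Type*} {S S₀ : Set ℝ} {E : Set ι} (hS₀ : S₀.Finite)
    (hE : E.Finite) (f : ι → ℝ → ℝ) (μ : ℝ → ℝ) {c lo hi : ℝ} (hc : 0 < c)
    (hlo : ∀ x ∈ S, lo ≤ μ x) (hhi : ∀ x ∈ S, μ x ≤ hi)
    (hS : ∀ x ∈ S, x ∈ S₀ ∨ ∃ y ∈ S, ∃ e ∈ E, x = f e y ∧ μ y + c ≤ μ x) : S.Finite := by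
  -- The values generated in at most `n` rounds; each of these sets is finite.
  let it : ℕ → Set ℝ := fun n => Nat.rec S₀ (fun _ s => S₀ ∪ Set.image2 f E s) n
  have hit : ∀ n, (it n).Finite := by
    intro n
    induction n with
    | zero => exact hS₀
    | succ n ih => exact hS₀.union (hE.image2 f ih)
  -- Going back to a predecessor costs potential `c`, so after `n` predecessors the potential would
  -- fall below `lo`.
  have key : ∀ n : ℕ, ∀ x ∈ S, μ x < lo + n * c → x ∈ it n := by
    intro n
    induction n with
    | zero =>
      intro x hx h
      have := hlo x hx
      simp at h
      linarith
    | succ n ih =>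
      intro x hx h
      rcases hS x hx with h₀ | ⟨y, hy, e, he, rfl, hμ⟩
      · exact Or.inl h₀
      · refine Or.inr ⟨e, he, y, ih y hy ?_, rfl⟩
        push_cast at h
        linarith
  obtain ⟨n, hn⟩ := exists_nat_gt ((hi - lo) / c)
  rw [div_lt_iff₀ hc] at hn
  exact (hit n).subset fun x hx => key n x hx (by have := hhi x hx; linarith)

/-- Degrees below one in a finite set are bounded away from one. -/
theorem exists_gap {E : Set ℝ} (hE : E.Finite) :
    ∃ c : ℝ, 0 < c ∧ ∀ e ∈ E, e < 1 → e ≤ 1 - c := by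
  induction E, hE using Set.Finite.induction_on with
  | empty => exact ⟨1, one_pos, by simp⟩
  | @insert a s _ _ ih =>
    obtain ⟨c, hc, h⟩ := ih
    by_cases ha : a < 1
    · refine ⟨min c (1 - a), lt_min hc (by linarith), ?_⟩
      rintro e (rfl | he) h1
      · have := min_le_right c (1 - e); linarith
      · have := min_le_left c (1 - a); have := h e he h1; linarith
    · refine ⟨c, hc, ?_⟩
      rintro e (rfl | he) h1
      · exact absurd h1 ha
      · exact h e he h1

/-- The values obtained from degrees in `D` by conjunction with degrees in `E`. -/
inductive ConjClosure (tn : TNorm) (D E : Set ℝ) : ℝ → Prop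
  | base {d} (h : d ∈ D) : ConjClosure tn D E d
  | step {d e} (h : ConjClosure tn D E d) (he : e ∈ E) : ConjClosure tn D E (tn.conj d e)

/-- The thresholds obtained from those in `D` by rewriting with axioms of degree in `E`. -/
inductive RaiseClosure (tn : TNorm) (D E : Set ℝ) : ℝ → Prop
  | base {d} (h : d ∈ D) : RaiseClosure tn D E d
  | step {d e} (h : RaiseClosure tn D E d) (he : e ∈ E) (hde : d ≤ e) :
      RaiseClosure tn D E (tn.raise d e)

variable {tn : TNorm} {D E : Set ℝ}

theorem ConjClosure.mem_Icc (hD : D ⊆ Set.Icc 0 1) (hE : E ⊆ Set.Icc 0 1) {d : ℝ}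
    (h : ConjClosure tn D E d) : d ∈ Set.Icc (0 : ℝ) 1 := by
  induction h with
  | base h => exact hD h
  | step h he ih =>
    exact ⟨TNorm.conj_nonneg ih.1 (hE he).1, (TNorm.conj_le_left ih.1 (hE he).2).trans ih.2⟩

/-- The whole closure may be infinite, as powers of a degree accumulate at zero, but only boundedly
many effective conjunctions keep a value above `ε`. Conjunction with a degree below one lowers the
value (Łukasiewicz) or its logarithm (product) by a uniform amount; Gödel creates no new values. -/
theorem ConjClosure.finite_ge (hDf : D.Finite) (hEf : E.Finite) (hD : D ⊆ Set.Icc 0 1)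
    (hE : E ⊆ Set.Icc 0 1) {ε : ℝ} (hε : 0 < ε) :
    {d | ConjClosure tn D E d ∧ ε ≤ d}.Finite := by
  obtain ⟨c, hc, hgap⟩ := exists_gap hEf
  set S := {d | ConjClosure tn D E d ∧ ε ≤ d} with hSdef
  have hS1 : ∀ x ∈ S, x ≤ 1 := fun x hx => (hx.1.mem_Icc hD hE).2
  -- Conjunction with one is the identity and is skipped, so the last remaining conjunction uses a
  -- degree of at most `1 - c`.
  have main : ∀ (tn : TNorm) (μ : ℝ → ℝ),
      (∀ y e, ε ≤ tn.conj y e → ε ≤ y → y ≤ 1 → 0 ≤ e → e ≤ 1 - c →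
        μ y + c ≤ μ (tn.conj y e)) →
      ∀ x, ConjClosure tn D E x → ε ≤ x →
        x ∈ D ∨ ∃ y, (ConjClosure tn D E y ∧ ε ≤ y) ∧ ∃ e ∈ E,
          x = tn.conj y e ∧ μ y + c ≤ μ x := by
    intro tn μ hμ x hx
    induction hx with
    | base h => exact fun _ => Or.inl h
    | @step d e h he ih =>
      intro hεx
      have hd := h.mem_Icc hD hE
      have hεd : ε ≤ d := hεx.trans (TNorm.conj_le_left hd.1 (hE he).2)
      by_cases h1 : e < 1
      · exact Or.inr ⟨d, ⟨h, hεd⟩, e, he, rfl, hμ d e hεx hεd hd.2 (hE he).1 (hgap e he h1)⟩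
      · have : e = 1 := le_antisymm (hE he).2 (not_lt.1 h1)
        subst this
        rw [TNorm.conj_one hd.1 hd.2]
        exact ih hεd
  cases tn with
  | goedel =>
    refine (hDf.union hEf).subset ?_
    rintro x ⟨hx, -⟩
    induction hx with
    | base h => exact Or.inl h
    | @step d e _ he ih =>
      rcases min_choice d e with h | h
      · simpa only [TNorm.conj, h] using ih
      · simp only [TNorm.conj, h]; exact Or.inr he
  | lukasiewicz =>
    refine finite_of_potential (lo := -1) (hi := -ε) hDf hEf
      (fun e x => TNorm.lukasiewicz.conj x e) (fun x => -x) hc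
      (fun x hx => neg_le_neg (hS1 x hx)) (fun x hx => neg_le_neg hx.2) ?_
    rintro x ⟨hx, hεx⟩
    refine main _ (fun x => -x) ?_ x hx hεx
    intro y e h hy hy1 he he1
    have : TNorm.lukasiewicz.conj y e ≤ y - c := by
      simp only [TNorm.conj] at h ⊢
      rcases max_choice (y + e - 1) 0 with h' | h' <;> rw [h'] at h ⊢ <;> linarith
    linarith
  | product =>
    refine finite_of_potential (lo := 0) (hi := -Real.log ε) hDf hEf
      (fun e x => TNorm.product.conj x e) (fun x => -Real.log x) hc
      (fun x hx => neg_nonneg.2 (Real.log_nonpos (hε.le.trans hx.2) (hS1 x hx)))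
      (fun x hx => neg_le_neg (Real.log_le_log hε hx.2)) ?_
    rintro x ⟨hx, hεx⟩
    refine main _ (fun x => -Real.log x) ?_ x hx hεx
    intro y e h hy hy1 he he1
    have hy0 : 0 < y := hε.trans_le hy
    have he0 : 0 < e := by
      rcases he.lt_or_eq with h' | h'
      · exact h'
      · subst h'; simp only [TNorm.conj, mul_zero] at h; linarith
    -- `log e ≤ e - 1 ≤ -c`: the gap below one is also a gap of logarithms.
    have := Real.log_le_sub_one_of_pos he0
    simp only [TNorm.conj]
    rw [Real.log_mul hy0.ne' he0.ne']
    linarith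

theorem RaiseClosure.mem_Ioc (hD : D ⊆ Set.Ioc 0 1) (hE : E ⊆ Set.Icc 0 1) {d : ℝ}
    (h : RaiseClosure tn D E d) : d ∈ Set.Ioc (0 : ℝ) 1 := by
  induction h with
  | base h => exact hD h
  | step h he hde ih =>
    exact ⟨ih.1.trans_le (TNorm.le_raise ih.1 hde (hE he).2),
      TNorm.raise_le_one ih.1 hde (hE he).2⟩

/-- Thresholds only grow and never exceed one, and each raise by a degree below one adds at least
`c` to the threshold (Łukasiewicz) or to its logarithm (product). Positive starting thresholds keep
the logarithm bounded below; Gödel leaves thresholds unchanged. -/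
theorem RaiseClosure.finite (hDf : D.Finite) (hEf : E.Finite) (hD : D ⊆ Set.Ioc 0 1)
    (hE : E ⊆ Set.Icc 0 1) : {d | RaiseClosure tn D E d}.Finite := by
  obtain ⟨c, hc, hgap⟩ := exists_gap hEf
  obtain ⟨δ, hδ, hδD⟩ : ∃ δ : ℝ, 0 < δ ∧ ∀ d ∈ D, δ ≤ d := by
    rcases D.eq_empty_or_nonempty with h | h
    · exact ⟨1, one_pos, by simp [h]⟩
    · obtain ⟨m, hm, hmin⟩ := hDf.exists_minimal h
      exact ⟨m, (hD hm).1, fun d hd => (le_total m d).elim id fun h => hmin hd h⟩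
  have hlow : ∀ x, RaiseClosure tn D E x → δ ≤ x := by
    intro x hx
    induction hx with
    | base h => exact hδD _ h
    | step h he hde ih =>
      exact ih.trans (TNorm.le_raise (h.mem_Ioc hD hE).1 hde (hE he).2)
  have hS1 : ∀ x, RaiseClosure tn D E x → x ≤ 1 := fun x hx => (hx.mem_Ioc hD hE).2
  have main : ∀ (tn : TNorm) (μ : ℝ → ℝ),
      (∀ y e, 0 < y → y ≤ e → e ≤ 1 - c → μ y + c ≤ μ (tn.raise y e)) →
      ∀ x, RaiseClosure tn D E x →
        x ∈ D ∨ ∃ y, RaiseClosure tn D E y ∧ ∃ e ∈ E, x = tn.raise y e ∧ μ y + c ≤ μ x := by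
    intro tn μ hμ x hx
    induction hx with
    | base h => exact Or.inl h
    | @step d e h he hde ih =>
      have hd := h.mem_Ioc hD hE
      by_cases h1 : e < 1
      · exact Or.inr ⟨d, h, e, he, rfl, hμ d e hd.1 hde (hgap e he h1)⟩
      · have : e = 1 := le_antisymm (hE he).2 (not_lt.1 h1)
        subst this
        rw [TNorm.raise_one hd.2]
        exact ih
  cases tn with
  | goedel =>
    refine hDf.subset ?_
    intro x hx
    induction hx with
    | base h => exact h
    | step h he hde ih => exact ih
  | lukasiewicz =>
    refine finite_of_potential (lo := δ) (hi := 1) hDf hEf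
      (fun e x => TNorm.lukasiewicz.raise x e) (fun x => x) hc hlow hS1 ?_
    intro x hx
    refine main _ (fun x => x) ?_ x hx
    intro y e hy hye he1
    exact le_min (by linarith) (by linarith)
  | product =>
    refine finite_of_potential (lo := Real.log δ) (hi := 0) hDf hEf
      (fun e x => TNorm.product.raise x e) Real.log hc
      (fun x hx => Real.log_le_log hδ (hlow x hx))
      (fun x hx => Real.log_nonpos (hδ.le.trans (hlow x hx)) (hS1 x hx)) ?_
    intro x hx
    refine main _ Real.log ?_ x hx
    intro y e hy hye he1
    have he0 : 0 < e := hy.trans_le hye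
    have := Real.log_le_sub_one_of_pos he0
    simp only [TNorm.raise]
    rw [Real.log_div hy.ne' he0.ne']
    linarith

end FuzzyDLLite

namespace FuzzyDLLite

/-! ### Facts -/

/-- Facts `B(x)` and `P(x,y)` over a domain `X`. -/
inductive GFact (NC NR : Type u) (X : Type u) where
  | con (B : BasicConcept NC NR) (x : X)
  | rol (P : NR) (x y : X)

variable {NC NR NI : Type u} {X Y : Type u} {k : ℕ}

/-- The fact `Q(x,y)`. -/
def BasicRole.fact (Q : BasicRole NR) (x y : X) : GFact NC NR X :=
  match Q with
  | .name P => .rol P x y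
  | .inv P => .rol P y x

/-- The image of a fact under a map between domains. -/
def GFact.map (f : X → Y) : GFact NC NR X → GFact NC NR Y
  | .con B x => .con B (f x)
  | .rol P x y => .rol P (f x) (f y)

@[simp]
theorem BasicRole.map_fact (Q : BasicRole NR) (f : X → Y) (x y : X) :
    (Q.fact x y : GFact NC NR X).map f = Q.fact (f x) (f y) := by
  cases Q <;> rfl

/-- The degree of a fact in an interpretation. -/
noncomputable def Interp.degree (I : Interp NC NR NI) : GFact NC NR I.Dom → ℝ
  | .con B x => I.basicConcept B x
  | .rol P x y => I.rol P x y

theorem Interp.degree_fact (I : Interp NC NR NI) (Q : BasicRole NR) (x y : I.Dom) :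
    I.degree (Q.fact x y) = I.basicRole Q x y := by
  cases Q <;> rfl

theorem Interp.basicRole_mem_Icc (I : Interp NC NR NI) (Q : BasicRole NR) (x y : I.Dom) :
    I.basicRole Q x y ∈ Set.Icc (0 : ℝ) 1 := by
  cases Q
  · exact (I.rol _ x y).2
  · exact (I.rol _ y x).2

theorem Interp.basicRole_le (I : Interp NC NR NI) (Q : BasicRole NR) (x y : I.Dom) :
    I.basicRole Q x y ≤ I.basicConcept (.ex Q) x :=
  le_ciSup (f := fun y => I.basicRole Q x y)
    ⟨1, by rintro _ ⟨y, rfl⟩; exact (I.basicRole_mem_Icc Q x y).2⟩ y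

theorem Interp.basicConcept_mem_Icc (I : Interp NC NR NI) (B : BasicConcept NC NR) (x : I.Dom) :
    I.basicConcept B x ∈ Set.Icc (0 : ℝ) 1 := by
  have := I.nonempty
  cases B with
  | name A => exact (I.con A x).2
  | ex Q =>
    exact ⟨(I.basicRole_mem_Icc Q x (Classical.arbitrary _)).1.trans (I.basicRole_le Q x _),
      ciSup_le fun y => (I.basicRole_mem_Icc Q x y).2⟩

theorem Interp.degree_mem_Icc (I : Interp NC NR NI) (F : GFact NC NR I.Dom) :
    I.degree F ∈ Set.Icc (0 : ℝ) 1 := by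
  cases F with
  | con B x => exact I.basicConcept_mem_Icc B x
  | rol P x y => exact (I.rol P x y).2

/-- The assertion that states the fact to degree `d` belongs to the ABox. -/
def InABox (A : ABox NC NR NI) : GFact NC NR NI → ℝ → Prop
  | .con B a, d => ∃ e : unitInterval, (e : ℝ) = d ∧ Assertion.concept B a e ∈ A
  | .rol P a b, d => ∃ e : unitInterval, (e : ℝ) = d ∧ Assertion.role P a b e ∈ A

theorem Interp.IsModel.le_degree_of_inABox {tn : TNorm} {T : TBox NC NR} {A : ABox NC NR NI}
    {I : Interp NC NR NI} (hI : I.IsModel tn T A) {F : GFact NC NR NI} {d : ℝ}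
    (h : InABox A F d) : d ≤ I.degree (F.map I.ind) := by
  cases F with
  | con B a =>
    obtain ⟨e, rfl, h⟩ := h
    exact hI.abox _ h
  | rol P a b =>
    obtain ⟨e, rfl, h⟩ := h
    exact hI.abox _ h

/-! ### Matches of atoms with facts -/

/-- The term may take the value `x`, which `_` always may. -/
def RTerm.TakesIn (ind : NI → X) (π : ℕ → X) (t : RTerm NI) (x : X) : Prop :=
  ∀ s, t = some s → s.eval ind π = x

/-- The fact matches the atom, where `P(t,_)` and `P(_,t)` are also matched by facts for `∃ P`
and `∃ P⁻`. -/
inductive RAtom.Match (ind : NI → X) (π : ℕ → X) : RAtom NC NR NI → GFact NC NR X → Prop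
  | concept {A t x} (h : RTerm.TakesIn ind π t x) : Match ind π (.concept A t) (.con (.name A) x)
  | role {P s t x y} (hs : RTerm.TakesIn ind π s x) (ht : RTerm.TakesIn ind π t y) :
      Match ind π (.role P s t) (.rol P x y)
  | exName {P s x} (hs : RTerm.TakesIn ind π s x) :
      Match ind π (.role P s none) (.con (.ex (.name P)) x)
  | exInv {P t y} (ht : RTerm.TakesIn ind π t y) :
      Match ind π (.role P none t) (.con (.ex (.inv P)) y)

variable {ind : NI → X} {π : ℕ → X}

@[simp]
theorem RTerm.takesIn_none (x : X) : RTerm.TakesIn ind π none x := by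
  intro s h; cases h

@[simp]
theorem RTerm.takesIn_some {t : Term NI} {x : X} :
    RTerm.TakesIn ind π (some t) x ↔ t.eval ind π = x :=
  ⟨fun h => h t rfl, by rintro h s ⟨⟩; exact h⟩

theorem RTerm.TakesIn.bind {t : RTerm NI} {x : X} (h : RTerm.TakesIn ind π t x)
    {f : Term NI → RTerm NI} {π' : ℕ → X} {ind' : NI → X}
    (hf : ∀ s ∈ t, ∀ s' ∈ f s, s'.eval ind' π' = s.eval ind π) :
    RTerm.TakesIn ind' π' (t.bind f) x := by
  cases t with
  | none => exact takesIn_none x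
  | some t =>
    intro s hs
    rw [hf t rfl s hs]
    exact h t rfl

theorem RAtom.match_atom_con {B : BasicConcept NC NR} {t : RTerm NI} {x : X}
    (h : RTerm.TakesIn ind π t x) : RAtom.Match ind π (B.atom t) (.con B x) := by
  rcases B with A | P | P
  · exact .concept h
  · exact .exName h
  · exact .exInv h

theorem RAtom.Match.exists_of_con {B : BasicConcept NC NR} {α : RAtom NC NR NI} {x : X}
    (h : RAtom.Match ind π α (.con B x)) : ∃ t, α = B.atom t ∧ RTerm.TakesIn ind π t x := by
  cases h with
  | concept h => exact ⟨_, rfl, h⟩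
  | exName h => exact ⟨_, rfl, h⟩
  | exInv h => exact ⟨_, rfl, h⟩

theorem RAtom.match_atom_fact {Q : BasicRole NR} {s t : RTerm NI} {x y : X}
    (hs : RTerm.TakesIn ind π s x) (ht : RTerm.TakesIn ind π t y) :
    RAtom.Match ind π (Q.atom s t : RAtom NC NR NI) (Q.fact x y) := by
  cases Q
  · exact .role hs ht
  · exact .role ht hs

theorem RAtom.Match.exists_of_fact {Q : BasicRole NR} {α : RAtom NC NR NI} {x y : X}
    (h : RAtom.Match ind π α (Q.fact x y)) :
    ∃ s t, α = Q.atom s t ∧ RTerm.TakesIn ind π s x ∧ RTerm.TakesIn ind π t y := by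
  cases Q with
  | name P => cases h with | role hs ht => exact ⟨_, _, rfl, hs, ht⟩
  | inv P => cases h with | role hs ht => exact ⟨_, _, rfl, ht, hs⟩

/-- The named terms of an atom. -/
def RAtom.terms : RAtom NC NR NI → List (Term NI)
  | .concept _ t => t.toList
  | .role _ s t => s.toList ++ t.toList

theorem RAtom.Match.bind {α : RAtom NC NR NI} {F : GFact NC NR X} (h : RAtom.Match ind π α F)
    {f : Term NI → RTerm NI} {π' : ℕ → X} {ind' : NI → X}
    (hf : ∀ s ∈ α.terms, ∀ s' ∈ f s, s'.eval ind' π' = s.eval ind π) :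
    RAtom.Match ind' π' (α.bind f) F := by
  cases h with
  | concept h => exact .concept (h.bind fun s hs => hf s (by simpa [terms] using hs))
  | role hs ht =>
    exact .role (hs.bind fun s hs => hf s (by simp [terms]; exact Or.inl hs))
      (ht.bind fun s hs => hf s (by simp [terms]; exact Or.inr hs))
  | exName h => exact .exName (h.bind fun s hs => hf s (by simpa [terms] using hs))
  | exInv h => exact .exInv (h.bind fun s hs => hf s (by simpa [terms] using hs))

theorem Term.eval_subst (t : Term NI) (σ : ℕ → Term NI) :
    (t.subst σ).eval ind π = t.eval ind fun v => (σ v).eval ind π := by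
  cases t <;> rfl

theorem RTerm.takesIn_subst {t : RTerm NI} {σ : ℕ → Term NI} {x : X} :
    RTerm.TakesIn ind π (t.bind fun t => some (t.subst σ)) x ↔
      RTerm.TakesIn ind (fun v => (σ v).eval ind π) t x := by
  cases t with
  | none => exact iff_of_true (takesIn_none x) (takesIn_none x)
  | some t => simp [Term.eval_subst]

/-- A substitution can be moved into the assignment. For matches with facts about `∃ P` this uses
that substitution never produces `_`. -/
theorem RAtom.match_subst {α : RAtom NC NR NI} {σ : ℕ → Term NI} {F : GFact NC NR X} :
    RAtom.Match ind π (α.subst σ) F ↔ RAtom.Match ind (fun v => (σ v).eval ind π) α F := by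
  constructor
  · intro h
    rcases α with ⟨A, t⟩ | ⟨P, s, t⟩
    · cases h with
      | concept h => exact .concept (RTerm.takesIn_subst.1 h)
    · generalize hα : (RAtom.role P s t).subst σ = α at h
      cases h with
      | concept h => cases hα
      | role hs ht => cases hα; exact .role (RTerm.takesIn_subst.1 hs) (RTerm.takesIn_subst.1 ht)
      | exName h =>
        simp only [subst, bind, role.injEq] at hα
        obtain ⟨rfl, rfl, ht⟩ := hα
        cases t with
        | none => exact .exName (RTerm.takesIn_subst.1 h)
        | some t => cases ht
      | exInv h =>
        simp only [subst, bind, role.injEq] at hα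
        obtain ⟨rfl, hs, rfl⟩ := hα
        cases s with
        | none => exact .exInv (RTerm.takesIn_subst.1 h)
        | some t => cases hs
  · intro h
    refine h.bind fun s _ s' hs' => ?_
    cases hs'
    exact Term.eval_subst s σ

/-! ### Unification -/

theorem Term.mgu_unifies {s t : Term NI} {σ : ℕ → Term NI} (h : s.mgu t = some σ) :
    s.subst σ = t.subst σ := by
  rcases s with a | v <;> rcases t with b | w <;> simp only [Term.mgu] at h
  · split_ifs at h with hab
    · rw [hab]
  all_goals
    cases h
    simp [Term.subst, Term.eval, Function.update_apply]

/-- The unifier replaces a variable by a term of equal value, so the same assignment still works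
after substitution. Two individual names unify only if they are equal, which is why distinct names
must have distinct values; this holds in the canonical model. -/
theorem Term.exists_mgu {s t : Term NI} (hind : Function.Injective ind)
    (h : s.eval ind π = t.eval ind π) :
    ∃ σ, s.mgu t = some σ ∧ ∀ v, (σ v).eval ind π = π v := by
  rcases s with a | v <;> rcases t with b | w <;> simp only [Term.mgu]
  · rw [if_pos (hind h)]
    exact ⟨_, rfl, fun v => rfl⟩
  all_goals
    refine ⟨_, rfl, fun u => ?_⟩
    simp only [Function.update_apply]
    split_ifs with hu
    · subst hu
      first | exact h.symm | exact h
    · rfl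

theorem mguTerm_unifies {s t : Term NI} {σ : ℕ → Term NI} (h : mguTerm (some s) (some t) = some σ) :
    s.subst σ = t.subst σ :=
  Term.mgu_unifies h

theorem exists_mguTerm {s t : RTerm NI} {x : X} (hind : Function.Injective ind)
    (hs : RTerm.TakesIn ind π s x) (ht : RTerm.TakesIn ind π t x) :
    ∃ σ, mguTerm s t = some σ ∧ ∀ v, (σ v).eval ind π = π v := by
  rcases s with _ | s <;> rcases t with _ | t
  case some.some =>
    exact Term.exists_mgu hind ((RTerm.takesIn_some.1 hs).trans (RTerm.takesIn_some.1 ht).symm)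
  all_goals exact ⟨_, rfl, fun v => rfl⟩

theorem Term.subst_subst (t : Term NI) (σ τ : ℕ → Term NI) :
    (t.subst σ).subst τ = t.subst fun v => (σ v).subst τ := by
  cases t <;> rfl

/-- A match of the merged atom is a match of both atoms. -/
theorem RTerm.TakesIn.of_orElse {s t : RTerm NI} {x : X}
    (h : RTerm.TakesIn ind π (s <|> t) x)
    (heq : ∀ s' ∈ s, ∀ t' ∈ t, s'.eval ind π = t'.eval ind π) :
    RTerm.TakesIn ind π s x ∧ RTerm.TakesIn ind π t x := by
  rcases s with _ | s
  · exact ⟨takesIn_none x, by simpa using h⟩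
  · have hs : s.eval ind π = x := by simpa using h
    refine ⟨by simpa using hs, ?_⟩
    rcases t with _ | t
    · exact takesIn_none x
    · rw [takesIn_some, ← heq s rfl t rfl, hs]

theorem RTerm.TakesIn.orElse {s t : RTerm NI} {x : X} (hs : RTerm.TakesIn ind π s x)
    (ht : RTerm.TakesIn ind π t x) : RTerm.TakesIn ind π (s <|> t) x := by
  rcases s with _ | s
  · simpa using ht
  · simpa using hs

/-- The unifier is composed of two stages: the first equation survives application of the second
substitution, and the second was solved after application of the first. -/
theorem RAtom.mgu_role {P : NR} {s t s' t' : RTerm NI} {ρ : ℕ → Term NI}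
    (h : (RAtom.role P s t : RAtom NC NR NI).mgu (.role P s' t') = some ρ) :
    (∀ a ∈ s, ∀ a' ∈ s', a.subst ρ = a'.subst ρ) ∧
      ∀ b ∈ t, ∀ b' ∈ t', b.subst ρ = b'.subst ρ := by
  simp only [RAtom.mgu, if_true, Option.bind_eq_some_iff, Option.map_eq_some_iff] at h
  obtain ⟨σ, hσ, τ, hτ, rfl⟩ := h
  constructor
  · rintro a rfl a' rfl
    rw [← Term.subst_subst, ← Term.subst_subst, mguTerm_unifies hσ]
  · rintro b rfl b' rfl
    rw [← Term.subst_subst, ← Term.subst_subst]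
    exact mguTerm_unifies hτ

theorem RAtom.exists_mgu_role {P : NR} {s t s' t' : RTerm NI} {x y : X}
    (hind : Function.Injective ind)
    (hs : RTerm.TakesIn ind π s x) (hs' : RTerm.TakesIn ind π s' x)
    (ht : RTerm.TakesIn ind π t y) (ht' : RTerm.TakesIn ind π t' y) :
    ∃ σ, (RAtom.role P s t : RAtom NC NR NI).mgu (.role P s' t') = some σ ∧
      ∀ v, (σ v).eval ind π = π v := by
  obtain ⟨σ, hσ, hσπ⟩ := exists_mguTerm hind hs hs'
  have key : ∀ {t : RTerm NI}, RTerm.TakesIn ind π t y →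
      RTerm.TakesIn ind π (t.map (Term.subst σ)) y := by
    rintro (_ | t) h
    · exact RTerm.takesIn_none y
    · simp only [Option.map_some, RTerm.takesIn_some, Term.eval_subst, hσπ] at h ⊢
      exact h
  obtain ⟨τ, hτ, hτπ⟩ := exists_mguTerm hind (key ht) (key ht')
  refine ⟨fun v => (σ v).subst τ, ?_, fun v => ?_⟩
  · simp [RAtom.mgu, hσ, hτ]
  · simp only [Term.eval_subst, hτπ, hσπ]

end FuzzyDLLite

namespace FuzzyDLLite

variable {NC NR NI : Type u} {X : Type u} {k : ℕ}

/-! ### The thresholds that occur in rewritings -/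

/-- The degrees of the axioms of a TBox. -/
def TBox.degrees (T : TBox NC NR) : Set ℝ := (fun α => (α.degree : ℝ)) '' (T : Set (FAxiom NC NR))

theorem TBox.finite_degrees (T : TBox NC NR) : T.degrees.Finite :=
  T.finite_toSet.image _

theorem TBox.degrees_subset (T : TBox NC NR) : T.degrees ⊆ Set.Icc 0 1 := by
  rintro _ ⟨α, -, rfl⟩
  exact α.degree.2

theorem perfectRef_induction {tn : TNorm} {T : TBox NC NR} {q : TQ NC NR NI k}
    {C : RQuery NC NR NI k → Prop} (h₀ : C q.toRQuery)
    (hs : ∀ p p', C p → Step tn T p p' → C p') (n : ℕ) : ∀ p ∈ perfectRef tn T q n, C p := by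
  induction n with
  | zero => rintro p rfl; exact h₀
  | succ n ih =>
    intro p hp
    rw [perfectRef, Function.iterate_succ_apply'] at hp
    rcases hp with hp | ⟨p', hp', h⟩
    · exact ih p hp
    · exact hs p' p (ih p' hp') h

/-- The thresholds of a rewriting are obtained from those of the query by raising. -/
theorem thresholds_perfectRef {tn : TNorm} {T : TBox NC NR} {q : TQ NC NR NI k} (n : ℕ) :
    ∀ p ∈ perfectRef tn T q n, ∀ γ ∈ p.body,
      RaiseClosure tn ((fun γ => (γ.2 : ℝ)) '' (q.body : Set (Atom NC NR NI × unitInterval)))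
        T.degrees γ.2 := by
  classical
  refine perfectRef_induction ?_ ?_ n
  · intro γ hγ
    simp only [TQ.toRQuery, RQuery.anon, Finset.mem_image] at hγ
    obtain ⟨_, ⟨γ₀, h₀, rfl⟩, rfl⟩ := hγ
    exact .base ⟨γ₀, h₀, rfl⟩
  · intro p p' hp hs γ' hγ'
    cases hs with
    | apply α γ η hα hγ h =>
      simp only [RQuery.anon, RQuery.replace, Finset.mem_image, Finset.mem_insert,
        Finset.mem_erase] at hγ'
      obtain ⟨η', rfl | ⟨-, hη'⟩, rfl⟩ := hγ'
      · have hγd := hp γ hγ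
        cases h with
        | concept B B' e t d h => exact .step hγd ⟨_, hα, rfl⟩ h
        | role Q Q' e s t d h => exact .step hγd ⟨_, hα, rfl⟩ h
      · exact hp η' hη'
    | reduce γ₁ γ₂ σ h₁ h₂ h =>
      simp only [RQuery.anon, RQuery.reduce, Finset.mem_image, Finset.mem_insert,
        Finset.mem_erase] at hγ'
      obtain ⟨η', rfl | ⟨η'', ⟨-, -, h''⟩, rfl⟩, rfl⟩ := hγ'
      · simp only
        rcases max_choice γ₁.2 γ₂.2 with h | h <;> rw [h]
        · exact hp γ₁ h₁
        · exact hp γ₂ h₂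
      · exact hp η'' h''

/-! ### Arguments of atoms -/

/-- The two arguments of a role atom, or the argument of a concept atom. -/
def RAtom.arg : RAtom NC NR NI → Bool → RTerm NI
  | .concept _ t, true => t
  | .concept _ _, false => none
  | .role _ s _, false => s
  | .role _ _ t, true => t

@[simp]
theorem RAtom.arg_bind (α : RAtom NC NR NI) (f : Term NI → RTerm NI) (b : Bool) :
    (α.bind f).arg b = (α.arg b).bind f := by
  cases α <;> cases b <;> rfl

theorem RAtom.mem_terms_iff {α : RAtom NC NR NI} {t : Term NI} :
    t ∈ α.terms ↔ ∃ b, α.arg b = some t := by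
  cases α <;> simp [terms, arg]

-- Occurrences become pairs of an atom and an argument side, so that an unbound variable is one
-- whose set of such pairs has a single element. The next two lemmas use this.
open Classical in
theorem RAtom.occ_eq (α : RAtom NC NR NI) (v : ℕ) :
    α.occ v = ∑ b : Bool, if α.arg b = some (.var v) then 1 else 0 := by
  cases α <;> simp only [occ, arg, Fintype.sum_bool] <;> simp [add_comm] <;> congr

theorem RQuery.Unbound.unique {p : RQuery NC NR NI k} {v : ℕ} (h : p.Unbound v)
    {γ γ' : RAtom NC NR NI × ℝ} (hγ : γ ∈ p.body) (hγ' : γ' ∈ p.body) {b b' : Bool}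
    (hb : γ.1.arg b = some (.var v)) (hb' : γ'.1.arg b' = some (.var v)) :
    γ = γ' ∧ b = b' := by
  classical
  have h1 := h.2
  simp only [RAtom.occ_eq] at h1
  rw [← Finset.sum_product', ← Finset.card_filter, Finset.card_eq_one] at h1
  obtain ⟨x, hx⟩ := h1
  have m : (γ, b) ∈ ({x} : Finset _) := hx ▸ by simp [hγ, hb]
  have m' : (γ', b') ∈ ({x} : Finset _) := hx ▸ by simp [hγ', hb']
  rw [Finset.mem_singleton] at m m'
  exact Prod.mk.inj (m.trans m'.symm)

theorem RQuery.exists_of_not_unbound {p : RQuery NC NR NI k} {v : ℕ} (h : ¬ p.Unbound v)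
    (hv : ∀ i, p.head i ≠ .var v) {γ : RAtom NC NR NI × ℝ} (hγ : γ ∈ p.body) {b : Bool}
    (hb : γ.1.arg b = some (.var v)) :
    ∃ γ' ∈ p.body, ∃ b', γ'.1.arg b' = some (.var v) ∧ (γ', b') ≠ (γ, b) := by
  classical
  by_contra! hc
  refine h ⟨hv, ?_⟩
  simp only [RAtom.occ_eq]
  rw [← Finset.sum_product', ← Finset.card_filter, Finset.card_eq_one]
  refine ⟨(γ, b), ?_⟩
  ext ⟨γ', b'⟩
  simp only [Finset.mem_filter, Finset.mem_product, Finset.mem_univ, and_true,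
    Finset.mem_singleton]
  constructor
  · rintro ⟨h1, h2⟩
    exact hc γ' h1 b' h2
  · rintro ⟨⟩
    exact ⟨hγ, hb⟩

/-! ### Soundness of the rewriting -/

/-- The query holds for the tuple `a` in the interpretation. -/
def RQuery.SatIn (I : Interp NC NR NI) (a : Fin k → NI) (p : RQuery NC NR NI k) : Prop :=
  ∃ π : ℕ → I.Dom, (∀ i, (p.head i).eval I.ind π = I.ind (a i)) ∧
    ∀ γ ∈ p.body, ∃ F, RAtom.Match I.ind π γ.1 F ∧ γ.2 ≤ I.degree F

/-- The degree of an atom with given values of its arguments. -/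
def Interp.argDegree (I : Interp NC NR NI) (x : Bool → I.Dom) : RAtom NC NR NI → ℝ
  | .concept A _ => I.con A (x true)
  | .role P _ _ => I.rol P (x false) (x true)

theorem Interp.argDegree_bind (I : Interp NC NR NI) (x : Bool → I.Dom) (α : RAtom NC NR NI)
    (f : Term NI → RTerm NI) : I.argDegree x (α.bind f) = I.argDegree x α := by
  cases α <;> rfl

variable {I : Interp NC NR NI} {π : ℕ → I.Dom}

/-- Witnessedness supplies an actual role successor for a match through a fact about `∃ P`, so
matches reduce to a choice of values for both arguments. -/
theorem exists_match_iff_argDegree (hI : I.Witnessed) {α : RAtom NC NR NI} {d : ℝ} :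
    (∃ F, RAtom.Match I.ind π α F ∧ d ≤ I.degree F) ↔
      ∃ x : Bool → I.Dom, (∀ b, RTerm.TakesIn I.ind π (α.arg b) (x b)) ∧ d ≤ I.argDegree x α := by
  constructor
  · rintro ⟨F, hF, hd⟩
    cases hF with
    | @concept A t x h =>
      exact ⟨fun _ => x, by rintro (_ | _); exacts [RTerm.takesIn_none x, h], hd⟩
    | @role P s t x y hs ht =>
      exact ⟨fun b => cond b y x, by rintro (_ | _); exacts [hs, ht], hd⟩
    | @exName P s x hs =>
      obtain ⟨y, hy⟩ := hI (.name P) x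
      exact ⟨fun b => cond b y x, by rintro (_ | _); exacts [hs, RTerm.takesIn_none y],
        hd.trans hy.ge⟩
    | @exInv P t y ht =>
      obtain ⟨x, hx⟩ := hI (.inv P) y
      exact ⟨fun b => cond b y x, by rintro (_ | _); exacts [RTerm.takesIn_none x, ht],
        hd.trans hx.ge⟩
  · rintro ⟨x, hx, hd⟩
    cases α with
    | concept A t => exact ⟨_, .concept (hx true), hd⟩
    | role P s t => exact ⟨_, .role (hx false) (hx true), hd⟩

theorem exists_match_atom_role_iff (hI : I.Witnessed) {Q : BasicRole NR} {s t : RTerm NI} {d : ℝ} :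
    (∃ F, RAtom.Match I.ind π (Q.atom s t : RAtom NC NR NI) F ∧ d ≤ I.degree F) ↔
      ∃ x y, RTerm.TakesIn I.ind π s x ∧ RTerm.TakesIn I.ind π t y ∧ d ≤ I.basicRole Q x y := by
  constructor
  · intro h
    obtain ⟨x, hx, hd⟩ := (exists_match_iff_argDegree hI).1 h
    cases Q
    · exact ⟨x false, x true, hx false, hx true, hd⟩
    · exact ⟨x true, x false, hx true, hx false, hd⟩
  · rintro ⟨x, y, hs, ht, hd⟩
    exact ⟨_, RAtom.match_atom_fact hs ht, by rwa [I.degree_fact]⟩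

theorem exists_match_atom_concept_iff (hI : I.Witnessed) {B : BasicConcept NC NR} {t : RTerm NI}
    {d : ℝ} : (∃ F, RAtom.Match I.ind π (B.atom t) F ∧ d ≤ I.degree F) ↔
      ∃ x, RTerm.TakesIn I.ind π t x ∧ d ≤ I.basicConcept B x := by
  constructor
  · intro h
    cases B with
    | name A =>
      obtain ⟨x, hx, hd⟩ := (exists_match_iff_argDegree hI).1 h
      exact ⟨x true, hx true, hd⟩
    | ex Q =>
      obtain ⟨x, y, hx, -, hd⟩ := (exists_match_atom_role_iff hI).1 h
      exact ⟨x, hx, hd.trans (I.basicRole_le Q x y)⟩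
  · rintro ⟨x, hx, hd⟩
    exact ⟨_, RAtom.match_atom_con hx, hd⟩

/-- A variable that was turned into `_` occurs only once, so it may be assigned whatever element
matches that one occurrence without affecting other atoms or the head. -/
theorem RQuery.SatIn.of_anon (hI : I.Witnessed) {a : Fin k → NI} {p : RQuery NC NR NI k}
    (h : p.anon.SatIn I a) : p.SatIn I a := by
  classical
  obtain ⟨π, hhead, hbody⟩ := h
  have hval : ∀ γ : RAtom NC NR NI × ℝ, ∃ x : Bool → I.Dom, γ ∈ p.body →
      (∀ b s, γ.1.arg b = some s → (¬ ∃ v, s = .var v ∧ p.Unbound v) → s.eval I.ind π = x b) ∧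
        γ.2 ≤ I.argDegree x γ.1 := by
    intro γ
    by_cases hγ : γ ∈ p.body
    · have := hbody _ (Finset.mem_image_of_mem _ hγ)
      obtain ⟨x, hx, hd⟩ := (exists_match_iff_argDegree hI).1 this
      rw [I.argDegree_bind] at hd
      refine ⟨x, fun _ => ⟨fun b s hs hn => ?_, hd⟩⟩
      refine hx b s ?_
      simp only [RAtom.arg_bind, hs, Option.bind_some, if_neg hn]
    · exact ⟨fun _ => π 0, fun h => absurd h hγ⟩
  choose x hx using hval
  -- An unbound variable gets the value found at its occurrence; uniqueness makes the choice of
  -- occurrence irrelevant.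
  let π' : ℕ → I.Dom := fun v =>
    if h : p.Unbound v ∧ ∃ c : (RAtom NC NR NI × ℝ) × Bool,
      c.1 ∈ p.body ∧ c.1.1.arg c.2 = some (.var v) then x h.2.choose.1 h.2.choose.2 else π v
  have hπ' : ∀ v, ¬ p.Unbound v → π' v = π v := fun v hv => dif_neg fun h => hv h.1
  have hterm : ∀ s : Term NI, (¬ ∃ v, s = .var v ∧ p.Unbound v) →
      s.eval I.ind π' = s.eval I.ind π := by
    rintro (a | v) hs
    · rfl
    · exact hπ' v fun h => hs ⟨v, rfl, h⟩
  refine ⟨π', fun i => ?_, fun γ hγ => (exists_match_iff_argDegree hI).2 ⟨x γ, ?_, (hx γ hγ).2⟩⟩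
  · rw [hterm]
    · exact hhead i
    · rintro ⟨v, hv, hu⟩
      exact hu.1 i hv
  · intro b s hs
    by_cases hu : ∃ v, s = .var v ∧ p.Unbound v
    · obtain ⟨v, rfl, hu⟩ := hu
      have hex : p.Unbound v ∧ ∃ c : (RAtom NC NR NI × ℝ) × Bool,
        c.1 ∈ p.body ∧ c.1.1.arg c.2 = some (.var v) := ⟨hu, (γ, b), hγ, hs⟩
      obtain ⟨h1, h2⟩ := hu.unique hex.2.choose_spec.1 hγ hex.2.choose_spec.2 hs
      show π' v = _
      simp only [π', dif_pos hex, h1, h2]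
    · rw [hterm s hu]
      exact (hx γ hγ).1 b s hs hu

/-- The raised threshold on the left-hand side gives `d ≤ x ⊗ e`, and residuation turns the axiom
into `x ⊗ e ≤ y`. -/
theorem exists_match_of_gr {tn : TNorm} {α : FAxiom NC NR} {γ η : RAtom NC NR NI × ℝ}
    (hI : I.Witnessed) (hα : I.SatAxiom tn α) (h : Gr tn α γ η) (hpos : 0 < γ.2)
    (hη : ∃ F, RAtom.Match I.ind π η.1 F ∧ η.2 ≤ I.degree F) :
    ∃ F, RAtom.Match I.ind π γ.1 F ∧ γ.2 ≤ I.degree F := by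
  cases h with
  | concept B B' e t d hde =>
    obtain ⟨x, hx, hd⟩ := (exists_match_atom_concept_iff hI).1 hη
    refine (exists_match_atom_concept_iff hI).2 ⟨x, hx, ?_⟩
    have hB := I.basicConcept_mem_Icc B x
    exact ((TNorm.le_conj_iff_raise_le hpos hde).2 hd).trans
      ((TNorm.conj_le_iff hB.1 (I.basicConcept_mem_Icc B' x).1 e.2.2).2 (hα x))
  | role Q Q' e s t d hde =>
    obtain ⟨x, y, hx, hy, hd⟩ := (exists_match_atom_role_iff hI).1 hη
    refine (exists_match_atom_role_iff hI).2 ⟨x, y, hx, hy, ?_⟩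
    have hB := I.basicRole_mem_Icc Q x y
    exact ((TNorm.le_conj_iff_raise_le hpos hde).2 hd).trans
      ((TNorm.conj_le_iff hB.1 (I.basicRole_mem_Icc Q' x y).1 e.2.2).2 (hα x y))

/-- Where both atoms name an argument, the unifier equates the terms; where one has `_`, the merged
atom has taken the argument of the other. Hence the same elements serve both atoms. -/
theorem exists_match_of_merge (hI : I.Witnessed) {α β : RAtom NC NR NI} {σ : ℕ → Term NI}
    (h : α.mgu β = some σ) {d : ℝ}
    (hm : ∃ F, RAtom.Match I.ind π ((α.merge β).subst σ) F ∧ d ≤ I.degree F) :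
    (∃ F, RAtom.Match I.ind (fun v => (σ v).eval I.ind π) α F ∧ d ≤ I.degree F) ∧
      ∃ F, RAtom.Match I.ind (fun v => (σ v).eval I.ind π) β F ∧ d ≤ I.degree F := by
  simp only [RAtom.match_subst, exists_match_iff_argDegree hI] at hm ⊢
  obtain ⟨x, hx, hd⟩ := hm
  have hunif : ∀ {s t : Term NI}, s.subst σ = t.subst σ →
      s.eval I.ind (fun v => (σ v).eval I.ind π) = t.eval I.ind fun v => (σ v).eval I.ind π := by
    intro s t hst
    rw [← Term.eval_subst, ← Term.eval_subst, hst]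
  rcases α with ⟨A, t⟩ | ⟨P, s, t⟩ <;> rcases β with ⟨A', t'⟩ | ⟨P', s', t'⟩
  · simp only [RAtom.mgu] at h
    split_ifs at h with hA
    subst hA
    obtain ⟨h1, h2⟩ := RTerm.TakesIn.of_orElse (hx true) (by
      rintro a rfl a' rfl
      exact hunif (mguTerm_unifies h))
    exact ⟨⟨x, by rintro (_ | _); exacts [RTerm.takesIn_none _, h1], hd⟩,
      x, by rintro (_ | _); exacts [RTerm.takesIn_none _, h2], hd⟩
  · cases h
  · cases h
  · have hP : P = P' := by
      by_contra hP
      simp [RAtom.mgu, hP] at h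
    subst hP
    obtain ⟨h1, h2⟩ := RAtom.mgu_role h
    obtain ⟨a1, a2⟩ := RTerm.TakesIn.of_orElse (hx false) fun a ha a' ha' => hunif (h1 a ha a' ha')
    obtain ⟨b1, b2⟩ := RTerm.TakesIn.of_orElse (hx true) fun a ha a' ha' => hunif (h2 a ha a' ha')
    exact ⟨⟨x, by rintro (_ | _); exacts [a1, b1], hd⟩, x, by rintro (_ | _); exacts [a2, b2], hd⟩

/-- Soundness of a single step, read from the new query back to the old one. A unification is undone
by composing the assignment with the unifier; the larger threshold of the merged atom covers both
originals. -/
theorem RQuery.SatIn.of_step {tn : TNorm} {T : TBox NC NR} (hI : I.Witnessed)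
    (hT : ∀ α ∈ T, I.SatAxiom tn α) {a : Fin k → NI} {p p' : RQuery NC NR NI k}
    (hpos : ∀ γ ∈ p.body, 0 < γ.2) (hs : Step tn T p p') (h : p'.SatIn I a) : p.SatIn I a := by
  classical
  cases hs with
  | apply α γ η hα hγ hg =>
    obtain ⟨π, hhead, hbody⟩ := h.of_anon hI
    refine ⟨π, hhead, fun γ' hγ' => ?_⟩
    by_cases h : γ' = γ
    · subst h
      exact exists_match_of_gr hI (hT α hα) hg (hpos _ hγ)
        (hbody η (Finset.mem_insert_self _ _))
    · exact hbody γ' (Finset.mem_insert_of_mem (Finset.mem_erase.2 ⟨h, hγ'⟩))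
  | reduce γ₁ γ₂ σ h₁ h₂ hσ =>
    obtain ⟨π, hhead, hbody⟩ := h.of_anon hI
    obtain ⟨⟨F₁, m₁, d₁⟩, F₂, m₂, d₂⟩ :=
      exists_match_of_merge hI hσ (hbody _ (Finset.mem_insert_self _ _))
    refine ⟨fun v => (σ v).eval I.ind π, fun i => ?_, fun γ hγ => ?_⟩
    · rw [← Term.eval_subst]
      exact hhead i
    · by_cases e₁ : γ = γ₁
      · subst e₁; exact ⟨F₁, m₁, (le_max_left _ _).trans d₁⟩
      by_cases e₂ : γ = γ₂
      · subst e₂; exact ⟨F₂, m₂, (le_max_right _ _).trans d₂⟩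
      have := hbody (γ.1.subst σ, γ.2) (Finset.mem_insert_of_mem
        (Finset.mem_image_of_mem (fun γ => (γ.1.subst σ, γ.2))
          (Finset.mem_erase.2 ⟨e₂, Finset.mem_erase.2 ⟨e₁, hγ⟩⟩)))
      simpa only [RAtom.match_subst] using this

theorem toRAtom_match_iff (hI : I.Witnessed) (α : Atom NC NR NI) (d : ℝ) :
    (∃ F, RAtom.Match I.ind π α.toRAtom F ∧ d ≤ I.degree F) ↔ d ≤ α.degree I π := by
  cases α with
  | concept B t =>
    rw [Atom.toRAtom, exists_match_atom_concept_iff hI]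
    constructor
    · rintro ⟨x, hx, hd⟩
      rw [RTerm.takesIn_some] at hx
      subst hx
      exact hd
    · exact fun h => ⟨_, RTerm.takesIn_some.2 rfl, h⟩
  | role P s t =>
    rw [Atom.toRAtom, exists_match_iff_argDegree hI]
    constructor
    · rintro ⟨x, hx, hd⟩
      have h1 := RTerm.takesIn_some.1 (hx false)
      have h2 := RTerm.takesIn_some.1 (hx true)
      simp only [Interp.argDegree, ← h1, ← h2] at hd
      exact hd
    · exact fun h => ⟨fun b => cond b (t.eval I.ind π) (s.eval I.ind π), by
        rintro (_ | _) <;> exact RTerm.takesIn_some.2 rfl, h⟩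

theorem TQ.isAnswer_of_satIn (hI : I.Witnessed) {q : TQ NC NR NI k} {a : Fin k → NI}
    (h : q.toRQuery.SatIn I a) : q.IsAnswer I a := by
  classical
  obtain ⟨π, hhead, hbody⟩ := h.of_anon hI
  exact ⟨π, hhead, fun γ hγ =>
    (toRAtom_match_iff hI γ.1 γ.2).1 (hbody _ (Finset.mem_image_of_mem _ hγ))⟩

/-- An atom holds in the database iff it matches a fact of the ABox of sufficient degree. -/
theorem dbSat_iff {A : ABox NC NR NI} {h : ℕ → NI} {γ : RAtom NC NR NI × ℝ} :
    DBSat A h γ ↔ ∃ F e, RAtom.Match id h γ.1 F ∧ γ.2 ≤ e ∧ InABox A F e := by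
  obtain ⟨α, d⟩ := γ
  rcases α with ⟨N, t⟩ | ⟨P, s, t⟩
  · constructor
    · rintro ⟨a, e, hd, ht, hA⟩
      exact ⟨_, e, .concept ht, hd, e, rfl, hA⟩
    · rintro ⟨F, e, hF, hd, hA⟩
      cases hF with
      | concept ht =>
        obtain ⟨e, rfl, hA⟩ := hA
        exact ⟨_, e, hd, ht, hA⟩
  · constructor
    · rintro (⟨a, b, e, hd, hs, ht, hA⟩ | ⟨rfl, a, e, hd, hs, hA⟩ | ⟨rfl, b, e, hd, ht, hA⟩)
      · exact ⟨_, e, .role hs ht, hd, e, rfl, hA⟩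
      · exact ⟨_, e, .exName hs, hd, e, rfl, hA⟩
      · exact ⟨_, e, .exInv ht, hd, e, rfl, hA⟩
    · rintro ⟨F, e, hF, hd, hA⟩
      cases hF with
      | role hs ht =>
        obtain ⟨e, rfl, hA⟩ := hA
        exact Or.inl ⟨_, _, e, hd, hs, ht, hA⟩
      | exName hs =>
        obtain ⟨e, rfl, hA⟩ := hA
        exact Or.inr (Or.inl ⟨rfl, _, e, hd, hs, hA⟩)
      | exInv ht =>
        obtain ⟨e, rfl, hA⟩ := hA
        exact Or.inr (Or.inr ⟨rfl, _, e, hd, ht, hA⟩)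

theorem RTerm.TakesIn.map {X Y : Type u} {ind : NI → X} {π : ℕ → X} (f : X → Y) {t : RTerm NI}
    {x : X} (h : RTerm.TakesIn ind π t x) :
    RTerm.TakesIn (fun a => f (ind a)) (fun v => f (π v)) t (f x) := by
  intro s hs
  rw [← h s hs]
  cases s <;> rfl

theorem RAtom.Match.map {X Y : Type u} {ind : NI → X} {π : ℕ → X} (f : X → Y)
    {α : RAtom NC NR NI} {F : GFact NC NR X} (h : RAtom.Match ind π α F) :
    RAtom.Match (fun a => f (ind a)) (fun v => f (π v)) α (F.map f) := by
  cases h with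
  | concept h => exact .concept (h.map f)
  | role hs ht => exact .role (hs.map f) (ht.map f)
  | exName h => exact .exName (h.map f)
  | exInv h => exact .exInv (h.map f)

theorem RQuery.satIn_of_dbSat {tn : TNorm} {T : TBox NC NR} {A : ABox NC NR NI}
    (hI : I.IsModel tn T A) {a : Fin k → NI} {p : RQuery NC NR NI k} {h : ℕ → NI}
    (hhead : ∀ i, (p.head i).eval id h = a i) (hbody : ∀ γ ∈ p.body, DBSat A h γ) :
    p.SatIn I a := by
  refine ⟨fun v => I.ind (h v), fun i => ?_, fun γ hγ => ?_⟩
  · rw [← hhead i]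
    cases p.head i <;> rfl
  · obtain ⟨F, e, hF, hd, hA⟩ := dbSat_iff.1 (hbody γ hγ)
    exact ⟨F.map I.ind, hF.map I.ind, hd.trans (hI.le_degree_of_inABox hA)⟩

/-- Soundness of the rewriting. -/
theorem dbAnswers_subset_certainAnswers {tn : TNorm} {T : TBox NC NR} {A : ABox NC NR NI}
    {q : TQ NC NR NI k} (hpos : ∀ γ ∈ q.body, 0 < γ.2) (n : ℕ) :
    dbAnswers A (perfectRef tn T q n) ⊆ q.certainAnswers tn T A := by
  rintro a ⟨p, hp, h, hhead, hbody⟩ I hI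
  have hpos' : ∀ n, ∀ p ∈ perfectRef tn T q n, ∀ γ ∈ p.body, 0 < γ.2 := by
    intro n p hp γ hγ
    refine ((thresholds_perfectRef n p hp γ hγ).mem_Ioc ?_ T.degrees_subset).1
    rintro _ ⟨γ, hγ, rfl⟩
    exact ⟨hpos γ hγ, γ.2.2.2⟩
  -- Satisfaction is traced back along the rewriting to the starting query.
  have key : ∀ n, ∀ p ∈ perfectRef tn T q n, p.SatIn I a → q.toRQuery.SatIn I a := by
    intro n
    induction n with
    | zero => rintro p rfl hp; exact hp
    | succ n ih =>
      intro p hp hsat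
      rw [perfectRef, Function.iterate_succ_apply'] at hp
      rcases hp with hp | ⟨p', hp', hs⟩
      · exact ih p hp hsat
      · exact ih p' hp' (hsat.of_step hI.witnessed hI.tbox (hpos' n p' hp') hs)
  exact TQ.isAnswer_of_satIn hI.witnessed (key n p hp (RQuery.satIn_of_dbSat hI hhead hbody))

end FuzzyDLLite

namespace FuzzyDLLite

variable {NC NR NI : Type u} {k : ℕ}

/-! ### The canonical model -/

/-- The elements of the canonical model: individual names, and a `Q`-successor of every element
for every basic role `Q`. -/
inductive Elem (NR NI : Type u) where
  | ind (a : NI)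
  | null (x : Elem NR NI) (Q : BasicRole NR)

/-- `Chase tn T A n F d`: the fact `F` is derived to degree `d` in `n` steps. -/
inductive Chase (tn : TNorm) (T : TBox NC NR) (A : ABox NC NR NI) :
    ℕ → GFact NC NR (Elem NR NI) → ℝ → Prop
  | abox {F d} (h : InABox A F d) : Chase tn T A 0 (F.map Elem.ind) d
  | ex {n Q x y d} (h : Chase tn T A n (BasicRole.fact Q x y) d) :
      Chase tn T A (n + 1) (.con (.ex Q) x) d
  | wit {n Q x d} (h : Chase tn T A n (.con (.ex Q) x) d) :
      Chase tn T A (n + 1) (BasicRole.fact Q x (.null x Q)) d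
  | concept {n B B' e x d} (hT : FAxiom.concept B (.pos B') e ∈ T)
      (h : Chase tn T A n (.con B x) d) : Chase tn T A (n + 1) (.con B' x) (tn.conj d e)
  | role {n Q Q' e x y d} (hT : FAxiom.role Q (.pos Q') e ∈ T)
      (h : Chase tn T A n (BasicRole.fact Q x y) d) :
      Chase tn T A (n + 1) (BasicRole.fact Q' x y) (tn.conj d e)

/-- The degrees of the assertions of an ABox. -/
def ABox.degrees (A : ABox NC NR NI) : Set ℝ :=
  (fun β : Assertion NC NR NI unitInterval =>
    match β with
    | .concept _ _ d => (d : ℝ)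
    | .role _ _ _ d => (d : ℝ)) '' (A : Set (Assertion NC NR NI unitInterval))

variable {tn : TNorm} {T : TBox NC NR} {A : ABox NC NR NI}

theorem ABox.finite_degrees (A : ABox NC NR NI) : A.degrees.Finite :=
  A.finite_toSet.image _

theorem ABox.degrees_subset (A : ABox NC NR NI) : A.degrees ⊆ Set.Icc 0 1 := by
  rintro _ ⟨β, -, rfl⟩
  cases β
  · exact Subtype.property _
  · exact Subtype.property _

/-- This lets the finiteness result for conjunctions control all derived degrees at once, although
the chase itself may be infinite. -/
theorem Chase.conjClosure {n : ℕ} {F : GFact NC NR (Elem NR NI)} {d : ℝ}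
    (h : Chase tn T A n F d) : ConjClosure tn A.degrees T.degrees d := by
  induction h with
  | @abox F d h =>
    cases F with
    | con B a => obtain ⟨e, rfl, h⟩ := h; exact .base ⟨_, h, rfl⟩
    | rol P a b => obtain ⟨e, rfl, h⟩ := h; exact .base ⟨_, h, rfl⟩
  | ex _ ih => exact ih
  | wit _ ih => exact ih
  | concept hT _ ih => exact ih.step ⟨_, hT, rfl⟩
  | role hT _ ih => exact ih.step ⟨_, hT, rfl⟩

theorem Chase.mem_Icc {n : ℕ} {F : GFact NC NR (Elem NR NI)} {d : ℝ}
    (h : Chase tn T A n F d) : d ∈ Set.Icc (0 : ℝ) 1 :=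
  h.conjClosure.mem_Icc A.degrees_subset T.degrees_subset

/-- The degree of a fact in the canonical model. -/
noncomputable def chaseDegree (tn : TNorm) (T : TBox NC NR) (A : ABox NC NR NI)
    (F : GFact NC NR (Elem NR NI)) : ℝ :=
  sSup {d | ∃ n, Chase tn T A n F d}

theorem Chase.le_chaseDegree {n : ℕ} {F : GFact NC NR (Elem NR NI)} {d : ℝ}
    (h : Chase tn T A n F d) : d ≤ chaseDegree tn T A F :=
  le_csSup ⟨1, by rintro _ ⟨m, hm⟩; exact hm.mem_Icc.2⟩ ⟨n, h⟩

theorem chaseDegree_mem_Icc (F : GFact NC NR (Elem NR NI)) :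
    chaseDegree tn T A F ∈ Set.Icc (0 : ℝ) 1 :=
  ⟨Real.sSup_nonneg (by rintro _ ⟨m, hm⟩; exact hm.mem_Icc.1),
    Real.sSup_le (by rintro _ ⟨m, hm⟩; exact hm.mem_Icc.2) zero_le_one⟩

/-- Positive degrees in the canonical model are attained by derivations. -/
theorem exists_chase_of_pos {F : GFact NC NR (Elem NR NI)} (h : 0 < chaseDegree tn T A F) :
    ∃ n, Chase tn T A n F (chaseDegree tn T A F) := by
  set s := chaseDegree tn T A F with hs
  obtain ⟨d, ⟨n, hd⟩, hlt⟩ : ∃ d ∈ {d | ∃ n, Chase tn T A n F d}, s / 2 < d :=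
    exists_lt_of_lt_csSup (by
      by_contra hne
      rw [Set.not_nonempty_iff_eq_empty] at hne
      rw [chaseDegree, hne, Real.sSup_empty] at hs
      exact h.ne' hs) (by change s / 2 < s; linarith)
  -- Only finitely many derived degrees lie above `s / 2 > 0`, so the supremum is a maximum.
  have hfin : {d | (∃ n, Chase tn T A n F d) ∧ s / 2 ≤ d}.Finite :=
    (ConjClosure.finite_ge A.finite_degrees T.finite_degrees A.degrees_subset T.degrees_subset
      (half_pos h)).subset fun d ⟨⟨n, hn⟩, hd⟩ => ⟨hn.conjClosure, hd⟩
  obtain ⟨m, ⟨⟨n', hm⟩, hm2⟩, hmax⟩ := hfin.exists_maximal ⟨d, ⟨n, hd⟩, hlt.le⟩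
  have hle : s ≤ m := by
    refine csSup_le ⟨d, n, hd⟩ ?_
    rintro x ⟨l, hx⟩
    rcases le_total x m with h' | h'
    · exact h'
    · exact hmax ⟨⟨l, hx⟩, hm2.trans h'⟩ h'
  exact ⟨n', (hle.antisymm hm.le_chaseDegree) ▸ hm⟩

theorem chaseDegree_eq_zero_or (F : GFact NC NR (Elem NR NI)) :
    chaseDegree tn T A F = 0 ∨ ∃ n, Chase tn T A n F (chaseDegree tn T A F) := by
  rcases (chaseDegree_mem_Icc (tn := tn) (T := T) (A := A) F).1.lt_or_eq with h | h
  · exact Or.inr (exists_chase_of_pos h)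
  · exact Or.inl h.symm

/-- The canonical model. -/
noncomputable abbrev canonical [Nonempty NI] (tn : TNorm) (T : TBox NC NR) (A : ABox NC NR NI) :
    Interp NC NR NI where
  Dom := Elem NR NI
  nonempty := ⟨.ind (Classical.arbitrary NI)⟩
  ind := .ind
  con N x := ⟨chaseDegree tn T A (.con (.name N) x), chaseDegree_mem_Icc _⟩
  rol P x y := ⟨chaseDegree tn T A (.rol P x y), chaseDegree_mem_Icc _⟩

theorem canonical_basicRole [Nonempty NI] (Q : BasicRole NR) (x y : Elem NR NI) :
    (canonical tn T A).basicRole Q x y = chaseDegree tn T A (Q.fact x y) := by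
  cases Q <;> rfl

/-- A derivation of `Q(x,y)` extends through `∃ Q` at `x` to the designated successor with no loss
of degree. That successor therefore attains the supremum, which makes the canonical interpretation
witnessed. -/
theorem chaseDegree_fact_le_null (Q : BasicRole NR) (x y : Elem NR NI) :
    chaseDegree tn T A (Q.fact x y) ≤ chaseDegree tn T A (Q.fact x (.null x Q)) := by
  rcases chaseDegree_eq_zero_or (tn := tn) (T := T) (A := A) (Q.fact x y) with h | ⟨n, h⟩
  · rw [h]; exact (chaseDegree_mem_Icc _).1
  · exact h.ex.wit.le_chaseDegree

theorem canonical_ex_eq [Nonempty NI] (Q : BasicRole NR) (x : Elem NR NI) :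
    (canonical tn T A).basicConcept (.ex Q) x =
      chaseDegree tn T A (Q.fact x (.null x Q)) := by
  refine le_antisymm ?_ ?_
  · have := (canonical tn T A).nonempty
    refine ciSup_le fun y => ?_
    rw [canonical_basicRole]
    exact chaseDegree_fact_le_null Q x y
  · rw [← canonical_basicRole]
    exact (canonical tn T A).basicRole_le Q x (.null x Q)

theorem canonical_witnessed [Nonempty NI] : (canonical tn T A).Witnessed := fun Q x =>
  ⟨.null x Q, by rw [canonical_ex_eq, canonical_basicRole]⟩

/-- The semantic degree of `∃ Q`, a supremum over successors, agrees with its derived degree because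
the chase rules `ex` and `wit` pass between the two. -/
theorem canonical_basicConcept [Nonempty NI] (B : BasicConcept NC NR) (x : Elem NR NI) :
    (canonical tn T A).basicConcept B x = chaseDegree tn T A (.con B x) := by
  cases B with
  | name N => rfl
  | ex Q =>
    rw [canonical_ex_eq]
    refine le_antisymm ?_ ?_
    · rcases chaseDegree_eq_zero_or (tn := tn) (T := T) (A := A) (Q.fact x (.null x Q))
        with h | ⟨n, h⟩
      · rw [h]; exact (chaseDegree_mem_Icc _).1
      · exact h.ex.le_chaseDegree
    · rcases chaseDegree_eq_zero_or (tn := tn) (T := T) (A := A) (.con (.ex Q) x)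
        with h | ⟨n, h⟩
      · rw [h]; exact (chaseDegree_mem_Icc _).1
      · exact h.wit.le_chaseDegree

theorem canonical_degree [Nonempty NI] (F : GFact NC NR (Elem NR NI)) :
    (canonical tn T A).degree F = chaseDegree tn T A F := by
  cases F with
  | con B x => exact canonical_basicConcept B x
  | rol P x y => rfl

/-- The canonical model maps homomorphically into every model. -/
theorem Interp.IsModel.exists_hom {I : Interp NC NR NI} (hI : I.IsModel tn T A) :
    ∃ f : Elem NR NI → I.Dom, ∀ F, chaseDegree tn T A F ≤ I.degree (F.map f) := by
  choose w hw using hI.witnessed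
  -- A new `Q`-successor goes to a witness of `∃ Q` at the image of its parent.
  let f : Elem NR NI → I.Dom := fun x => Elem.rec (fun a => I.ind a) (fun _ Q y => w Q y) x
  refine ⟨f, fun F => Real.sSup_le ?_ (I.degree_mem_Icc _).1⟩
  rintro d ⟨n, h⟩
  induction h with
  | @abox F d h =>
    have : (F.map Elem.ind).map f = F.map I.ind := by cases F <;> rfl
    rw [this]
    exact hI.le_degree_of_inABox h
  | @ex n Q x y d _ ih =>
    rw [BasicRole.map_fact, I.degree_fact] at ih
    exact ih.trans (I.basicRole_le Q _ _)
  | @wit n Q x d _ ih =>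
    rw [BasicRole.map_fact, I.degree_fact]
    exact ih.trans (hw Q (f x)).ge
  | @concept n B B' e x d hT h ih =>
    refine (TNorm.conj_mono e.2.1 ih).trans ?_
    exact (TNorm.conj_le_iff (I.degree_mem_Icc _).1 (I.basicConcept_mem_Icc _ _).1 e.2.2).2
      (hI.tbox _ hT (f x))
  | @role n Q Q' e x y d hT h ih =>
    simp only [BasicRole.map_fact, I.degree_fact] at ih ⊢
    refine (TNorm.conj_mono e.2.1 ih).trans ?_
    exact (TNorm.conj_le_iff (I.basicRole_mem_Icc _ _ _).1 (I.basicRole_mem_Icc _ _ _).1 e.2.2).2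
      (hI.tbox _ hT (f x) (f y))

/-- The canonical model of a consistent ontology is a model. -/
theorem canonical_isModel [Nonempty NI] (h : Consistent tn T A) : (canonical tn T A).IsModel tn T A := by
  obtain ⟨I, hI⟩ := h
  obtain ⟨f, hf⟩ := hI.exists_hom
  have hcon : ∀ B x, (canonical tn T A).basicConcept B x ≤ I.basicConcept B (f x) := fun B x => by
    rw [canonical_basicConcept]; exact hf (.con B x)
  have hrol : ∀ Q x y, (canonical tn T A).basicRole Q x y ≤ I.basicRole Q (f x) (f y) :=
    fun Q x y => by
      rw [canonical_basicRole]
      refine (hf _).trans ?_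
      rw [BasicRole.map_fact, I.degree_fact]
  refine ⟨canonical_witnessed, ?_, ?_⟩
  · rintro (⟨B, (B' | B'), e⟩ | ⟨Q, (Q' | Q'), e⟩) hα
    · intro x
      refine (TNorm.conj_le_iff ((canonical tn T A).basicConcept_mem_Icc _ _).1
        ((canonical tn T A).basicConcept_mem_Icc _ _).1 e.2.2).1 ?_
      rw [canonical_basicConcept, canonical_basicConcept]
      rcases chaseDegree_eq_zero_or (tn := tn) (T := T) (A := A) (.con B x) with h | ⟨n, h⟩
      · rw [h]
        exact (TNorm.conj_le_left le_rfl e.2.2).trans (chaseDegree_mem_Icc _).1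
      · exact (h.concept hα).le_chaseDegree
    · intro x
      -- Negative axioms transfer from the given model: degrees in the canonical interpretation are
      -- no larger, so the left-hand side shrinks and the residual negation on the right grows.
      exact (hI.tbox _ hα (f x)).trans <|
        (TNorm.residuum_anti ((canonical tn T A).basicConcept_mem_Icc B x).1 (hcon B x)
          (TNorm.neg_mem_Icc (I.basicConcept_mem_Icc _ _).2).1
          (TNorm.neg_mem_Icc (I.basicConcept_mem_Icc _ _).2).2).trans
        (TNorm.residuum_mono ((canonical tn T A).basicConcept_mem_Icc _ _).1
          ((canonical tn T A).basicConcept_mem_Icc _ _).2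
          (TNorm.neg_anti ((canonical tn T A).basicConcept_mem_Icc _ _).1 (hcon B' x)))
    · intro x y
      refine (TNorm.conj_le_iff ((canonical tn T A).basicRole_mem_Icc _ _ _).1
        ((canonical tn T A).basicRole_mem_Icc _ _ _).1 e.2.2).1 ?_
      rw [canonical_basicRole, canonical_basicRole]
      rcases chaseDegree_eq_zero_or (tn := tn) (T := T) (A := A) (Q.fact x y) with h | ⟨n, h⟩
      · rw [h]
        exact (TNorm.conj_le_left le_rfl e.2.2).trans (chaseDegree_mem_Icc _).1
      · exact (h.role hα).le_chaseDegree
    · intro x y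
      exact (hI.tbox _ hα (f x) (f y)).trans <|
        (TNorm.residuum_anti ((canonical tn T A).basicRole_mem_Icc Q x y).1 (hrol Q x y)
          (TNorm.neg_mem_Icc (I.basicRole_mem_Icc _ _ _).2).1
          (TNorm.neg_mem_Icc (I.basicRole_mem_Icc _ _ _).2).2).trans
        (TNorm.residuum_mono ((canonical tn T A).basicRole_mem_Icc _ _ _).1
          ((canonical tn T A).basicRole_mem_Icc _ _ _).2
          (TNorm.neg_anti ((canonical tn T A).basicRole_mem_Icc _ _ _).1 (hrol Q' x y)))
  · rintro (⟨B, a, e⟩ | ⟨P, a, b, e⟩) hβ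
    · show (e : ℝ) ≤ (canonical tn T A).basicConcept B (.ind a)
      rw [canonical_basicConcept]
      exact (Chase.abox (F := .con B a) ⟨e, rfl, hβ⟩).le_chaseDegree
    · exact (Chase.abox (F := .rol P a b) ⟨e, rfl, hβ⟩).le_chaseDegree

end FuzzyDLLite

namespace FuzzyDLLite

variable {NC NR NI : Type u} {k : ℕ}

/-! ### Completeness of the rewriting -/

/-- Whether a term is not `_`, as a number. -/
def RTerm.count : RTerm NI → ℕ
  | none => 0
  | some _ => 1

/-- The number of arguments of an atom that are not `_`. -/
def RAtom.named (α : RAtom NC NR NI) : ℕ :=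
  (α.arg false).count + (α.arg true).count

theorem RAtom.named_atom_concept (B : BasicConcept NC NR) (t : RTerm NI) :
    (B.atom t).named = t.count := by
  rcases B with A | P | P <;> simp [named, BasicConcept.atom, BasicRole.atom, arg, RTerm.count]

theorem RAtom.named_atom_role (Q : BasicRole NR) (s t : RTerm NI) :
    (Q.atom s t : RAtom NC NR NI).named = s.count + t.count := by
  cases Q <;> simp [named, BasicRole.atom, arg, add_comm]

theorem RTerm.count_bind_le (t : RTerm NI) (f : Term NI → RTerm NI) :
    RTerm.count (t.bind f) ≤ t.count := by
  rcases t with _ | t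
  · exact le_rfl
  · simp only [Option.bind_some]
    cases f t <;> simp [count]

theorem RAtom.named_subst (α : RAtom NC NR NI) (σ : ℕ → Term NI) :
    (α.subst σ).named = α.named := by
  have : ∀ t : RTerm NI, RTerm.count (t.bind fun t => some (t.subst σ)) = t.count := by
    rintro (_ | t) <;> rfl
  simp only [named, subst, arg_bind, this]

/-- The side of an atom `Q(s,t)` on which `t` stands. -/
def BasicRole.side : BasicRole NR → Bool
  | .name _ => true
  | .inv _ => false

theorem BasicRole.arg_atom (Q : BasicRole NR) (s t : RTerm NI) (b : Bool) :
    (Q.atom s t : RAtom NC NR NI).arg b = if b = Q.side then t else s := by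
  cases Q <;> cases b <;> rfl

variable {tn : TNorm} {T : TBox NC NR} {A : ABox NC NR NI} {π : ℕ → Elem NR NI}

/-- The threshold atom matches a fact that is derived in `n` steps. -/
def ChaseSat (tn : TNorm) (T : TBox NC NR) (A : ABox NC NR NI) (π : ℕ → Elem NR NI) (n : ℕ)
    (γ : RAtom NC NR NI × ℝ) : Prop :=
  ∃ F d, RAtom.Match Elem.ind π γ.1 F ∧ γ.2 ≤ d ∧ Chase tn T A n F d

/-- The measure that decreases along the rewriting. -/
noncomputable def weight (tn : TNorm) (T : TBox NC NR) (A : ABox NC NR NI) (π : ℕ → Elem NR NI)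
    (γ : RAtom NC NR NI × ℝ) : ℕ :=
  1 + γ.1.named + sInf {n | ChaseSat tn T A π n γ}

theorem ChaseSat.weight_le {n : ℕ} {γ : RAtom NC NR NI × ℝ} (h : ChaseSat tn T A π n γ) :
    weight tn T A π γ ≤ 1 + γ.1.named + n :=
  Nat.add_le_add_left (Nat.sInf_le h) _

theorem exists_minimal_chaseSat {γ : RAtom NC NR NI × ℝ} (h : ∃ n, ChaseSat tn T A π n γ) :
    ∃ m, ChaseSat tn T A π m γ ∧ (∀ n < m, ¬ ChaseSat tn T A π n γ) ∧
      weight tn T A π γ = 1 + γ.1.named + m :=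
  ⟨_, Nat.sInf_mem h, fun _ hn => Nat.notMem_of_lt_sInf hn, rfl⟩

/-- The query `p` holds in the canonical model with total weight at most `N`. -/
structure RQuery.ChaseHolds (tn : TNorm) (T : TBox NC NR) (A : ABox NC NR NI) (a : Fin k → NI)
    (N : ℕ) (π : ℕ → Elem NR NI) (p : RQuery NC NR NI k) : Prop where
  head : ∀ i, (p.head i).eval Elem.ind π = Elem.ind (a i)
  body : ∀ γ ∈ p.body, ∃ n, ChaseSat tn T A π n γ
  sum_le : ∑ γ ∈ p.body, weight tn T A π γ ≤ N

/-- Query bodies are sets, so threshold atoms may coincide after substitution or anonymization; this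
can only lower the total weight. -/
theorem sum_image_le {ι κ : Type*} [DecidableEq κ] (s : Finset ι) (g : ι → κ) (f : κ → ℕ) :
    ∑ x ∈ s.image g, f x ≤ ∑ x ∈ s, f (g x) := by
  classical
  induction s using Finset.induction_on with
  | empty => simp
  | insert a s ha ih =>
    rw [Finset.image_insert, Finset.sum_insert ha]
    by_cases h : g a ∈ s.image g
    · rw [Finset.insert_eq_of_mem h]; omega
    · rw [Finset.sum_insert h]; omega

theorem sum_insert_le {ι : Type*} [DecidableEq ι] (s : Finset ι) (a : ι) (f : ι → ℕ) :
    ∑ x ∈ insert a s, f x ≤ f a + ∑ x ∈ s, f x := by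
  by_cases h : a ∈ s
  · rw [Finset.insert_eq_of_mem h]; omega
  · rw [Finset.sum_insert h]

theorem ChaseSat.bind {n : ℕ} {γ : RAtom NC NR NI × ℝ} {f : Term NI → RTerm NI}
    (hf : ∀ s, ∀ s' ∈ f s, s'.eval Elem.ind π = s.eval Elem.ind π)
    (h : ChaseSat tn T A π n γ) : ChaseSat tn T A π n (γ.1.bind f, γ.2) := by
  obtain ⟨F, d, hF, hd, hc⟩ := h
  exact ⟨F, d, hF.bind fun s _ => hf s, hd, hc⟩

theorem RAtom.named_bind_le (α : RAtom NC NR NI) (f : Term NI → RTerm NI) :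
    (α.bind f).named ≤ α.named := by
  simp only [named, arg_bind]
  exact add_le_add (RTerm.count_bind_le _ f) (RTerm.count_bind_le _ f)

theorem RAtom.named_bind_lt {α : RAtom NC NR NI} {f : Term NI → RTerm NI} {b : Bool} {t : Term NI}
    (hb : α.arg b = some t) (ht : f t = none) : (α.bind f).named < α.named := by
  have h : RTerm.count ((α.arg b).bind f) < (α.arg b).count := by
    simp [hb, ht, RTerm.count]
  simp only [named, arg_bind]
  cases b
  · exact add_lt_add_of_lt_of_le h (RTerm.count_bind_le _ f)
  · exact add_lt_add_of_le_of_lt (RTerm.count_bind_le _ f) h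

/-- The height part of the weight does not grow, as every match of the old atom is one of the new
atom. The form with named counts on both sides avoids subtraction. -/
theorem weight_bind_le {γ : RAtom NC NR NI × ℝ} (h : ∃ n, ChaseSat tn T A π n γ)
    {f : Term NI → RTerm NI}
    (hf : ∀ s, ∀ s' ∈ f s, s'.eval Elem.ind π = s.eval Elem.ind π) :
    weight tn T A π (γ.1.bind f, γ.2) + γ.1.named ≤
      weight tn T A π γ + (γ.1.bind f).named := by
  obtain ⟨m, hm, -, hw⟩ := exists_minimal_chaseSat h
  have := (hm.bind hf).weight_le
  simp only at this
  omega

open Classical in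
/-- A term that stays when unbound variables are made anonymous keeps its value. -/
theorem anon_term_eval (p : RQuery NC NR NI k) (s : Term NI) :
    ∀ s' ∈ (if ∃ v, s = .var v ∧ p.Unbound v then none else some s : RTerm NI),
      s'.eval Elem.ind π = s.eval Elem.ind π := by
  intro s' hs'
  split_ifs at hs'
  · cases hs'
  · cases hs'; rfl

variable {a : Fin k → NI} {N : ℕ}

theorem RQuery.ChaseHolds.anon {p : RQuery NC NR NI k} (h : p.ChaseHolds tn T A a N π) :
    p.anon.ChaseHolds tn T A a N π := by
  classical
  refine ⟨h.head, ?_, ?_⟩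
  · intro γ hγ
    simp only [RQuery.anon, Finset.mem_image] at hγ
    obtain ⟨γ, hγ, rfl⟩ := hγ
    obtain ⟨n, hn⟩ := h.body γ hγ
    exact ⟨n, hn.bind (anon_term_eval p)⟩
  · refine (sum_image_le _ _ _).trans ((Finset.sum_le_sum fun γ hγ => ?_).trans h.sum_le)
    have h1 := weight_bind_le (h.body γ hγ) (anon_term_eval p)
    have h2 := γ.1.named_bind_le fun t => if ∃ v, t = .var v ∧ p.Unbound v then none else some t
    omega

/-- The operation `anon` decreases the weight if there is an unbound variable. -/
theorem RQuery.ChaseHolds.anon_lt {p : RQuery NC NR NI k} (h : p.ChaseHolds tn T A a N π)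
    {γ : RAtom NC NR NI × ℝ} (hγ : γ ∈ p.body) {b : Bool} {v : ℕ}
    (hb : γ.1.arg b = some (.var v)) (hv : p.Unbound v) :
    ∃ M < N, p.anon.ChaseHolds tn T A a M π := by
  classical
  refine ⟨_, lt_of_lt_of_le ?_ h.sum_le, h.anon.head, h.anon.body, le_rfl⟩
  refine (sum_image_le _ _ _).trans_lt (Finset.sum_lt_sum (fun γ hγ => ?_) ⟨γ, hγ, ?_⟩)
  · have h1 := weight_bind_le (h.body γ hγ) (anon_term_eval p)
    have h2 := γ.1.named_bind_le fun t => if ∃ v, t = .var v ∧ p.Unbound v then none else some t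
    omega
  · have h1 := weight_bind_le (h.body γ hγ) (anon_term_eval p)
    have h2 := RAtom.named_bind_lt
      (f := fun t => if ∃ v, t = .var v ∧ p.Unbound v then none else some t) hb
      (if_pos ⟨v, rfl, hv⟩)
    omega

theorem RQuery.ChaseHolds.replace_lt {p : RQuery NC NR NI k} (h : p.ChaseHolds tn T A a N π)
    {γ η : RAtom NC NR NI × ℝ} (hγ : γ ∈ p.body) (hη : ∃ n, ChaseSat tn T A π n η)
    (hlt : weight tn T A π η < weight tn T A π γ) :
    ∃ M < N, (p.replace γ η).ChaseHolds tn T A a M π := by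
  classical
  refine ⟨_, lt_of_lt_of_le ?_ h.sum_le, h.head, ?_, le_rfl⟩
  · refine (sum_insert_le _ _ _).trans_lt ?_
    rw [← Finset.add_sum_erase _ _ hγ]
    omega
  · intro γ' hγ'
    rcases Finset.mem_insert.1 hγ' with rfl | hγ'
    · exact hη
    · exact h.body _ (Finset.mem_of_mem_erase hγ')

/-- Since `π` absorbs `σ`, substitution changes neither matches nor weights; the decrease comes from
replacing two atoms by their merger. -/
theorem RQuery.ChaseHolds.reduce_lt {p : RQuery NC NR NI k} (h : p.ChaseHolds tn T A a N π)
    {γ₁ γ₂ : RAtom NC NR NI × ℝ} (h₁ : γ₁ ∈ p.body) (h₂ : γ₂ ∈ p.body) (hne : γ₁ ≠ γ₂)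
    {σ : ℕ → Term NI} (hσ : ∀ v, (σ v).eval Elem.ind π = π v)
    (hm : ∃ n, ChaseSat tn T A π n (γ₁.1.merge γ₂.1, max γ₁.2 γ₂.2))
    (hlt : weight tn T A π (γ₁.1.merge γ₂.1, max γ₁.2 γ₂.2) <
      weight tn T A π γ₁ + weight tn T A π γ₂) :
    ∃ M < N, (p.reduce γ₁ γ₂ σ).ChaseHolds tn T A a M π := by
  classical
  have hsat : ∀ n γ, ChaseSat tn T A π n (γ.1.subst σ, γ.2) ↔ ChaseSat tn T A π n γ := by
    intro n γ
    simp only [ChaseSat, RAtom.match_subst, hσ]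
  have hw : ∀ γ, weight tn T A π (γ.1.subst σ, γ.2) = weight tn T A π γ := by
    intro γ
    simp only [weight, hsat, RAtom.named_subst]
  refine ⟨_, lt_of_lt_of_le ?_ h.sum_le, ?_, ?_, le_rfl⟩
  · refine (sum_insert_le _ _ _).trans_lt ?_
    have h3 := sum_image_le ((p.body.erase γ₁).erase γ₂) (fun γ => (γ.1.subst σ, γ.2))
      (weight tn T A π)
    simp only [hw] at h3
    rw [← Finset.add_sum_erase _ _ h₁,
      ← Finset.add_sum_erase _ _ (Finset.mem_erase.2 ⟨hne.symm, h₂⟩)]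
    have h4 := hw (γ₁.1.merge γ₂.1, max γ₁.2 γ₂.2)
    simp only at h4
    rw [h4]
    omega
  · intro i
    rw [← h.head i]
    simp only [RQuery.reduce, Term.eval_subst, hσ]
  · intro γ hγ
    rcases Finset.mem_insert.1 hγ with rfl | hγ
    · obtain ⟨n, hn⟩ := hm
      exact ⟨n, (hsat n (_, _)).2 hn⟩
    · obtain ⟨γ', hγ', rfl⟩ := Finset.mem_image.1 hγ
      obtain ⟨n, hn⟩ := h.body γ' (Finset.mem_of_mem_erase (Finset.mem_of_mem_erase hγ'))
      exact ⟨n, (hsat n γ').2 hn⟩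

/-- The possible ways in which a threshold atom can have a derivation of least height: it matches
an assertion, or an axiom is applicable, or a named variable is mapped to a new element. -/
theorem chaseSat_cases {m : ℕ} {γ : RAtom NC NR NI × ℝ} (hpos : 0 < γ.2)
    (h : ChaseSat tn T A π m γ) (hmin : ∀ n < m, ¬ ChaseSat tn T A π n γ) :
    (∃ F d, RAtom.Match Elem.ind π γ.1 (F.map Elem.ind) ∧ γ.2 ≤ d ∧ InABox A F d) ∨
    (∃ α ∈ T, ∃ η, Gr tn α γ η ∧ η.1.named ≤ γ.1.named ∧ ∃ n < m, ChaseSat tn T A π n η) ∨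
    ∃ Q s v x, γ.1 = BasicRole.atom Q s (some (.var v)) ∧ π v = .null x Q ∧
      RTerm.TakesIn Elem.ind π s x ∧
      ∃ d, γ.2 ≤ d ∧ Chase tn T A m (Q.fact x (.null x Q)) d := by
  obtain ⟨α, d⟩ := γ
  obtain ⟨F, d', hF, hd, hc⟩ := h
  simp only at hF hd hpos
  cases hc with
  | abox h => exact Or.inl ⟨_, _, hF, hd, h⟩
  | @ex n Q x y _ h =>
    -- An atom matched by `∃ Q` at `x` has the form `Q(t,_)`, so it is already matched by the
    -- earlier fact `Q(x,y)`, against minimality.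
    obtain ⟨t, rfl, ht⟩ := hF.exists_of_con
    exact absurd ⟨_, _, RAtom.match_atom_fact ht (RTerm.takesIn_none y), hd, h⟩
      (hmin n n.lt_succ_self)
  | @wit n Q x _ h =>
    obtain ⟨s, t, rfl, hs, ht⟩ := hF.exists_of_fact
    -- With `_` in the successor place, the earlier fact about `∃ Q` would do, against minimality;
    -- an individual name cannot denote a new element; so only a variable remains.
    rcases t with _ | b | v
    · exact absurd ⟨_, _, RAtom.match_atom_con (B := .ex Q) hs, hd, h⟩ (hmin n n.lt_succ_self)
    · cases RTerm.takesIn_some.1 ht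
    · exact Or.inr (Or.inr ⟨Q, s, v, x, rfl, RTerm.takesIn_some.1 ht, hs, _, hd, h.wit⟩)
  | @concept n B B' e x d₀ hT h =>
    obtain ⟨t, rfl, ht⟩ := hF.exists_of_con
    -- A conjunction never exceeds the axiom degree, so the axiom is applicable at this threshold.
    have hde : d ≤ e := hd.trans (TNorm.conj_le_right h.mem_Icc.2 e.2.1)
    refine Or.inr (Or.inl ⟨_, hT, _, .concept B B' e t d hde, ?_, n, n.lt_succ_self, ?_⟩)
    · simp only [RAtom.named_atom_concept, le_refl]
    · exact ⟨_, _, RAtom.match_atom_con ht, (TNorm.le_conj_iff_raise_le hpos hde).1 hd, h⟩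
  | @role n Q Q' e x y d₀ hT h =>
    obtain ⟨s, t, rfl, hs, ht⟩ := hF.exists_of_fact
    have hde : d ≤ e := hd.trans (TNorm.conj_le_right h.mem_Icc.2 e.2.1)
    refine Or.inr (Or.inl ⟨_, hT, _, .role Q Q' e s t d hde, ?_, n, n.lt_succ_self, ?_⟩)
    · simp only [RAtom.named_atom_role, le_refl]
    · exact ⟨_, _, RAtom.match_atom_fact hs ht, (TNorm.le_conj_iff_raise_le hpos hde).1 hd, h⟩

/-- The distance of an element from the individuals. -/
def Elem.depth : Elem NR NI → ℕ
  | .ind _ => 0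
  | .null x _ => x.depth + 1

/-- The depth of the value of a term. -/
def RTerm.depth (π : ℕ → Elem NR NI) : RTerm NI → ℕ
  | none => 0
  | some t => (t.eval Elem.ind π).depth

theorem RTerm.TakesIn.depth_le {t : RTerm NI} {x : Elem NR NI}
    (h : RTerm.TakesIn Elem.ind π t x) : t.depth π ≤ x.depth := by
  rcases t with _ | t
  · exact Nat.zero_le _
  · rw [RTerm.takesIn_some] at h
    rw [RTerm.depth, h]

theorem RAtom.Match.exists_ind {α : RAtom NC NR NI} {F : GFact NC NR NI}
    (h : RAtom.Match Elem.ind π α (F.map Elem.ind)) {b : Bool} {t : Term NI}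
    (hb : α.arg b = some t) : ∃ a, t.eval Elem.ind π = Elem.ind a := by
  cases F with
  | con B x =>
    obtain ⟨s, rfl, hs⟩ := h.exists_of_con
    refine ⟨x, hs t ?_⟩
    rcases B with N | P | P <;> cases b <;> first | exact hb | cases hb
  | rol P x y =>
    cases h with
    | role hs ht =>
      cases b
      · exact ⟨x, hs t hb⟩
      · exact ⟨y, ht t hb⟩

theorem Term.mgu_self (t : Term NI) : t.mgu t = some Term.var := by
  cases t with
  | ind a => simp [mgu]
  | var v => simp [mgu]

theorem mguTerm_self (t : RTerm NI) : mguTerm t t = some Term.var := by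
  cases t with
  | none => rfl
  | some t => exact t.mgu_self

theorem Term.subst_var (t : Term NI) : t.subst Term.var = t := by
  cases t <;> rfl

theorem RAtom.mgu_self (α : RAtom NC NR NI) : α.mgu α = some Term.var := by
  have : (Term.subst Term.var : Term NI → Term NI) = id := funext Term.subst_var
  cases α with
  | concept A t => simp [mgu, mguTerm_self]
  | role P s t => simp [mgu, mguTerm_self, this]

theorem RAtom.subst_var (α : RAtom NC NR NI) : α.subst Term.var = α := by
  cases α <;> simp [subst, bind, Term.subst_var]

theorem RAtom.merge_self (α : RAtom NC NR NI) : α.merge α = α := by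
  have : ∀ t : RTerm NI, (t <|> t) = t := by rintro (_ | t) <;> rfl
  cases α <;> simp only [merge, this]

/-- Unifying an atom with itself changes nothing, so the corresponding rewriting step is pure
anonymization. This is what places `p.anon` in the rewriting in the completeness proof. -/
theorem RQuery.reduce_self {p : RQuery NC NR NI k} {γ : RAtom NC NR NI × ℝ} (h : γ ∈ p.body) :
    p.reduce γ γ Term.var = p := by
  classical
  obtain ⟨head, body⟩ := p
  simp only [reduce, Term.subst_var, RAtom.subst_var, RAtom.merge_self, max_self, Prod.mk.eta,
    Finset.image_id', mk.injEq, true_and]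
  rw [Finset.erase_eq_of_notMem (Finset.notMem_erase _ _), Finset.insert_erase h]

theorem RAtom.named_merge_le (α β : RAtom NC NR NI) :
    (α.merge β).named ≤ α.named + β.named := by
  have : ∀ s t : RTerm NI, RTerm.count (s <|> t) ≤ s.count + t.count := by
    rintro (_ | s) (_ | t) <;> simp [RTerm.count]
  rcases α with ⟨A, t⟩ | ⟨P, s, t⟩ <;> rcases β with ⟨A', t'⟩ | ⟨P', s', t'⟩ <;>
    simp only [merge, named, arg]
  · have := this t t'
    omega
  · omega
  · omega
  · have h1 := this t t'
    have h2 := this s s'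
    omega

/-- Two atoms that match the same role fact can be unified, which decreases the weight. -/
theorem exists_merge {γ₁ γ₂ : RAtom NC NR NI × ℝ} {Q : BasicRole NR} {s₁ s₂ t₁ t₂ : RTerm NI}
    {x y : Elem NR NI} (e₁ : γ₁.1 = Q.atom s₁ t₁) (e₂ : γ₂.1 = Q.atom s₂ t₂)
    (hs₁ : RTerm.TakesIn Elem.ind π s₁ x) (hs₂ : RTerm.TakesIn Elem.ind π s₂ x)
    (ht₁ : RTerm.TakesIn Elem.ind π t₁ y) (ht₂ : RTerm.TakesIn Elem.ind π t₂ y) :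
    (∃ σ, γ₁.1.mgu γ₂.1 = some σ ∧ ∀ v, (σ v).eval Elem.ind π = π v) ∧
      RAtom.Match Elem.ind π (γ₁.1.merge γ₂.1) (Q.fact x y) := by
  have hinj : Function.Injective (Elem.ind : NI → Elem NR NI) := fun a b h => by cases h; rfl
  rw [e₁, e₂]
  cases Q with
  | name P =>
    exact ⟨RAtom.exists_mgu_role hinj hs₁ hs₂ ht₁ ht₂, .role (hs₁.orElse hs₂) (ht₁.orElse ht₂)⟩
  | inv P =>
    exact ⟨RAtom.exists_mgu_role hinj ht₁ ht₂ hs₁ hs₂, .role (ht₁.orElse ht₂) (hs₁.orElse hs₂)⟩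

/-- New elements may be collapsed to an arbitrary individual: the head and all matched facts mention
individuals only, and the collapse fixes those. -/
theorem RQuery.ChaseHolds.mem_dbAnswers_of_abox [Nonempty NI] {p : RQuery NC NR NI k}
    {S : Set (RQuery NC NR NI k)} (hp : p ∈ S) (h : p.ChaseHolds tn T A a N π)
    (hA : ∀ γ ∈ p.body, ∃ F d,
      RAtom.Match Elem.ind π γ.1 (F.map Elem.ind) ∧ γ.2 ≤ d ∧ InABox A F d) :
    a ∈ dbAnswers A S := by
  let g : Elem NR NI → NI := fun x => match x with
    | .ind a => a
    | .null _ _ => Classical.arbitrary NI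
  refine ⟨p, hp, fun v => g (π v), fun i => ?_, fun γ hγ => ?_⟩
  · have := congrArg g (h.head i)
    refine Eq.trans ?_ this
    cases p.head i <;> rfl
  · obtain ⟨F, d, hF, hd, hFA⟩ := hA γ hγ
    refine dbSat_iff.2 ⟨F, d, ?_, hd, hFA⟩
    have hm := hF.map g
    have : (F.map Elem.ind).map g = F := by cases F <;> rfl
    rw [this] at hm
    exact hm

/-- The threshold atom is `Q(s,v)`, and is matched by the fact that holds for the value of `s` and
its `Q`-successor, which is the value of `v`. -/
def NullMatch (tn : TNorm) (T : TBox NC NR) (A : ABox NC NR NI) (π : ℕ → Elem NR NI)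
    (γ : RAtom NC NR NI × ℝ) (Q : BasicRole NR) (s : RTerm NI) (v : ℕ) (x : Elem NR NI) : Prop :=
  γ.1 = Q.atom s (some (.var v)) ∧ π v = .null x Q ∧ RTerm.TakesIn Elem.ind π s x ∧
    ∃ n d, γ.2 ≤ d ∧ Chase tn T A n (Q.fact x (.null x Q)) d ∧
      weight tn T A π γ = 1 + γ.1.named + n

/-- Strong induction on the weight. If no axiom application lowers it, each atom either matches the
ABox or is some `Q(s,v)` with `v` mapped to the `Q`-successor of the value of `s`. Among atoms of
the second kind, one with the deepest value of `v` is taken. Either `v` occurs only there and can be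
made anonymous, or any second occurrence is, by depth, again in the successor place of a `Q`-atom
with the same parent element, and the two atoms unify. -/
theorem RQuery.ChaseHolds.mem_dbAnswers [Nonempty NI] {S : Set (RQuery NC NR NI k)}
    (hS : ∀ p ∈ S, ∀ p', Step tn T p p' → p' ∈ S) (hpos : ∀ p ∈ S, ∀ γ ∈ p.body, 0 < γ.2) :
    ∀ (N : ℕ) (p : RQuery NC NR NI k), p ∈ S → p.ChaseHolds tn T A a N π → a ∈ dbAnswers A S := by
  classical
  intro N
  induction N using Nat.strong_induction_on with
  | _ N ih =>
  intro p hp h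
  by_cases h₂ : ∃ γ ∈ p.body, ∃ α ∈ T, ∃ η, Gr tn α γ η ∧ (∃ n, ChaseSat tn T A π n η) ∧
      weight tn T A π η < weight tn T A π γ
  · obtain ⟨γ, hγ, α, hα, η, hg, hη, hlt⟩ := h₂
    obtain ⟨M, hM, h'⟩ := h.replace_lt hγ hη hlt
    exact ih M hM _ (hS p hp _ (.apply p α γ η hα hγ hg)) h'.anon
  have cases' : ∀ γ ∈ p.body,
      (∃ F d, RAtom.Match Elem.ind π γ.1 (F.map Elem.ind) ∧ γ.2 ≤ d ∧ InABox A F d) ∨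
      ∃ Q s v x, NullMatch tn T A π γ Q s v x := by
    intro γ hγ
    obtain ⟨m, hm, hmin, hw⟩ := exists_minimal_chaseSat (h.body γ hγ)
    rcases chaseSat_cases (hpos p hp γ hγ) hm hmin with h1 | ⟨α, hα, η, hg, hn, n, hnm, hη⟩ | ⟨Q, s, v, x, e, hv, hs, d, hd, hc⟩
    · exact Or.inl h1
    · refine absurd ⟨γ, hγ, α, hα, η, hg, ⟨n, hη⟩, ?_⟩ h₂
      have := hη.weight_le
      omega
    · exact Or.inr ⟨Q, s, v, x, e, hv, hs, m, d, hd, hc, hw⟩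
  -- On atoms with a null match this is the depth of the successor, independently of the choice of
  -- `Q`, `s`, `v`, `x`.
  let f : RAtom NC NR NI × ℝ → ℕ := fun γ => max ((γ.1.arg false).depth π) ((γ.1.arg true).depth π)
  let W := p.body.filter fun γ => ∃ Q s v x, NullMatch tn T A π γ Q s v x
  have hf : ∀ (γ : RAtom NC NR NI × ℝ) Q s v x, NullMatch tn T A π γ Q s v x →
      f γ = x.depth + 1 := by
    rintro γ Q s v x ⟨e, hv, hs, -⟩
    have h1 := hs.depth_le
    have h2 : RTerm.depth π (some (.var v) : RTerm NI) = x.depth + 1 := by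
      show (π v).depth = _
      rw [hv]; rfl
    cases Q <;> simp only [f, e, BasicRole.atom, RAtom.arg] <;> omega
  rcases W.eq_empty_or_nonempty with hW | hW
  · refine h.mem_dbAnswers_of_abox hp fun γ hγ => (cases' γ hγ).resolve_right fun hw => ?_
    exact Finset.notMem_empty γ (hW ▸ Finset.mem_filter.2 ⟨hγ, hw⟩)
  obtain ⟨γ, hγW, hmax⟩ := W.exists_max_image f hW
  obtain ⟨hγ, Q, s, v, x, hnm⟩ := Finset.mem_filter.1 hγW
  obtain ⟨e, hv, hs, n, d, hd, hc, hw⟩ := id hnm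
  have hb : γ.1.arg Q.side = some (.var v) := by rw [e, BasicRole.arg_atom, if_pos rfl]
  -- Anonymizing a variable that occurs once lowers the count of named arguments; the step is
  -- realized by unifying `γ` with itself.
  by_cases hu : p.Unbound v
  · obtain ⟨M, hM, h'⟩ := h.anon_lt hγ hb hu
    refine ih M hM _ (hS p hp _ ?_) h'
    have := Step.reduce (tn := tn) (T := T) p γ γ _ hγ hγ γ.1.mgu_self
    rwa [RQuery.reduce_self hγ] at this
  -- Head terms denote individuals, whereas `v` denotes a new element.
  have hhead : ∀ i, p.head i ≠ .var v := by
    intro i hi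
    have := h.head i
    rw [hi] at this
    change π v = _ at this
    rw [hv] at this
    cases this
  obtain ⟨γ', hγ', b', hb', hne⟩ := RQuery.exists_of_not_unbound hu hhead hγ hb
  rcases cases' γ' hγ' with ⟨F, d, hF, -, -⟩ | ⟨Q', s', v', x', hnm'⟩
  · obtain ⟨a, ha⟩ := hF.exists_ind hb'
    change π v = _ at ha
    rw [hv] at ha
    cases ha
  have hle := hmax γ' (Finset.mem_filter.2 ⟨hγ', Q', s', v', x', hnm'⟩)
  rw [hf γ' Q' s' v' x' hnm', hf γ Q s v x hnm] at hle
  obtain ⟨e', hv', hs', n', d', hd', hc', hw'⟩ := hnm'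
  have hb'' := hb'
  rw [e', BasicRole.arg_atom] at hb''
  split_ifs at hb'' with hside
  -- The second occurrence is also in a successor place. A new element determines its parent and its
  -- role, so both atoms are matched by the same role fact.
  · cases hb''
    rw [hv] at hv'
    cases hv'
    have hγγ : γ ≠ γ' := by
      rintro rfl
      exact hne (by rw [hside])
    have ht : RTerm.TakesIn Elem.ind π (some (.var v)) (Elem.null x Q) := RTerm.takesIn_some.2 hv
    obtain ⟨⟨σ, hσ, hσπ⟩, hm⟩ := exists_merge e e' hs hs' ht ht
    -- The derivation belonging to the larger threshold serves the merged atom. The weight falls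
    -- strictly because two summands `1` become one.
    have hsat : ∃ l ≤ n + n', ChaseSat tn T A π l (γ.1.merge γ'.1, max γ.2 γ'.2) := by
      rcases le_total γ.2 γ'.2 with hle' | hle'
      · exact ⟨n', by omega, _, d', hm, by rwa [max_eq_right hle'], hc'⟩
      · exact ⟨n, by omega, _, d, hm, by rwa [max_eq_left hle'], hc⟩
    obtain ⟨l, hl, hsat⟩ := hsat
    obtain ⟨M, hM, h'⟩ := h.reduce_lt hγ hγ' hγγ hσπ ⟨l, hsat⟩ (by
      have h1 := hsat.weight_le
      have h2 := γ.1.named_merge_le γ'.1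
      simp only at h1
      omega)
    exact ih M hM _ (hS p hp _ (.reduce p γ γ' σ hγ hγ' hσ)) h'.anon
  -- Here `v` would be the parent in the other atom, whose successor would then lie deeper, against
  -- maximality.
  · rw [hb'', RTerm.takesIn_some] at hs'
    change π v = x' at hs'
    rw [← hs', hv] at hle
    simp only [Elem.depth] at hle
    omega

/-- Completeness of the rewriting. -/
theorem certainAnswers_subset_dbAnswers [Nonempty NI] (hcons : Consistent tn T A)
    {q : TQ NC NR NI k} (hpos : ∀ γ ∈ q.body, 0 < γ.2) {n : ℕ}
    (hn : perfectRef tn T q (n + 1) = perfectRef tn T q n) :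
    q.certainAnswers tn T A ⊆ dbAnswers A (perfectRef tn T q n) := by
  classical
  intro a ha
  obtain ⟨π, hhead, hbody⟩ := ha _ (canonical_isModel hcons)
  have hpos' : ∀ p ∈ perfectRef tn T q n, ∀ γ ∈ p.body, 0 < γ.2 := by
    intro p hp γ hγ
    refine ((thresholds_perfectRef n p hp γ hγ).mem_Ioc ?_ T.degrees_subset).1
    rintro _ ⟨γ, hγ, rfl⟩
    exact ⟨hpos γ hγ, γ.2.2.2⟩
  have hclosed : ∀ p ∈ perfectRef tn T q n, ∀ p', Step tn T p p' → p' ∈ perfectRef tn T q n := by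
    intro p hp p' hs
    rw [← hn, perfectRef, Function.iterate_succ_apply']
    exact Or.inr ⟨p, hp, hs⟩
  have hmem : ∀ m, q.toRQuery ∈ perfectRef tn T q m := by
    intro m
    induction m with
    | zero => rfl
    | succ m ih =>
      rw [perfectRef, Function.iterate_succ_apply']
      exact Or.inl ih
  refine RQuery.ChaseHolds.mem_dbAnswers hclosed hpos' _ _ (hmem n)
    (RQuery.ChaseHolds.anon ⟨hhead, ?_, le_rfl⟩)
  intro γ hγ
  obtain ⟨γ', hγ', rfl⟩ := Finset.mem_image.1 hγ
  obtain ⟨F, hF, hd⟩ := (toRAtom_match_iff canonical_witnessed γ'.1 γ'.2).2 (hbody γ' hγ')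
  rw [canonical_degree] at hd
  -- A positive threshold forces a positive degree, and such a degree is attained by a finite
  -- derivation.
  obtain ⟨m, hm⟩ := exists_chase_of_pos ((show (0 : ℝ) < γ'.2 from hpos γ' hγ').trans_le hd)
  exact ⟨m, F, _, hF, hd, hm⟩

end FuzzyDLLite

namespace FuzzyDLLite

variable {NC NR NI : Type u} {k : ℕ}

/-! ### Termination of the rewriting -/

/-- The concept or role name of an atom. -/
def RAtom.pred : RAtom NC NR NI → NC ⊕ NR
  | .concept A _ => .inl A
  | .role P _ _ => .inr P

/-- The role name of a basic role. -/
def BasicRole.pred : BasicRole NR → NR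
  | .name P => P
  | .inv P => P

/-- The concept or role name of a basic concept. -/
def BasicConcept.pred : BasicConcept NC NR → NC ⊕ NR
  | .name A => .inl A
  | .ex Q => .inr Q.pred

/-- The concept or role name on the left-hand side of an axiom. -/
def FAxiom.pred : FAxiom NC NR → NC ⊕ NR
  | .concept B _ _ => B.pred
  | .role Q _ _ => .inr Q.pred

/-- The predicate and the named arguments of the atom belong to the given sets. -/
def RAtom.Over (N : Set (NC ⊕ NR)) (X : Set (Term NI)) (α : RAtom NC NR NI) : Prop :=
  α.pred ∈ N ∧ ∀ b, ∀ t ∈ α.arg b, t ∈ X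

theorem RAtom.finite_over {N : Set (NC ⊕ NR)} {X : Set (Term NI)} (hN : N.Finite)
    (hX : X.Finite) : {α : RAtom NC NR NI | α.Over N X}.Finite := by
  have hX' : (insert none (some '' X) : Set (RTerm NI)).Finite := (hX.image some).insert none
  have hmem : ∀ t : RTerm NI, (∀ s ∈ t, s ∈ X) → t ∈ (insert none (some '' X) : Set (RTerm NI)) := by
    rintro (_ | t) h
    · exact Or.inl rfl
    · exact Or.inr ⟨t, h t rfl, rfl⟩
  refine ((hN.prod (hX'.prod hX')).image fun x : (NC ⊕ NR) × RTerm NI × RTerm NI =>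
    match x with
    | (.inl A, _, t) => RAtom.concept A t
    | (.inr P, s, t) => RAtom.role P s t).subset ?_
  rintro (⟨A, t⟩ | ⟨P, s, t⟩) ⟨hα, harg⟩
  · exact ⟨(.inl A, none, t), ⟨hα, Or.inl rfl, hmem t (harg true)⟩, rfl⟩
  · exact ⟨(.inr P, s, t), ⟨hα, hmem s (harg false), hmem t (harg true)⟩, rfl⟩

@[simp]
theorem RAtom.pred_bind (α : RAtom NC NR NI) (f : Term NI → RTerm NI) :
    (α.bind f).pred = α.pred := by
  cases α <;> rfl

theorem RAtom.Over.bind {N : Set (NC ⊕ NR)} {X : Set (Term NI)} {α : RAtom NC NR NI}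
    (h : α.Over N X) {f : Term NI → RTerm NI} (hf : ∀ t ∈ X, ∀ t' ∈ f t, t' ∈ X) :
    (α.bind f).Over N X := by
  refine ⟨by rw [RAtom.pred_bind]; exact h.1, fun b t ht => ?_⟩
  rw [arg_bind] at ht
  obtain ⟨s, hs, hst⟩ := Option.mem_bind_iff.1 ht
  exact hf s (h.2 b s hs) t hst

/-- A most general unifier of function-free terms replaces a variable by one of the two terms, so no
new terms arise. -/
theorem Term.mgu_maps {X : Set (Term NI)} {s t : Term NI} (hs : s ∈ X) (ht : t ∈ X)
    {σ : ℕ → Term NI} (h : s.mgu t = some σ) : ∀ r ∈ X, r.subst σ ∈ X := by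
  have hid : ∀ r ∈ X, r.subst Term.var ∈ X := fun r hr => by rwa [Term.subst_var]
  have key : ∀ (v : ℕ) (r : Term NI), r ∈ X → ∀ r' ∈ X,
      r'.subst (Function.update Term.var v r) ∈ X := by
    rintro v r hr (a | w) hr'
    · exact hr'
    · show Function.update Term.var v r w ∈ X
      rw [Function.update_apply]
      split_ifs
      · exact hr
      · exact hr'
  rcases s with a | v <;> rcases t with b | w <;> simp only [Term.mgu] at h
  · split_ifs at h
    cases h
    exact hid
  all_goals
    cases h
    exact key _ _ (by assumption)

theorem mguTerm_maps {X : Set (Term NI)} {s t : RTerm NI} (hs : ∀ r ∈ s, r ∈ X)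
    (ht : ∀ r ∈ t, r ∈ X) {σ : ℕ → Term NI} (h : mguTerm s t = some σ) :
    ∀ r ∈ X, r.subst σ ∈ X := by
  rcases s with _ | s <;> rcases t with _ | t
  case some.some => exact Term.mgu_maps (hs s rfl) (ht t rfl) h
  all_goals
    cases h
    exact fun r hr => by rwa [Term.subst_var]

theorem RAtom.mgu_maps {N : Set (NC ⊕ NR)} {X : Set (Term NI)} {α β : RAtom NC NR NI}
    (hα : α.Over N X) (hβ : β.Over N X) {ρ : ℕ → Term NI} (h : α.mgu β = some ρ) :
    ∀ r ∈ X, r.subst ρ ∈ X := by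
  rcases α with ⟨A, t⟩ | ⟨P, s, t⟩ <;> rcases β with ⟨A', t'⟩ | ⟨P', s', t'⟩
  · simp only [RAtom.mgu] at h
    split_ifs at h
    exact mguTerm_maps (hα.2 true) (hβ.2 true) h
  · cases h
  · cases h
  · simp only [RAtom.mgu] at h
    split_ifs at h
    simp only [Option.bind_eq_some_iff, Option.map_eq_some_iff] at h
    obtain ⟨σ, hσ, τ, hτ, rfl⟩ := h
    have h1 := mguTerm_maps (hα.2 false) (hβ.2 false) hσ
    have hmap : ∀ t : RTerm NI, (∀ r ∈ t, r ∈ X) → ∀ r ∈ t.map (Term.subst σ), r ∈ X := by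
      rintro (_ | t) ht r hr
      · cases hr
      · cases hr
        exact h1 t (ht t rfl)
    have h2 := mguTerm_maps (hmap _ (hα.2 true)) (hmap _ (hβ.2 true)) hτ
    intro r hr
    rw [← Term.subst_subst]
    exact h2 _ (h1 r hr)

theorem RAtom.Over.merge {N : Set (NC ⊕ NR)} {X : Set (Term NI)} {α β : RAtom NC NR NI}
    (hα : α.Over N X) (hβ : β.Over N X) : (α.merge β).Over N X := by
  have key : ∀ s t : RTerm NI, (∀ r ∈ s, r ∈ X) → (∀ r ∈ t, r ∈ X) →
      ∀ r ∈ (s <|> t : RTerm NI), r ∈ X := by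
    rintro (_ | s) t hs ht r hr
    · exact ht r (by simpa using hr)
    · exact hs r (by simpa using hr)
  rcases α with ⟨A, t⟩ | ⟨P, s, t⟩ <;> rcases β with ⟨A', t'⟩ | ⟨P', s', t'⟩
  · refine ⟨hα.1, ?_⟩
    rintro (_ | _)
    · rintro t ⟨⟩
    · exact key _ _ (hα.2 true) (hβ.2 true)
  · exact hα
  · exact hα
  · refine ⟨hα.1, ?_⟩
    rintro (_ | _)
    · exact key _ _ (hα.2 false) (hβ.2 false)
    · exact key _ _ (hα.2 true) (hβ.2 true)

/-- The head and the body of the query are built from the given predicates and terms. -/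
def RQuery.Over (N : Set (NC ⊕ NR)) (X : Set (Term NI)) (p : RQuery NC NR NI k) : Prop :=
  (∀ i, p.head i ∈ X) ∧ ∀ γ ∈ p.body, γ.1.Over N X

theorem RQuery.Over.anon {N : Set (NC ⊕ NR)} {X : Set (Term NI)} {p : RQuery NC NR NI k}
    (h : p.Over N X) : p.anon.Over N X := by
  classical
  refine ⟨h.1, fun γ hγ => ?_⟩
  obtain ⟨γ', hγ', rfl⟩ := Finset.mem_image.1 hγ
  refine (h.2 γ' hγ').bind fun t ht t' ht' => ?_
  split_ifs at ht'
  · cases ht'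
  · cases ht'; exact ht

theorem BasicRole.over_atom {N : Set (NC ⊕ NR)} {X : Set (Term NI)} {Q : BasicRole NR}
    {s t : RTerm NI} : (Q.atom s t : RAtom NC NR NI).Over N X ↔
      .inr Q.pred ∈ N ∧ (∀ r ∈ s, r ∈ X) ∧ ∀ r ∈ t, r ∈ X := by
  cases Q <;> simp [RAtom.Over, BasicRole.atom, RAtom.pred, BasicRole.pred, RAtom.arg, and_comm]

theorem BasicConcept.over_atom {N : Set (NC ⊕ NR)} {X : Set (Term NI)} {B : BasicConcept NC NR}
    {t : RTerm NI} : (B.atom t : RAtom NC NR NI).Over N X ↔ B.pred ∈ N ∧ ∀ r ∈ t, r ∈ X := by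
  cases B with
  | name A => simp [RAtom.Over, BasicConcept.atom, RAtom.pred, BasicConcept.pred, RAtom.arg]
  | ex Q =>
    simp only [BasicConcept.atom, BasicConcept.pred, BasicRole.over_atom]
    simp

/-- An axiom changes only the predicate and may introduce `_` but no named term; a unification
changes only terms, within `X`. -/
theorem RQuery.Over.step {tn : TNorm} {T : TBox NC NR} {N : Set (NC ⊕ NR)} {X : Set (Term NI)}
    (hT : ∀ α ∈ T, α.pred ∈ N) {p p' : RQuery NC NR NI k} (h : p.Over N X)
    (hs : Step tn T p p') : p'.Over N X := by
  classical
  cases hs with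
  | apply α γ η hα hγ hg =>
    refine RQuery.Over.anon ⟨h.1, fun γ' hγ' => ?_⟩
    rcases Finset.mem_insert.1 hγ' with rfl | hγ'
    · have h1 := h.2 γ hγ
      have h2 := hT α hα
      cases hg with
      | concept B B' e t d hde =>
        exact BasicConcept.over_atom.2 ⟨h2, (BasicConcept.over_atom.1 h1).2⟩
      | role Q Q' e s t d hde =>
        exact BasicRole.over_atom.2 ⟨h2, (BasicRole.over_atom.1 h1).2⟩
    · exact h.2 γ' (Finset.mem_of_mem_erase hγ')
  | reduce γ₁ γ₂ σ h₁ h₂ hσ =>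
    have hX := RAtom.mgu_maps (h.2 _ h₁) (h.2 _ h₂) hσ
    have hX' : ∀ t ∈ X, ∀ t' ∈ (some (t.subst σ) : RTerm NI), t' ∈ X := by
      rintro t ht t' ⟨⟩
      exact hX t ht
    refine RQuery.Over.anon ⟨fun i => hX _ (h.1 i), fun γ' hγ' => ?_⟩
    rcases Finset.mem_insert.1 hγ' with rfl | hγ'
    · exact ((h.2 _ h₁).merge (h.2 _ h₂)).bind hX'
    · obtain ⟨γ, hγ, rfl⟩ := Finset.mem_image.1 hγ'
      exact (h.2 γ (Finset.mem_of_mem_erase (Finset.mem_of_mem_erase hγ))).bind hX'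

/-- There are finitely many queries over finite sets of predicates, terms and thresholds. -/
theorem RQuery.finite_over {N : Set (NC ⊕ NR)} {X : Set (Term NI)} {D : Set ℝ} (hN : N.Finite)
    (hX : X.Finite) (hD : D.Finite) :
    {p : RQuery NC NR NI k | p.Over N X ∧ ∀ γ ∈ p.body, γ.2 ∈ D}.Finite := by
  classical
  have hb : {b : Finset (RAtom NC NR NI × ℝ) | (b : Set (RAtom NC NR NI × ℝ)) ⊆
      {α : RAtom NC NR NI | α.Over N X} ×ˢ D}.Finite :=
    ((RAtom.finite_over hN hX).prod hD).finite_subsets.preimage Finset.coe_injective.injOn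
  have hh : {h : Fin k → Term NI | ∀ i, h i ∈ X}.Finite := by
    have := Set.Finite.pi' (fun _ : Fin k => hX)
    exact this
  refine ((hh.prod hb).image fun x => (⟨x.1, x.2⟩ : RQuery NC NR NI k)).subset ?_
  rintro ⟨head, body⟩ ⟨⟨h1, h2⟩, h3⟩
  exact ⟨(head, body), ⟨h1, fun γ hγ => ⟨h2 γ hγ, h3 γ hγ⟩⟩, rfl⟩

/-- Predicates come from the TBox and the query, terms from the query, thresholds from the finite
closure under raising. Bodies are sets of threshold atoms over these, so only finitely many are
possible. -/
theorem exists_finite_perfectRef (tn : TNorm) (T : TBox NC NR) {q : TQ NC NR NI k}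
    (hpos : ∀ γ ∈ q.body, 0 < γ.2) :
    ∃ S : Set (RQuery NC NR NI k), S.Finite ∧ ∀ n, perfectRef tn T q n ⊆ S := by
  classical
  let b : RQuery NC NR NI k :=
    { head := fun i => .var (q.answerVars i)
      body := q.body.image fun γ => (γ.1.toRAtom, (γ.2 : ℝ)) }
  let N : Set (NC ⊕ NR) := FAxiom.pred '' (T : Set (FAxiom NC NR)) ∪
    (fun γ => γ.1.pred) '' (b.body : Set (RAtom NC NR NI × ℝ))
  let X : Set (Term NI) := Set.range b.head ∪ ⋃ γ ∈ (b.body : Set (RAtom NC NR NI × ℝ)),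
    {t | t ∈ γ.1.terms}
  have hN : N.Finite := (T.finite_toSet.image _).union (b.body.finite_toSet.image _)
  have hX : X.Finite := (Set.finite_range _).union
    (b.body.finite_toSet.biUnion fun γ _ => γ.1.terms.finite_toSet)
  have hD := RaiseClosure.finite (tn := tn)
    (D := (fun γ => (γ.2 : ℝ)) '' (q.body : Set (Atom NC NR NI × unitInterval)))
    (q.body.finite_toSet.image _) T.finite_degrees
    (by rintro _ ⟨γ, hγ, rfl⟩; exact ⟨hpos γ hγ, γ.2.2.2⟩) T.degrees_subset
  refine ⟨_, RQuery.finite_over hN hX hD, fun n p hp => ⟨?_, thresholds_perfectRef n p hp⟩⟩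
  refine perfectRef_induction (RQuery.Over.anon (p := b) ⟨?_, ?_⟩) ?_ n p hp
  · exact fun i => Or.inl ⟨i, rfl⟩
  · refine fun γ hγ => ⟨Or.inr ⟨γ, hγ, rfl⟩, fun c t ht => Or.inr ?_⟩
    exact Set.mem_biUnion hγ (RAtom.mem_terms_iff.2 ⟨c, ht⟩)
  · exact fun p p' h hs => h.step (fun α hα => Or.inl ⟨α, hα, rfl⟩) hs

/-- An increasing sequence of subsets of a finite set becomes stationary. -/
theorem exists_succ_eq_of_subset_finite {ι : Type*} {f : ℕ → Set ι} (hf : ∀ n, f n ⊆ f (n + 1))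
    {S : Set ι} (hS : S.Finite) (hfS : ∀ n, f n ⊆ S) : ∃ n, f (n + 1) = f n := by
  by_contra! hne
  have key : ∀ n, n ≤ (f n).ncard := by
    intro n
    induction n with
    | zero => exact Nat.zero_le _
    | succ n ih =>
      exact ih.trans_lt (Set.ncard_lt_ncard ((hf n).ssubset_of_ne (hne n).symm)
        (hS.subset (hfS _)))
  have := (key (S.ncard + 1)).trans (Set.ncard_le_ncard (hfS _) hS)
  omega

/-- The rewriting terminates, and its result computes the certain answers. -/
theorem perfectRef_correct [Nonempty NI] (tn : TNorm) (T : TBox NC NR) {q : TQ NC NR NI k}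
    (hpos : ∀ γ ∈ q.body, 0 < γ.2) :
    ∃ n : ℕ, perfectRef tn T q (n + 1) = perfectRef tn T q n ∧ (perfectRef tn T q n).Finite ∧
      ∀ A : ABox NC NR NI, Consistent tn T A →
        q.certainAnswers tn T A = dbAnswers A (perfectRef tn T q n) := by
  obtain ⟨S, hS, hsub⟩ := exists_finite_perfectRef tn T hpos
  obtain ⟨n, hn⟩ := exists_succ_eq_of_subset_finite (f := perfectRef tn T q) (fun n => by
    rw [perfectRef, perfectRef, Function.iterate_succ_apply']
    exact Set.subset_union_left) hS hsub
  exact ⟨n, hn, hS.subset (hsub n), fun A hA =>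
    (certainAnswers_subset_dbAnswers hA hpos hn).antisymm
      (dbAnswers_subset_certainAnswers hpos n)⟩

end FuzzyDLLite

namespace FuzzyDLLite

/-! ### From first-order formulas to circuits -/

namespace WordFormula

/-- The constant circuits. -/
def constCircuit (n : ℕ) : Bool → Circuit n
  | true => .all 0 Fin.elim0
  | false => .any 0 Fin.elim0

/-- The circuit that decides whether the truth value of the formula is `b`. -/
def circuit {n : ℕ} : {k : ℕ} → WordFormula k → Bool → (Fin k → Fin n) → Circuit n
  | _, .bit i, b, v => .lit (v i) b
  | _, .eq i j, b, v => constCircuit n (b == decide (v i = v j))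
  | _, .lt i j, b, v => constCircuit n (b == decide (v i < v j))
  | _, .add i j l, b, v => constCircuit n (b == decide ((v i : ℕ) + (v j : ℕ) = (v l : ℕ)))
  | _, .mul i j l, b, v => constCircuit n (b == decide ((v i : ℕ) * (v j : ℕ) = (v l : ℕ)))
  -- Circuits have negation only at the leaves; the parameter `b` carries it inwards by De Morgan
  -- duality.
  | _, .not φ, b, v => φ.circuit (!b) v
  | _, .and φ ψ, true, v => .all 2 fun j => if j = 0 then φ.circuit true v else ψ.circuit true v
  | _, .and φ ψ, false, v =>
      .any 2 fun j => if j = 0 then φ.circuit false v else ψ.circuit false v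
  | _, .ex φ, true, v => .any n fun x => φ.circuit true (Fin.snoc v x)
  | _, .ex φ, false, v => .all n fun x => φ.circuit false (Fin.snoc v x)

theorem accepts_constCircuit {n : ℕ} (w : Fin n → Bool) (b : Bool) :
    (constCircuit n b).Accepts w ↔ b = true := by
  cases b
  · exact iff_of_false (fun ⟨j, _⟩ => j.elim0) (by simp)
  · exact iff_of_true (fun j => j.elim0) rfl

theorem accepts_circuit {n : ℕ} (w : Fin n → Bool) {k : ℕ} (φ : WordFormula k) :
    ∀ (b : Bool) (v : Fin k → Fin n),
      (φ.circuit b v).Accepts w ↔ (φ.Holds w v ↔ b = true) := by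
  induction φ with
  | bit i =>
    intro b v
    simp only [circuit, Circuit.Accepts, Holds]
    cases b <;> cases w (v i) <;> simp
  | eq i j =>
    intro b v
    simp only [circuit, accepts_constCircuit, Holds]
    cases b <;> simp
  | lt i j =>
    intro b v
    simp only [circuit, accepts_constCircuit, Holds]
    cases b <;> simp
  | add i j l =>
    intro b v
    simp only [circuit, accepts_constCircuit, Holds]
    cases b <;> simp
  | mul i j l =>
    intro b v
    simp only [circuit, accepts_constCircuit, Holds]
    cases b <;> simp
  | not φ ih =>
    intro b v
    simp only [circuit, ih, Holds]
    cases b <;> simp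
  | and φ ψ ih₁ ih₂ =>
    intro b v
    cases b
    · simp only [circuit, Circuit.Accepts, Holds, Fin.exists_fin_two]
      simp [ih₁, ih₂, imp_iff_not_or]
    · simp only [circuit, Circuit.Accepts, Holds, Fin.forall_fin_two]
      simp [ih₁, ih₂]
  | ex φ ih =>
    intro b v
    cases b <;> simp [circuit, Circuit.Accepts, Holds, ih]

/-- A bound for the depth of the circuits of a formula. -/
def depthBound : {k : ℕ} → WordFormula k → ℕ
  | _, .bit _ => 1
  | _, .eq _ _ => 1
  | _, .lt _ _ => 1
  | _, .add _ _ _ => 1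
  | _, .mul _ _ _ => 1
  | _, .not φ => φ.depthBound
  | _, .and φ ψ => 1 + max φ.depthBound ψ.depthBound
  | _, .ex φ => 1 + φ.depthBound

theorem depth_constCircuit_le {n : ℕ} (b : Bool) : (constCircuit n b).depth ≤ 1 := by
  cases b <;> simp [constCircuit, Circuit.depth]

theorem depth_circuit_le {n k : ℕ} (φ : WordFormula k) :
    ∀ (b : Bool) (v : Fin k → Fin n), (φ.circuit b v).depth ≤ φ.depthBound := by
  induction φ with
  | bit i => intro b v; simp [circuit, Circuit.depth, depthBound]
  | eq i j => intro b v; exact depth_constCircuit_le _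
  | lt i j => intro b v; exact depth_constCircuit_le _
  | add i j l => intro b v; exact depth_constCircuit_le _
  | mul i j l => intro b v; exact depth_constCircuit_le _
  | not φ ih => intro b v; exact ih _ v
  | and φ ψ ih₁ ih₂ =>
    intro b v
    cases b <;>
    · simp only [circuit, Circuit.depth, depthBound]
      refine Nat.add_le_add_left (Finset.sup_le fun j _ => ?_) 1
      split_ifs
      · exact (ih₁ _ v).trans (le_max_left _ _)
      · exact (ih₂ _ v).trans (le_max_right _ _)
  | ex φ ih =>
    intro b v
    cases b <;> exact Nat.add_le_add_left (Finset.sup_le fun j _ => ih _ _) 1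

theorem size_constCircuit {n : ℕ} (b : Bool) : (constCircuit n b).size = 1 := by
  cases b <;> simp [constCircuit, Circuit.size]

/-- A quantifier multiplies the size by at most `n` and a conjunction adds two sizes. The base `n +
1` keeps the powers monotone in the exponent, also for the empty word. -/
theorem exists_size_circuit_le {k : ℕ} (φ : WordFormula k) :
    ∃ c : ℕ, ∀ (n : ℕ) (b : Bool) (v : Fin k → Fin n),
      (φ.circuit b v).size ≤ c * (n + 1) ^ c := by
  have hconst : ∃ c : ℕ, ∀ n : ℕ, 1 ≤ c * (n + 1) ^ c := ⟨1, fun n => by simp⟩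
  have hpow : ∀ {n c d : ℕ}, c ≤ d → (n + 1) ^ c ≤ (n + 1) ^ d := fun h =>
    Nat.pow_le_pow_right (Nat.succ_pos _) h
  induction φ with
  | bit i =>
    obtain ⟨c, hc⟩ := hconst
    exact ⟨c, fun n b v => hc n⟩
  | eq i j =>
    obtain ⟨c, hc⟩ := hconst
    exact ⟨c, fun n b v => (size_constCircuit _).trans_le (hc n)⟩
  | lt i j =>
    obtain ⟨c, hc⟩ := hconst
    exact ⟨c, fun n b v => (size_constCircuit _).trans_le (hc n)⟩
  | add i j l =>
    obtain ⟨c, hc⟩ := hconst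
    exact ⟨c, fun n b v => (size_constCircuit _).trans_le (hc n)⟩
  | mul i j l =>
    obtain ⟨c, hc⟩ := hconst
    exact ⟨c, fun n b v => (size_constCircuit _).trans_le (hc n)⟩
  | not φ ih =>
    obtain ⟨c, hc⟩ := ih
    exact ⟨c, fun n b v => hc n _ v⟩
  | and φ ψ ih₁ ih₂ =>
    obtain ⟨c, hc⟩ := ih₁
    obtain ⟨d, hd⟩ := ih₂
    refine ⟨1 + c + d, fun n b v => ?_⟩
    have key : ∀ b, 1 + ((φ.circuit b v).size + (ψ.circuit b v).size) ≤
        (1 + c + d) * (n + 1) ^ (1 + c + d) := by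
      intro b
      have h1 := (hc n b v).trans (Nat.mul_le_mul_left c (hpow (show c ≤ 1 + c + d by omega)))
      have h2 := (hd n b v).trans (Nat.mul_le_mul_left d (hpow (show d ≤ 1 + c + d by omega)))
      have h3 : 1 ≤ (n + 1) ^ (1 + c + d) := Nat.one_le_pow _ _ (Nat.succ_pos _)
      rw [add_mul, add_mul, one_mul]
      omega
    cases b <;> simpa [circuit, Circuit.size, Fin.sum_univ_two] using key _
  | ex φ ih =>
    obtain ⟨c, hc⟩ := ih
    refine ⟨1 + c, fun n b v => ?_⟩
    have key : ∀ b, 1 + ∑ x, (φ.circuit b (Fin.snoc v x : Fin _ → Fin n)).size ≤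
        (1 + c) * (n + 1) ^ (1 + c) := by
      intro b
      have h1 : ∑ x, (φ.circuit b (Fin.snoc v x : Fin _ → Fin n)).size ≤
          n * (c * (n + 1) ^ c) := by
        refine (Finset.sum_le_card_nsmul _ _ _ fun x _ => hc n b _).trans ?_
        simp
      have h3 : 1 ≤ (n + 1) ^ (1 + c) := Nat.one_le_pow _ _ (Nat.succ_pos _)
      have h4 : n * (c * (n + 1) ^ c) ≤ c * (n + 1) ^ (1 + c) := by
        rw [pow_add, pow_one]
        nlinarith [Nat.zero_le (c * (n + 1) ^ c)]
      rw [add_mul, one_mul]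
      omega
    cases b <;> exact key _

end WordFormula

/-- A promise problem that is separated by a first-order formula is in AC⁰. -/
theorem inAC0_of_formula {yes no : Set (List Bool)} (φ : WordFormula 0)
    (hyes : ∀ w ∈ yes, φ.Holds w.get Fin.elim0) (hno : ∀ w ∈ no, ¬ φ.Holds w.get Fin.elim0) :
    InAC0 yes no := by
  obtain ⟨c, hc⟩ := φ.exists_size_circuit_le
  have hacc : ∀ (n : ℕ) (w : Fin n → Bool),
      (φ.circuit true (Fin.elim0 : Fin 0 → Fin n)).Accepts w ↔ φ.Holds w Fin.elim0 := fun n w => by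
    rw [φ.accepts_circuit]; simp
  -- For `n ≥ 1`, `(n + 1) ^ c ≤ 2 ^ c * n ^ c`; the additive constant covers `n = 0`.
  refine ⟨fun n => φ.circuit true Fin.elim0, φ.depthBound, c * 2 ^ c + c, φ,
    fun n => φ.depth_circuit_le _ _, fun n => (hc n _ _).trans ?_, hacc,
    fun w hw => (hacc _ _).2 (hyes w hw), fun w hw h => hno w hw ((hacc _ _).1 h)⟩
  have h2c : 1 ≤ 2 ^ c := Nat.one_le_two_pow
  rcases n.eq_zero_or_pos with rfl | hn
  · simp only [zero_add, one_pow, mul_one]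
    omega
  · calc c * (n + 1) ^ c ≤ c * (2 * n) ^ c :=
          Nat.mul_le_mul_left c (Nat.pow_le_pow_left (by omega) c)
      _ = c * 2 ^ c * n ^ c := by rw [mul_pow]; ring
      _ ≤ (c * 2 ^ c + c) * n ^ (c * 2 ^ c + c) :=
          Nat.mul_le_mul (by omega) (Nat.pow_le_pow_right hn (by omega))
      _ ≤ _ := by omega

/-! ### Definable predicates -/

/-- The predicate of words and tuples of positions is defined by a first-order formula. -/
def Definable {k : ℕ} (R : ∀ n, (Fin n → Bool) → (Fin k → Fin n) → Prop) : Prop :=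
  ∃ φ : WordFormula k, ∀ n w v, φ.Holds w v ↔ R n w v

/-- The map is a projection. -/
def IsVar {k : ℕ} (s : ∀ n, (Fin k → Fin n) → Fin n) : Prop :=
  ∃ i, ∀ n v, s n v = v i

/-- The map is a sum of projections and a constant. -/
def IsTerm {k : ℕ} (s : ∀ n, (Fin k → Fin n) → ℕ) : Prop :=
  ∃ (l : List (Fin k)) (c : ℕ), ∀ n v, s n v = (l.map fun i => (v i : ℕ)).sum + c

section

variable {k : ℕ}

/-- All entries but the last. -/
abbrev initial {n : ℕ} (v : Fin (k + 1) → Fin n) : Fin k → Fin n := fun i => v i.castSucc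

theorem IsVar.proj (i : Fin k) : IsVar fun _ v => v i := ⟨i, fun _ _ => rfl⟩

theorem IsVar.initial {s : ∀ n, (Fin k → Fin n) → Fin n} (h : IsVar s) :
    IsVar fun n (v : Fin (k + 1) → Fin n) => s n (initial v) := by
  obtain ⟨i, hi⟩ := h
  exact ⟨i.castSucc, fun n v => hi n _⟩

theorem IsVar.isTerm {s : ∀ n, (Fin k → Fin n) → Fin n} (h : IsVar s) :
    IsTerm fun n v => (s n v : ℕ) := by
  obtain ⟨i, hi⟩ := h
  exact ⟨[i], 0, fun n v => by simp [hi]⟩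

theorem IsTerm.initial {s : ∀ n, (Fin k → Fin n) → ℕ} (h : IsTerm s) :
    IsTerm fun n (v : Fin (k + 1) → Fin n) => s n (initial v) := by
  obtain ⟨l, c, h⟩ := h
  exact ⟨l.map Fin.castSucc, c, fun n v => (h n _).trans (by rw [List.map_map]; rfl)⟩

theorem IsTerm.const (c : ℕ) : IsTerm fun (n : ℕ) (_ : Fin k → Fin n) => c :=
  ⟨[], c, fun n v => by simp⟩

theorem IsTerm.add {s t : ∀ n, (Fin k → Fin n) → ℕ} (hs : IsTerm s) (ht : IsTerm t) :
    IsTerm fun n v => s n v + t n v := by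
  obtain ⟨l, c, h⟩ := hs
  obtain ⟨l', c', h'⟩ := ht
  exact ⟨l ++ l', c + c', fun n v => by
    simp only [h, h', List.map_append, List.sum_append]; omega⟩

theorem IsTerm.two_mul {s : ∀ n, (Fin k → Fin n) → ℕ} (hs : IsTerm s) :
    IsTerm fun n v => 2 * s n v := by
  simpa only [Nat.two_mul] using hs.add hs

variable {R R' : ∀ n, (Fin n → Bool) → (Fin k → Fin n) → Prop}

namespace Definable

theorem congr (h : Definable R) (hR : ∀ n w v, R n w v ↔ R' n w v) : Definable R' := by
  obtain ⟨φ, hφ⟩ := h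
  exact ⟨φ, fun n w v => (hφ n w v).trans (hR n w v)⟩

theorem not (h : Definable R) : Definable fun n w v => ¬ R n w v := by
  obtain ⟨φ, hφ⟩ := h
  exact ⟨.not φ, fun n w v => not_congr (hφ n w v)⟩

theorem and (h : Definable R) (h' : Definable R') :
    Definable fun n w v => R n w v ∧ R' n w v := by
  obtain ⟨φ, hφ⟩ := h
  obtain ⟨ψ, hψ⟩ := h'
  exact ⟨.and φ ψ, fun n w v => and_congr (hφ n w v) (hψ n w v)⟩

theorem or (h : Definable R) (h' : Definable R') :
    Definable fun n w v => R n w v ∨ R' n w v :=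
  (h.not.and h'.not).not.congr fun n w v => by tauto

theorem imp (h : Definable R) (h' : Definable R') :
    Definable fun n w v => R n w v → R' n w v :=
  (h.and h'.not).not.congr fun n w v => by tauto

theorem iff (h : Definable R) (h' : Definable R') :
    Definable fun n w v => R n w v ↔ R' n w v :=
  ((h.imp h').and (h'.imp h)).congr fun n w v => by tauto

theorem xor (h : Definable R) (h' : Definable R') :
    Definable fun n w v => Xor (R n w v) (R' n w v) :=
  (h.iff h').not.congr fun n w v => by unfold Xor; tauto

theorem ex {R : ∀ n, (Fin n → Bool) → (Fin k → Fin n) → Fin n → Prop}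
    (h : Definable fun n w (v : Fin (k + 1) → Fin n) => R n w (initial v) (v (Fin.last k))) :
    Definable fun n w v => ∃ x, R n w v x := by
  obtain ⟨φ, hφ⟩ := h
  refine ⟨.ex φ, fun n w v => exists_congr fun x => ?_⟩
  have : initial (Fin.snoc v x : Fin (k + 1) → Fin n) = v := Fin.init_snoc (α := fun _ => Fin n) x v
  rw [hφ]
  simp only [this, Fin.snoc_last]

theorem false : Definable fun n _ (_ : Fin k → Fin n) => False := by
  refine ⟨.ex (.lt (Fin.last k) (Fin.last k)), fun n w v => ?_⟩
  simp [WordFormula.Holds]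

theorem const (p : Prop) : Definable fun n _ (_ : Fin k → Fin n) => p := by
  by_cases h : p
  · exact false.not.congr fun n w v => by simp [h]
  · exact false.congr fun n w v => by simp [h]

theorem lt {s t : ∀ n, (Fin k → Fin n) → Fin n} (hs : IsVar s) (ht : IsVar t) :
    Definable fun n _ v => (s n v : ℕ) < t n v := by
  obtain ⟨i, hi⟩ := hs
  obtain ⟨j, hj⟩ := ht
  exact ⟨.lt i j, fun n w v => by simp [WordFormula.Holds, hi, hj]⟩

/-- Numbers below a position are themselves positions, so bounded quantification over numbers is
quantification over positions. -/
theorem exists_lt {t : ∀ n, (Fin k → Fin n) → Fin n} (ht : IsVar t)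
    {R : ∀ n, (Fin n → Bool) → (Fin k → Fin n) → ℕ → Prop}
    (h : Definable fun n w (v : Fin (k + 1) → Fin n) => R n w (initial v) (v (Fin.last k))) :
    Definable fun n w v => ∃ x < (t n v : ℕ), R n w v x := by
  refine (ex (R := fun n w v x => (x : ℕ) < t n v ∧ R n w v x)
    ((lt (.proj _) ht.initial).and h)).congr fun n w v => ?_
  exact ⟨fun ⟨x, h⟩ => ⟨x, h⟩, fun ⟨x, h, h'⟩ => ⟨⟨x, h.trans (t n v).2⟩, h, h'⟩⟩

theorem forall_lt {t : ∀ n, (Fin k → Fin n) → Fin n} (ht : IsVar t)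
    {R : ∀ n, (Fin n → Bool) → (Fin k → Fin n) → ℕ → Prop}
    (h : Definable fun n w (v : Fin (k + 1) → Fin n) => R n w (initial v) (v (Fin.last k))) :
    Definable fun n w v => ∀ x < (t n v : ℕ), R n w v x :=
  (exists_lt ht (R := fun n w v x => ¬ R n w v x) h.not).not.congr fun n w v => by
    push Not; rfl

theorem exists_pos {R : ∀ n, (Fin n → Bool) → (Fin k → Fin n) → ℕ → Prop}
    (h : Definable fun n w (v : Fin (k + 1) → Fin n) => R n w (initial v) (v (Fin.last k))) :
    Definable fun n w v => ∃ x < (List.ofFn w).length, R n w v x := by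
  refine (ex (R := fun n w v x => R n w v x) h).congr fun n w v => ?_
  rw [List.length_ofFn]
  exact ⟨fun ⟨x, h⟩ => ⟨x, x.2, h⟩, fun ⟨x, h, h'⟩ => ⟨⟨x, h⟩, h'⟩⟩

theorem forall_pos {R : ∀ n, (Fin n → Bool) → (Fin k → Fin n) → ℕ → Prop}
    (h : Definable fun n w (v : Fin (k + 1) → Fin n) => R n w (initial v) (v (Fin.last k))) :
    Definable fun n w v => ∀ x < (List.ofFn w).length, R n w v x :=
  (exists_pos (R := fun n w v x => ¬ R n w v x) h.not).not.congr fun n w v => by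
    push Not; rfl

theorem exists_finite {ι : Type*} {S : Set ι} (hS : S.Finite)
    {R : ι → ∀ n, (Fin n → Bool) → (Fin k → Fin n) → Prop} (h : ∀ i ∈ S, Definable (R i)) :
    Definable fun n w v => ∃ i ∈ S, R i n w v := by
  induction S, hS using Set.Finite.induction_on with
  | empty => exact false.congr fun n w v => by simp
  | @insert a s _ _ ih =>
    refine ((h a (Or.inl rfl)).or (ih fun i hi => h i (Or.inr hi))).congr fun n w v => ?_
    simp

theorem forall_finite {ι : Type*} {S : Set ι} (hS : S.Finite)
    {R : ι → ∀ n, (Fin n → Bool) → (Fin k → Fin n) → Prop} (h : ∀ i ∈ S, Definable (R i)) :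
    Definable fun n w v => ∀ i ∈ S, R i n w v :=
  (exists_finite hS (R := fun i n w v => ¬ R i n w v) fun i hi => (h i hi).not).not.congr
    fun n w v => by push Not; rfl

/-- By strong induction: a position equals `c` iff it differs from every smaller constant while
everything below it is such a constant. -/
theorem eq_const {s : ∀ n, (Fin k → Fin n) → Fin n} (hs : IsVar s) (c : ℕ) :
    Definable fun n _ v => (s n v : ℕ) = c := by
  induction c using Nat.strong_induction_on generalizing k with
  | _ c ih =>
  have h1 : Definable fun n w v => ∀ d ∈ Set.Iio c, (s n v : ℕ) ≠ d :=
    forall_finite (Set.finite_Iio c) fun d hd => (ih d hd hs).not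
  have h2 : Definable fun n w v => ∀ x < (s n v : ℕ), ∃ d ∈ Set.Iio c, x = d :=
    forall_lt hs (exists_finite (Set.finite_Iio c) fun d hd => ih d hd (.proj _))
  refine (h1.and h2).congr fun n w v => ?_
  constructor
  · rintro ⟨h1, h2⟩
    by_contra hne
    rcases lt_or_gt_of_ne hne with h | h
    · exact h1 _ h rfl
    · obtain ⟨d, hd, hcd⟩ := h2 c h
      exact (Set.mem_Iio.1 hd).ne' hcd
  · rintro rfl
    exact ⟨fun d hd => (Set.mem_Iio.1 hd).ne', fun x hx => ⟨x, hx, rfl⟩⟩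

theorem add_eq {s t r : ∀ n, (Fin k → Fin n) → Fin n} (hs : IsVar s) (ht : IsVar t)
    (hr : IsVar r) : Definable fun n _ v => (s n v : ℕ) + t n v = r n v := by
  obtain ⟨i, hi⟩ := hs
  obtain ⟨j, hj⟩ := ht
  obtain ⟨l, hl⟩ := hr
  exact ⟨.add i j l, fun n w v => by simp [WordFormula.Holds, hi, hj, hl]⟩

/-- Sums may exceed the word, but when the total equals a position all partial sums are positions
too, so they can be quantified one summand at a time. -/
theorem term_eq {s : ∀ n, (Fin k → Fin n) → ℕ} {t : ∀ n, (Fin k → Fin n) → Fin n} (hs : IsTerm s)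
    (ht : IsVar t) : Definable fun n _ v => s n v = t n v := by
  obtain ⟨l, c, h⟩ := hs
  simp only [h]
  clear h s
  induction hm : l.length generalizing k with
  | zero =>
    rw [List.length_eq_zero_iff] at hm
    subst hm
    exact (eq_const ht c).congr fun n w v => by simp [eq_comm]
  | succ m ih =>
    obtain ⟨i, l, rfl⟩ := List.exists_cons_of_length_eq_add_one hm
    refine (ex (R := fun n w v x => (l.map fun i => (v i : ℕ)).sum + c = x ∧ (v i : ℕ) + x = t n v)
      (and ?_ (add_eq (.initial (.proj i)) (.proj _) ht.initial))).congr fun n w v => ?_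
    · refine (ih (IsVar.proj (Fin.last k)) (l.map Fin.castSucc) (by simpa using hm)).congr fun n w v => ?_
      rw [List.map_map]
      rfl
    · rw [List.map_cons, List.sum_cons]
      constructor
      · rintro ⟨x, h1, h2⟩
        omega
      · intro h
        exact ⟨⟨_, lt_of_le_of_lt (by omega) (t n v).2⟩, rfl, by simp only; omega⟩

/-- An index outside the word equals no position and yields `none`, so both sides fail there and no
range condition is needed. -/
theorem getElem? {s : ∀ n, (Fin k → Fin n) → ℕ} (hs : IsTerm s) (b : Bool) :
    Definable fun n w v => (List.ofFn w)[s n v]? = some b := by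
  have hbit : Definable fun n w (v : Fin (k + 1) → Fin n) => w (v (Fin.last k)) = b := by
    cases b
    · exact ⟨.not (.bit (Fin.last k)), fun n w v => by simp [WordFormula.Holds]⟩
    · exact ⟨.bit (Fin.last k), fun n w v => Iff.rfl⟩
  refine (ex (R := fun n w v x => s n v = x ∧ w x = b)
    ((term_eq hs.initial (.proj _)).and hbit)).congr fun n w v => ?_
  rw [List.getElem?_ofFn]
  split_ifs with h
  · rw [Option.some_inj]
    exact ⟨fun ⟨x, h1, h2⟩ => by simp only [h1]; exact h2, fun h' => ⟨⟨_, h⟩, rfl, h'⟩⟩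
  · exact iff_of_false (fun ⟨x, h1, _⟩ => h (h1 ▸ x.2)) (by simp)

/-- Existential quantification over tuples of positions. -/
theorem exists_tuple {N : ℕ} {R : ∀ n, (Fin n → Bool) → (Fin N → Fin n) → Prop}
    (h : Definable R) : Definable fun n w (_ : Fin 0 → Fin n) => ∃ y, R n w y := by
  induction N with
  | zero => exact h.congr fun n w v => ⟨fun h => ⟨v, h⟩, fun ⟨y, h⟩ => by
      rwa [Subsingleton.elim v y]⟩
  | succ N ih =>
    refine (ih (R := fun n w y => ∃ x, R n w (Fin.snoc y x)) (ex
      (R := fun n w y x => R n w (Fin.snoc y x)) (h.congr fun n w v => ?_))).congr fun n w v => ?_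
    · have : Fin.snoc (initial v) (v (Fin.last N)) = v := Fin.snoc_init_self v
      rw [this]
    · constructor
      · rintro ⟨y, x, h⟩
        exact ⟨_, h⟩
      · rintro ⟨y, h⟩
        refine ⟨initial y, y (Fin.last N), ?_⟩
        have : Fin.snoc (initial y) (y (Fin.last N)) = y := Fin.snoc_init_self y
        rwa [this]

/-- The length of the word is a given number. -/
theorem length_eq (c : ℕ) : Definable fun n _ (_ : Fin k → Fin n) => n = c := by
  have h : ∀ c, Definable fun n _ (_ : Fin k → Fin n) => c < n := fun c =>
    (ex (R := fun n w v x => (x : ℕ) = c) (eq_const (.proj _) c)).congr fun n w v =>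
      ⟨fun ⟨x, hx⟩ => hx ▸ x.2, fun h => ⟨⟨c, h⟩, rfl⟩⟩
  refine ((h c).not.and (forall_finite (Set.finite_Iio c) fun d _ => h d)).congr fun n w v => ?_
  constructor
  · rintro ⟨h1, h2⟩
    by_contra hne
    exact lt_irrefl n (h2 n (Set.mem_Iio.2 (by omega)))
  · rintro rfl
    exact ⟨lt_irrefl n, fun d hd => hd⟩

/-- Every property of words of bounded length is definable. -/
theorem short (N : ℕ) (Y : Set (List Bool)) :
    Definable fun n w (_ : Fin k → Fin n) => n < N ∧ List.ofFn w ∈ Y := by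
  have hfin : {u : List Bool | u ∈ Y ∧ u.length < N}.Finite :=
    (List.finite_length_lt Bool N).subset fun u hu => hu.2
  have := exists_finite (k := k) hfin (R := fun u n w v => n = u.length ∧
      ∀ i ∈ Set.Iio u.length, ∀ b ∈ {b | u[i]? = some b}, (List.ofFn w)[i]? = some b)
    fun u _ => (length_eq u.length).and (forall_finite (Set.finite_Iio _) fun i _ =>
      forall_finite (Set.toFinite _) fun b _ => getElem? (.const i) b)
  refine this.congr fun n w v => ?_
  constructor
  · rintro ⟨u, ⟨hY, hN⟩, rfl, hu⟩
    have : List.ofFn w = u := by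
      refine List.ext_getElem? fun i => ?_
      by_cases hi : i < u.length
      · rw [List.getElem?_eq_getElem hi]
        exact hu i hi _ (List.getElem?_eq_getElem hi)
      · rw [List.getElem?_eq_none (by rw [List.length_ofFn]; omega),
          List.getElem?_eq_none (by omega)]
    exact ⟨hN, this.symm ▸ hY⟩
  · rintro ⟨hN, hY⟩
    exact ⟨List.ofFn w, ⟨hY, by rwa [List.length_ofFn]⟩, by rw [List.length_ofFn],
      fun i _ b hb => hb⟩

end Definable

end

end FuzzyDLLite

namespace FuzzyDLLite

/-! ### Binary arithmetic by digits -/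

/-- The carry at position `j` in the addition of numbers with the given digits. -/
def CarryAt (P Q : ℕ → Prop) (j : ℕ) : Prop :=
  ∃ i < j, (P i ∧ Q i) ∧ ∀ m < j, i < m → P m ∨ Q m

theorem carryAt_succ {P Q : ℕ → Prop} {j : ℕ} :
    CarryAt P Q (j + 1) ↔ (P j ∧ Q j) ∨ (CarryAt P Q j ∧ (P j ∨ Q j)) := by
  constructor
  · rintro ⟨i, hi, h, hm⟩
    rcases Nat.lt_succ_iff_lt_or_eq.1 hi with hij | rfl
    · exact Or.inr ⟨⟨i, hij, h, fun m hmj => hm m (by omega)⟩, hm j (by omega) hij⟩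
    · exact Or.inl h
  · rintro (h | ⟨⟨i, hi, h, hm⟩, hj⟩)
    · exact ⟨j, by omega, h, fun m h1 h2 => by omega⟩
    · refine ⟨i, by omega, h, fun m h1 h2 => ?_⟩
      rcases Nat.lt_succ_iff_lt_or_eq.1 h1 with h3 | rfl
      · exact hm m h3 h2
      · exact hj

theorem testBit_iff (x j : ℕ) : x.testBit j = true ↔ x / 2 ^ j % 2 = 1 := by
  rw [Nat.testBit_eq_decide_div_mod_eq, decide_eq_true_iff]

/-- Carry look-ahead: a carry arrives iff it was generated at some lower position and propagated
since. Both sides satisfy the same recurrence in `j`; the look-ahead form is first-order. -/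
theorem carryAt_testBit_iff (x y j : ℕ) :
    CarryAt (fun i => x.testBit i = true) (fun i => y.testBit i = true) j ↔
      2 ^ j ≤ x % 2 ^ j + y % 2 ^ j := by
  induction j with
  | zero => simp [CarryAt, Nat.mod_one]
  | succ j ih =>
    rw [carryAt_succ, ih, testBit_iff, testBit_iff, Nat.mod_pow_succ, Nat.mod_pow_succ, pow_succ]
    have hx := Nat.mod_lt x (Nat.two_pow_pos j)
    have hy := Nat.mod_lt y (Nat.two_pow_pos j)
    generalize x % 2 ^ j = a at *
    generalize y % 2 ^ j = b at *
    generalize 2 ^ j = c at *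
    rcases Nat.mod_two_eq_zero_or_one (x / c) with h | h <;>
      rcases Nat.mod_two_eq_zero_or_one (y / c) with h' | h' <;> 
      simp only [h, h', and_false, and_true, false_or, or_false, true_or, or_true, or_self,
        zero_ne_one, false_iff, true_iff] <;> omega

theorem testBit_add_iff (x y j : ℕ) :
    (x + y).testBit j = true ↔ Xor (Xor (x.testBit j = true) (y.testBit j = true))
      (CarryAt (fun i => x.testBit i = true) (fun i => y.testBit i = true) j) := by
  rw [carryAt_testBit_iff, testBit_iff, testBit_iff, testBit_iff,
    Nat.add_div (Nat.two_pow_pos j)]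
  unfold Xor
  split_ifs with h
  all_goals
    simp only [h, not_true_eq_false, not_false_eq_true, and_false, and_true, true_and, false_and,
      false_or, or_false]
    generalize x / 2 ^ j = a
    generalize y / 2 ^ j = b
    omega

/-- The most significant differing digit decides. The bound `n` confines the quantifiers to
positions, as all digits beyond it vanish. -/
theorem lt_iff_exists_digit {a b n : ℕ} (ha : a < 2 ^ n) (hb : b < 2 ^ n) :
    a < b ↔ ∃ j < n, (b.testBit j = true ∧ ¬ a.testBit j = true) ∧
      ∀ i < n, j < i → (a.testBit i = true ↔ b.testBit i = true) := by
  have hhigh : ∀ {x i}, x < 2 ^ n → n ≤ i → x.testBit i = false := fun hx hi =>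
    Nat.testBit_lt_two_pow (hx.trans_le (Nat.pow_le_pow_right two_pos hi))
  constructor
  · intro hab
    obtain ⟨i, hi, hmax⟩ := Nat.exists_most_significant_bit (n := a ^^^ b)
      (fun h => hab.ne (Nat.xor_eq_zero_iff.1 h))
    simp only [Nat.testBit_xor] at hi hmax
    have heq : ∀ j, i < j → a.testBit j = b.testBit j := fun j hj => by
      simpa using hmax j hj
    have hin : i < n := by
      by_contra hin
      rw [hhigh ha (not_lt.1 hin), hhigh hb (not_lt.1 hin)] at hi
      cases hi
    refine ⟨i, hin, ?_, fun j _ hj => by rw [heq j hj]⟩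
    cases ha' : a.testBit i <;> cases hb' : b.testBit i <;> simp only [ha', hb'] at hi
    · cases hi
    · exact ⟨rfl, by simp⟩
    · exact absurd (Nat.lt_of_testBit i hb' ha' fun j hj => (heq j hj).symm) hab.asymm
    · cases hi
  · rintro ⟨j, -, ⟨hb', ha'⟩, h⟩
    refine Nat.lt_of_testBit j (by simpa using ha') hb' fun i hi => ?_
    by_cases hin : i < n
    · exact Bool.eq_iff_iff.2 (h i hin hi)
    · rw [hhigh ha (not_lt.1 hin), hhigh hb (not_lt.1 hin)]

/-! ### Numbers in words -/

theorem cons_prefix_drop {b : Bool} {r W : List Bool} {s : ℕ} :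
    (b :: r) <+: W.drop s ↔ W[s]? = some b ∧ r <+: W.drop (s + 1) := by
  by_cases h : s < W.length
  · rw [List.drop_eq_getElem_cons h, List.cons_prefix_cons, List.getElem?_eq_getElem h,
      Option.some_inj, eq_comm]
  · rw [List.drop_eq_nil_of_le (not_lt.1 h), List.getElem?_eq_none (not_lt.1 h)]
    simp

theorem append_prefix_drop {u r W : List Bool} {s : ℕ} :
    (u ++ r) <+: W.drop s ↔ u <+: W.drop s ∧ r <+: W.drop (s + u.length) := by
  induction u generalizing s with
  | nil => simp
  | cons b u ih =>
    rw [List.cons_append, cons_prefix_drop, cons_prefix_drop, ih, List.length_cons, and_assoc]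
    ring_nf

/-- At position `s` of the word there starts a number with `l` digits. -/
def NumberAt (W : List Bool) (s l : ℕ) : Prop :=
  (W[s + 2 * l]? = some false ∧ W[s + 2 * l + 1]? = some false) ∧
    ∀ i < l, W[s + 2 * i]? = some true

theorem numberAt_succ {W : List Bool} {s l : ℕ} :
    NumberAt W s (l + 1) ↔ W[s]? = some true ∧ NumberAt W (s + 2) l := by
  have e : s + 2 * (l + 1) = s + 2 + 2 * l := by ring
  simp only [NumberAt, e]
  constructor
  · rintro ⟨h, h'⟩
    refine ⟨h' 0 (by omega), h, fun i hi => ?_⟩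
    have := h' (i + 1) (by omega)
    rwa [show s + 2 * (i + 1) = s + 2 + 2 * i by ring] at this
  · rintro ⟨h0, h, h'⟩
    refine ⟨h, fun i hi => ?_⟩
    rcases i with _ | i
    · exact h0
    · have := h' i (by omega)
      rwa [show s + 2 + 2 * i = s + 2 * (i + 1) by ring] at this

theorem NumberAt.unique {W : List Bool} {s l l' : ℕ} (h : NumberAt W s l) (h' : NumberAt W s l') :
    l = l' := by
  rcases lt_trichotomy l l' with hl | hl | hl
  · have := (h'.2 l hl).symm.trans h.1.1
    cases this
  · exact hl
  · have := (h.2 l' hl).symm.trans h'.1.1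
    cases this

theorem NumberAt.lt_length {W : List Bool} {s l : ℕ} (h : NumberAt W s l) :
    s + 2 * l + 1 < W.length := by
  by_contra hc
  have := h.1.2
  rw [List.getElem?_eq_none (not_lt.1 hc)] at this
  cases this

/-- Each digit takes two bits, a mark `true` followed by the digit, so digit `j` stands at `s + 2 *
j + 1`. -/
theorem flatMap_bits_prefix_iff {W : List Bool} (bs : List Bool) (s : ℕ) :
    (bs.flatMap (fun b => [true, b]) ++ [false, false]) <+: W.drop s ↔
      NumberAt W s bs.length ∧ ∀ j < bs.length, W[s + 2 * j + 1]? = bs[j]? := by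
  induction bs generalizing s with
  | nil => simp [cons_prefix_drop, NumberAt]
  | cons b bs ih =>
    simp only [List.flatMap_cons, List.cons_append, List.nil_append, cons_prefix_drop,
      List.length_cons, numberAt_succ, ih]
    constructor
    · rintro ⟨h0, h1, h2, h3⟩
      refine ⟨⟨h0, h2⟩, fun j hj => ?_⟩
      rcases j with _ | j
      · exact h1
      · have := h3 j (by omega)
        rwa [show s + 1 + 1 + 2 * j + 1 = s + 2 * (j + 1) + 1 by ring] at this
    · rintro ⟨⟨h0, h2⟩, h3⟩
      refine ⟨h0, h3 0 (by omega), h2, fun j hj => ?_⟩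
      have := h3 (j + 1) (by omega)
      rwa [show s + 2 * (j + 1) + 1 = s + 1 + 1 + 2 * j + 1 by ring] at this

theorem getElem?_bits {m j : ℕ} (h : j < m.bits.length) : m.bits[j]? = some (m.testBit j) := by
  rw [Nat.testBit_eq_inth, List.getI_eq_getElem _ h, List.getElem?_eq_getElem h]

theorem encodeNat_prefix_iff {W : List Bool} {m s : ℕ} :
    encodeNat m <+: W.drop s ↔ NumberAt W s m.size ∧
      ∀ j < m.size, W[s + 2 * j + 1]? = some (m.testBit j) := by
  rw [encodeNat, flatMap_bits_prefix_iff, Nat.size_eq_bits_len]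
  refine and_congr_right fun _ => forall₂_congr fun j hj => ?_
  rw [getElem?_bits (by rwa [Nat.size_eq_bits_len])]

theorem length_encodeNat (m : ℕ) : (encodeNat m).length = 2 * m.size + 2 := by
  have : ∀ bs : List Bool, (bs.flatMap fun b => [true, b]).length = 2 * bs.length := by
    intro bs
    induction bs with
    | nil => rfl
    | cons b bs ih => simp only [List.flatMap_cons, List.length_append, ih, List.length_cons,
        List.length_nil]; ring
  rw [encodeNat, List.length_append, this, Nat.size_eq_bits_len]
  rfl

/-- The end mark fixes the number of digits, so the code is prefix-free and at most one number
starts at a position. -/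
theorem eq_of_encodeNat_prefix {W : List Bool} {m m' s : ℕ} (h : encodeNat m <+: W.drop s)
    (h' : encodeNat m' <+: W.drop s) : m = m' := by
  rw [encodeNat_prefix_iff] at h h'
  have hs := h.1.unique h'.1
  refine Nat.eq_of_testBit_eq fun j => ?_
  by_cases hj : j < m.size
  · exact Option.some_inj.1 ((h.2 j hj).symm.trans (h'.2 j (hs ▸ hj)))
  · have := Nat.pow_le_pow_right two_pos (not_lt.1 hj)
    rw [Nat.testBit_lt_two_pow (m.lt_size_self.trans_le this),
      Nat.testBit_lt_two_pow (m'.lt_size_self.trans_le (hs ▸ this))]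

/-- The numbers that start at `s` and `t` have the same digits. -/
def SameNumber (W : List Bool) (s t : ℕ) : Prop :=
  ∃ l < W.length, (NumberAt W s l ∧ NumberAt W t l) ∧
    ∀ j < l, W[s + 2 * j + 1]? = some true ↔ W[t + 2 * j + 1]? = some true

theorem sameNumber_comm {W : List Bool} {s t : ℕ} : SameNumber W s t ↔ SameNumber W t s := by
  have : ∀ s t, SameNumber W s t → SameNumber W t s := fun s t ⟨l, hl, ⟨h1, h2⟩, h3⟩ =>
    ⟨l, hl, ⟨h2, h1⟩, fun j hj => (h3 j hj).symm⟩
  exact ⟨this s t, this t s⟩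

theorem sameNumber_iff {W : List Bool} {s t m : ℕ} (h : encodeNat m <+: W.drop s) :
    SameNumber W s t ↔ encodeNat m <+: W.drop t := by
  have h' := encodeNat_prefix_iff.1 h
  constructor
  · rintro ⟨l, -, ⟨h1, h2⟩, h3⟩
    obtain rfl := h1.unique h'.1
    refine encodeNat_prefix_iff.2 ⟨h2, fun j hj => ?_⟩
    have hlt := h2.lt_length
    have hj3 := h3 j hj
    rw [h'.2 j hj, List.getElem?_eq_getElem (by omega), Option.some_inj, Option.some_inj] at hj3
    rw [List.getElem?_eq_getElem (by omega), Option.some_inj]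
    exact (Bool.eq_iff_iff.2 hj3).symm
  · intro ht
    have ht' := encodeNat_prefix_iff.1 ht
    refine ⟨_, ?_, ⟨h'.1, ht'.1⟩, fun j hj => by rw [h'.2 j hj, ht'.2 j hj]⟩
    have := h'.1.lt_length
    omega

/-- The `j`-th digit of the number that starts at `s` is one. -/
def DigitAt (W : List Bool) (s j : ℕ) : Prop :=
  ∃ l < W.length, NumberAt W s l ∧ j < l ∧ W[s + 2 * j + 1]? = some true

theorem digitAt_iff {W : List Bool} {s m : ℕ} (h : encodeNat m <+: W.drop s) (j : ℕ) :
    DigitAt W s j ↔ m.testBit j = true := by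
  have h' := encodeNat_prefix_iff.1 h
  constructor
  · rintro ⟨l, -, h1, hj, h2⟩
    obtain rfl := h1.unique h'.1
    rw [h'.2 j hj] at h2
    exact Option.some_inj.1 h2
  · intro hm
    have hj : j < m.size := by
      by_contra hj
      rw [Nat.testBit_lt_two_pow
        (m.lt_size_self.trans_le (Nat.pow_le_pow_right two_pos (not_lt.1 hj)))] at hm
      cases hm
    have := h'.1.lt_length
    exact ⟨_, by omega, h'.1, hj, by rw [h'.2 j hj, hm]⟩

/-- The `j`-th digit of `c` times the number that starts at `s` is one. -/
def MulDigitAt (W : List Bool) (s : ℕ) : ℕ → ℕ → Prop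
  | 0, _ => False
  | c + 1, j => Xor (Xor (MulDigitAt W s c j) (DigitAt W s j))
      (CarryAt (MulDigitAt W s c) (DigitAt W s) j)

theorem mulDigitAt_iff {W : List Bool} {s m : ℕ} (h : encodeNat m <+: W.drop s) (c j : ℕ) :
    MulDigitAt W s c j ↔ (c * m).testBit j = true := by
  induction c generalizing j with
  | zero => simp [MulDigitAt]
  | succ c ih =>
    have h1 : MulDigitAt W s c = fun i => (c * m).testBit i = true := funext fun i => propext (ih i)
    have h2 : DigitAt W s = fun i => m.testBit i = true := funext fun i => propext (digitAt_iff h i)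
    rw [MulDigitAt, h1, h2, add_mul, one_mul, testBit_add_iff]

/-- `c` times the number that starts at `s` is less than `d` times the number that starts at `t`
(for words that are long enough). -/
def MulLt (W : List Bool) (c d s t : ℕ) : Prop :=
  ∃ j < W.length, (MulDigitAt W t d j ∧ ¬ MulDigitAt W s c j) ∧
    ∀ i < W.length, j < i → (MulDigitAt W s c i ↔ MulDigitAt W t d i)

/-- The encoding spends two bits per digit, so the number fills at most half of the word length; the
other half leaves room for the constant factor. -/
theorem mul_lt_two_pow_length {W : List Bool} {s m c : ℕ} (h : encodeNat m <+: W.drop s)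
    (hc : 2 * c ≤ W.length) : c * m < 2 ^ W.length := by
  have h1 := (encodeNat_prefix_iff.1 h).1.lt_length
  calc c * m < 2 ^ c * 2 ^ m.size :=
        Nat.mul_lt_mul'' Nat.lt_two_pow_self m.lt_size_self
    _ = 2 ^ (c + m.size) := (pow_add 2 c m.size).symm
    _ ≤ 2 ^ W.length := Nat.pow_le_pow_right two_pos (by omega)

theorem mulLt_iff {W : List Bool} {c d s t m m' : ℕ} (hs : encodeNat m <+: W.drop s)
    (ht : encodeNat m' <+: W.drop t) (hc : 2 * c ≤ W.length) (hd : 2 * d ≤ W.length) :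
    MulLt W c d s t ↔ c * m < d * m' := by
  rw [lt_iff_exists_digit (mul_lt_two_pow_length hs hc) (mul_lt_two_pow_length ht hd)]
  simp only [MulLt, mulDigitAt_iff hs, mulDigitAt_iff ht]

/-- The degree that starts at `s`, as numerator and denominator, is at least `r`. -/
def DegreeAt (W : List Bool) (r : ℚ) (s : ℕ) : Prop :=
  ∃ l < W.length, NumberAt W s l ∧ ¬ MulLt W r.den r.num.natAbs s (s + 2 * l + 2)

/-- Cross-multiplication: since `r` is fixed, the numerator and denominator in the word are
multiplied only by constants. The denominator starts right after the end mark of the numerator. -/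
theorem degreeAt_iff {W : List Bool} {r : ℚ} (hr : 0 ≤ r) {d : Set.Icc (0 : ℚ) 1} {s : ℕ}
    (h : encodeDegree d <+: W.drop s) (hden : 2 * r.den ≤ W.length)
    (hnum : 2 * r.num.natAbs ≤ W.length) : DegreeAt W r s ↔ r ≤ (d : ℚ) := by
  obtain ⟨h1, h2⟩ := append_prefix_drop.1 h
  rw [length_encodeNat, ← add_assoc] at h2
  have h1' := (encodeNat_prefix_iff.1 h1).1
  have hlt := h1'.lt_length
  have key : ¬ MulLt W r.den r.num.natAbs s (s + 2 * (d : ℚ).num.natAbs.size + 2) ↔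
      r ≤ (d : ℚ) := by
    rw [mulLt_iff h1 h2 hden hnum, not_lt, Rat.le_iff]
    have e1 : ((r.num.natAbs : ℕ) : ℤ) = r.num := Int.natAbs_of_nonneg (Rat.num_nonneg.2 hr)
    have e2 : (((d : ℚ).num.natAbs : ℕ) : ℤ) = (d : ℚ).num :=
      Int.natAbs_of_nonneg (Rat.num_nonneg.2 d.2.1)
    rw [← e1, ← e2, ← Int.ofNat_le]
    push_cast
    rw [mul_comm (r.den : ℤ)]
    simp
  rw [← key]
  constructor
  · rintro ⟨l, -, hl, h⟩
    obtain rfl := hl.unique h1'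
    exact h
  · exact fun h => ⟨_, by omega, h1', h⟩

/-! ### Definability of the predicates of words -/

variable {k : ℕ} {s t : ∀ n, (Fin k → Fin n) → ℕ}

theorem definable_prefix (hs : IsTerm s) (u : List Bool) :
    Definable fun n w v => u <+: (List.ofFn w).drop (s n v) := by
  induction u generalizing s with
  | nil => exact (Definable.const True).congr fun n w v => by simp
  | cons b u ih =>
    exact ((Definable.getElem? hs b).and (ih (hs.add (.const 1)))).congr fun n w v =>
      cons_prefix_drop.symm

theorem definable_numberAt (hs : IsTerm s) {l : ∀ n, (Fin k → Fin n) → Fin n} (hl : IsVar l) :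
    Definable fun n w v => NumberAt (List.ofFn w) (s n v) (l n v) :=
  ((Definable.getElem? (hs.add hl.isTerm.two_mul) false).and
    (Definable.getElem? ((hs.add hl.isTerm.two_mul).add (.const 1)) false)).and
    (.forall_lt hl (.getElem? (hs.initial.add (IsVar.proj _).isTerm.two_mul) true))

theorem definable_sameNumber (hs : IsTerm s) (ht : IsTerm t) :
    Definable fun n w v => SameNumber (List.ofFn w) (s n v) (t n v) :=
  .exists_pos (((definable_numberAt hs.initial (.proj _)).and
    (definable_numberAt ht.initial (.proj _))).and
    (.forall_lt (.proj _) ((Definable.getElem?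
      ((hs.initial.initial.add (IsVar.proj _).isTerm.two_mul).add (.const 1)) true).iff
      (.getElem? ((ht.initial.initial.add (IsVar.proj _).isTerm.two_mul).add (.const 1)) true))))

theorem definable_digitAt (hs : IsTerm s) {j : ∀ n, (Fin k → Fin n) → Fin n} (hj : IsVar j) :
    Definable fun n w v => DigitAt (List.ofFn w) (s n v) (j n v) :=
  .exists_pos ((definable_numberAt hs.initial (.proj _)).and ((Definable.lt hj.initial (.proj _)).and
    (.getElem? ((hs.initial.add hj.initial.isTerm.two_mul).add (.const 1)) true)))

/-- The factor `c` is a constant, so multiplication unfolds into `c` nested additions inside one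
formula. -/
theorem definable_mulDigitAt (hs : IsTerm s) (c : ℕ) {j : ∀ n, (Fin k → Fin n) → Fin n}
    (hj : IsVar j) : Definable fun n w v => MulDigitAt (List.ofFn w) (s n v) c (j n v) := by
  induction c generalizing k with
  | zero => exact .false
  | succ c ih =>
    refine ((ih hs hj).xor (definable_digitAt hs hj)).xor ?_
    refine .exists_lt hj (((ih hs.initial (.proj _)).and
      (definable_digitAt hs.initial (.proj _))).and ?_)
    exact .forall_lt hj.initial ((Definable.lt (IsVar.proj _).initial (.proj _)).imp
      ((ih hs.initial.initial (.proj _)).or (definable_digitAt hs.initial.initial (.proj _))))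

theorem definable_mulLt (c d : ℕ) (hs : IsTerm s) (ht : IsTerm t) :
    Definable fun n w v => MulLt (List.ofFn w) c d (s n v) (t n v) :=
  .exists_pos (((definable_mulDigitAt ht.initial d (.proj _)).and
    (definable_mulDigitAt hs.initial c (.proj _)).not).and
    (.forall_pos ((Definable.lt (IsVar.proj _).initial (.proj _)).imp
      ((definable_mulDigitAt hs.initial.initial c (.proj _)).iff
        (definable_mulDigitAt ht.initial.initial d (.proj _))))))

theorem definable_degreeAt (r : ℚ) (hs : IsTerm s) :
    Definable fun n w v => DegreeAt (List.ofFn w) r (s n v) :=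
  .exists_pos ((definable_numberAt hs.initial (.proj _)).and
    (definable_mulLt _ _ hs.initial
      ((hs.initial.add (IsVar.proj _).isTerm.two_mul).add (.const 2))).not)

theorem definable_even {x : ∀ n, (Fin k → Fin n) → Fin n} (hx : IsVar x) :
    Definable fun n _ v => Even (x n v : ℕ) :=
  (Definable.ex (R := fun n _ v y => (y : ℕ) + y = x n v)
    (.add_eq (.proj _) (.proj _) hx.initial)).congr fun n w v =>
      ⟨fun ⟨y, h⟩ => ⟨y, h.symm⟩, fun ⟨y, h⟩ => ⟨⟨y, by omega⟩, h.symm⟩⟩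

end FuzzyDLLite

namespace FuzzyDLLite

/-! ### Parsing the input -/

/-- The word has even length and contains no start mark at an even position. -/
def NoStart (u : List Bool) : Prop :=
  Even u.length ∧ ∀ i, Even i → ¬ (u[i]? = some false ∧ u[i + 1]? = some true)

theorem NoStart.nil : NoStart [] := ⟨by simp, by simp⟩

theorem NoStart.append {u u' : List Bool} (h : NoStart u) (h' : NoStart u') :
    NoStart (u ++ u') := by
  refine ⟨by rw [List.length_append]; exact h.1.add h'.1, fun i hi => ?_⟩
  obtain ⟨m, hm⟩ := h.1
  obtain ⟨j, hj⟩ := hi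
  by_cases hlt : i < u.length
  · rw [List.getElem?_append_left hlt, List.getElem?_append_left (by omega)]
    exact h.2 i ⟨j, hj⟩
  · rw [List.getElem?_append_right (by omega), List.getElem?_append_right (by omega),
      show i + 1 - u.length = i - u.length + 1 by omega]
    exact h'.2 _ ⟨j - m, by omega⟩

theorem NoStart.pair {a b : Bool} (h : ¬ (a = false ∧ b = true)) : NoStart [a, b] := by
  refine ⟨by simp, fun i hi => ?_⟩
  rcases i with _ | _ | i
  · simpa using h
  · simp at hi
  · simp

theorem NoStart.flatMap {ι : Type*} {f : ι → List Bool} (l : List ι) (h : ∀ x, NoStart (f x)) :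
    NoStart (l.flatMap f) := by
  induction l with
  | nil => exact .nil
  | cons x l ih => rw [List.flatMap_cons]; exact (h x).append ih

theorem noStart_encodeNat (m : ℕ) : NoStart (encodeNat m) :=
  (NoStart.flatMap _ fun _ => .pair (by simp)).append (.pair (by simp))

/-- The code is self-synchronizing: two-bit symbols are aligned at even positions and a start mark
occurs only where an entry begins, so entries can be found without parsing from the left. -/
theorem exists_prefix_of_start {ι : Type*} {f : ι → List Bool} (hf : ∀ x, NoStart (f x))
    (L : List ι) : ∀ u, NoStart u → ∀ x, Even x →
      (u ++ L.flatMap fun b => false :: true :: f b)[x]? = some false →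
      (u ++ L.flatMap fun b => false :: true :: f b)[x + 1]? = some true →
      ∃ b ∈ L, (false :: true :: f b) <+: (u ++ L.flatMap fun b => false :: true :: f b).drop x := by
  induction L with
  | nil =>
    intro u hu x hx h h'
    rw [List.flatMap_nil, List.append_nil] at h h'
    exact absurd ⟨h, h'⟩ (hu.2 x hx)
  | cons b L ih =>
    intro u hu x hx h h'
    obtain ⟨m, hm⟩ := hu.1
    obtain ⟨j, hj⟩ := hx
    rw [List.flatMap_cons] at h h' ⊢
    by_cases hlt : x < u.length
    · rw [List.getElem?_append_left (by omega)] at h h'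
      exact absurd ⟨h, h'⟩ (hu.2 x ⟨j, hj⟩)
    · have hdrop : ∀ l : List Bool, (u ++ l).drop x = l.drop (x - u.length) := fun l => by
        rw [List.drop_append, List.drop_eq_nil_of_le (not_lt.1 hlt), List.nil_append]
      rw [List.getElem?_append_right (by omega)] at h h'
      rw [hdrop]
      obtain ⟨z, hz⟩ : ∃ z, x - u.length = z + z := ⟨j - m, by omega⟩
      rw [show x + 1 - u.length = z + z + 1 by omega] at h'
      rw [hz] at h ⊢
      -- Either the position is this entry's own mark, or it lies behind the mark and `f b` takes
      -- the role of the initial segment.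
      rcases z with _ | z
      · exact ⟨b, by simp, by simp⟩
      · have e : z + 1 + (z + 1) = z + z + 1 + 1 := by ring
        rw [e] at h h' ⊢
        simp only [List.cons_append, List.getElem?_cons_succ, List.drop_succ_cons] at h h' ⊢
        obtain ⟨b', hb', hp⟩ := ih (f b) (hf b) (z + z) ⟨z, rfl⟩ h h'
        exact ⟨b', List.mem_cons_of_mem _ hb', hp⟩

theorem exists_start_of_mem {ι : Type*} {f : ι → List Bool} (hf : ∀ x, NoStart (f x))
    {L : List ι} {u : List Bool} (hu : NoStart u) {b : ι} (hb : b ∈ L) :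
    ∃ x, Even x ∧
      (false :: true :: f b) <+: (u ++ L.flatMap fun b => false :: true :: f b).drop x := by
  obtain ⟨L₁, L₂, rfl⟩ := List.append_of_mem hb
  refine ⟨(u ++ L₁.flatMap fun b => false :: true :: f b).length, ?_, ?_⟩
  · rw [List.length_append]
    refine hu.1.add ?_
    clear hb
    induction L₁ with
    | nil => simp
    | cons c L₁ ih =>
      rw [List.flatMap_cons, List.length_append, List.length_cons, List.length_cons]
      exact ((((hf c).1.add_one).add_one)).add ih
  · rw [List.flatMap_append, List.flatMap_cons, ← List.append_assoc, List.drop_left]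
    exact List.prefix_append _ _

variable {NC NR NI : Type u}

/-- The kind of an assertion. -/
def Assertion.kind {D : Type} : Assertion NC NR NI D → ℕ
  | .concept (.name _) _ _ => 0
  | .concept (.ex (.name _)) _ _ => 1
  | .concept (.ex (.inv _)) _ _ => 2
  | .role _ _ _ _ => 3

/-- The individual names in an assertion. -/
def Assertion.args {D : Type} : Assertion NC NR NI D → List NI
  | .concept _ a _ => [a]
  | .role _ a b _ => [a, b]

/-- The degree of an assertion. -/
def Assertion.degree {D : Type} : Assertion NC NR NI D → D
  | .concept _ _ d => d
  | .role _ _ _ d => d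

/-- The number of individual names in the assertions of a kind. -/
def kindArity (κ : ℕ) : ℕ := if κ = 3 then 2 else 1

theorem Assertion.length_args {D : Type} (β : Assertion NC NR NI D) :
    β.args.length = kindArity β.kind := by
  rcases β with ⟨A | P | P, a, d⟩ | ⟨P, a, b, d⟩ <;> rfl

variable {k : ℕ} {a : Fin k → NI} {L : List (Assertion NC NR NI (Set.Icc (0 : ℚ) 1))}

theorem mem_aboxOfList {β : Assertion NC NR NI unitInterval} :
    β ∈ aboxOfList L ↔ ∃ β' ∈ L, β'.mapDegree ratDegree = β := by
  classical
  simp [aboxOfList]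

variable [Encodable NC] [Encodable NR]

/-- The code of the concept or role name of an assertion. -/
def Assertion.code {D : Type} : Assertion NC NR NI D → ℕ
  | .concept (.name A) _ _ => Encodable.encode A
  | .concept (.ex (.name P)) _ _ => Encodable.encode P
  | .concept (.ex (.inv P)) _ _ => Encodable.encode P
  | .role P _ _ _ => Encodable.encode P

/-- There is an assertion of the given kind and name in the list, with arguments that stand in
the relation `V` to the terms and a degree of at least `r`. -/
def Entry (L : List (Assertion NC NR NI (Set.Icc (0 : ℚ) 1))) (V : RTerm NI → NI → Prop) (r : ℚ)
    (κ c : ℕ) (ts : List (RTerm NI)) : Prop :=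
  ∃ β ∈ L, (β.kind = κ ∧ β.code = c) ∧ List.Forall₂ V ts β.args ∧ r ≤ (β.degree : ℚ)

/-- The entries that make an atom true. -/
def RAtom.Patterns (Φ : ℕ → ℕ → List (RTerm NI) → Prop) : RAtom NC NR NI → Prop
  | .concept A t => Φ 0 (Encodable.encode A) [t]
  | .role P s t => Φ 3 (Encodable.encode P) [s, t] ∨
      (t = none ∧ Φ 1 (Encodable.encode P) [s]) ∨ (s = none ∧ Φ 2 (Encodable.encode P) [t])

theorem RAtom.Patterns.mono {Φ Φ' : ℕ → ℕ → List (RTerm NI) → Prop} {α : RAtom NC NR NI}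
    (h : ∀ κ c ts, (∀ t ∈ ts, ∃ b, α.arg b = t) → ts.length = kindArity κ →
      Φ κ c ts → Φ' κ c ts) (hα : α.Patterns Φ) : α.Patterns Φ' := by
  rcases α with ⟨A, t⟩ | ⟨P, s, t⟩
  · exact h _ _ _ (fun t' ht' => ⟨true, (List.mem_singleton.1 ht').symm⟩) rfl hα
  · have hs : ∃ b, (RAtom.role P s t : RAtom NC NR NI).arg b = s := ⟨false, rfl⟩
    have ht : ∃ b, (RAtom.role P s t : RAtom NC NR NI).arg b = t := ⟨true, rfl⟩
    rcases hα with hα | ⟨rfl, hα⟩ | ⟨rfl, hα⟩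
    · refine Or.inl (h _ _ _ ?_ rfl hα)
      simp only [List.mem_cons, List.not_mem_nil, or_false, forall_eq_or_imp, forall_eq]
      exact ⟨hs, ht⟩
    · refine Or.inr (Or.inl ⟨rfl, h _ _ _ ?_ rfl hα⟩)
      simpa only [List.mem_singleton, forall_eq] using hs
    · refine Or.inr (Or.inr ⟨rfl, h _ _ _ ?_ rfl hα⟩)
      simpa only [List.mem_singleton, forall_eq] using ht

/-- Database satisfaction is put into a uniform form, a search for one entry with given kind, code
and arguments, which can be checked on the word. -/
theorem dbSat_aboxOfList_iff {h : ℕ → NI} {α : RAtom NC NR NI} {d : ℝ} {r : ℚ}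
    (hd : (r : ℝ) = d) : DBSat (aboxOfList L) h (α, d) ↔
      α.Patterns (Entry L (RTerm.Takes h) r) := by
  subst hd
  have hle : ∀ e : Set.Icc (0 : ℚ) 1, (r : ℝ) ≤ (ratDegree e : ℝ) ↔ r ≤ (e : ℚ) := fun e =>
    Rat.cast_le
  have hcon : ∀ (B : BasicConcept NC NR) (t : RTerm NI),
      (∃ (a : NI) (e : unitInterval), (r : ℝ) ≤ (e : ℝ) ∧ RTerm.Takes h t a ∧
        Assertion.concept B a e ∈ aboxOfList L) ↔
      ∃ (a : NI) (e : Set.Icc (0 : ℚ) 1), r ≤ (e : ℚ) ∧ RTerm.Takes h t a ∧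
        Assertion.concept B a e ∈ L := by
    intro B t
    constructor
    · rintro ⟨a, e, he, ht, hA⟩
      obtain ⟨β, hβ, hβe⟩ := mem_aboxOfList.1 hA
      cases β <;> cases hβe
      exact ⟨_, _, (hle _).1 he, ht, hβ⟩
    · rintro ⟨a, e, he, ht, hA⟩
      exact ⟨a, _, (hle e).2 he, ht, mem_aboxOfList.2 ⟨_, hA, rfl⟩⟩
  have hrol : ∀ (P : NR) (s t : RTerm NI),
      (∃ (a b : NI) (e : unitInterval), (r : ℝ) ≤ (e : ℝ) ∧ RTerm.Takes h s a ∧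
        RTerm.Takes h t b ∧ Assertion.role P a b e ∈ aboxOfList L) ↔
      ∃ (a b : NI) (e : Set.Icc (0 : ℚ) 1), r ≤ (e : ℚ) ∧ RTerm.Takes h s a ∧
        RTerm.Takes h t b ∧ Assertion.role P a b e ∈ L := by
    intro P s t
    constructor
    · rintro ⟨a, b, e, he, hs, ht, hA⟩
      obtain ⟨β, hβ, hβe⟩ := mem_aboxOfList.1 hA
      cases β <;> cases hβe
      exact ⟨_, _, _, (hle _).1 he, hs, ht, hβ⟩
    · rintro ⟨a, b, e, he, hs, ht, hA⟩
      exact ⟨a, b, _, (hle e).2 he, hs, ht, mem_aboxOfList.2 ⟨_, hA, rfl⟩⟩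
  have h0 : ∀ (A : NC) (t : RTerm NI), (∃ (a : NI) (e : Set.Icc (0 : ℚ) 1), r ≤ (e : ℚ) ∧
      RTerm.Takes h t a ∧ Assertion.concept (.name A) a e ∈ L) ↔
      Entry L (RTerm.Takes h) r 0 (Encodable.encode A) [t] := by
    intro A t
    constructor
    · rintro ⟨a, e, he, ht, hA⟩
      exact ⟨_, hA, ⟨rfl, rfl⟩, .cons ht .nil, he⟩
    · rintro ⟨⟨A' | P' | P', a, e⟩ | ⟨P', a, b, e⟩, hβ, ⟨hk, hc⟩, hf, he⟩ <;> cases hk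
      obtain rfl := Encodable.encode_injective hc
      cases hf with | cons ht _ => exact ⟨a, e, he, ht, hβ⟩
  have h1 : ∀ (P : NR) (t : RTerm NI), (∃ (a : NI) (e : Set.Icc (0 : ℚ) 1), r ≤ (e : ℚ) ∧
      RTerm.Takes h t a ∧ Assertion.concept (.ex (.name P)) a e ∈ L) ↔
      Entry L (RTerm.Takes h) r 1 (Encodable.encode P) [t] := by
    intro P t
    constructor
    · rintro ⟨a, e, he, ht, hA⟩
      exact ⟨_, hA, ⟨rfl, rfl⟩, .cons ht .nil, he⟩
    · rintro ⟨⟨A' | P' | P', a, e⟩ | ⟨P', a, b, e⟩, hβ, ⟨hk, hc⟩, hf, he⟩ <;> cases hk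
      obtain rfl := Encodable.encode_injective hc
      cases hf with | cons ht _ => exact ⟨a, e, he, ht, hβ⟩
  have h2 : ∀ (P : NR) (t : RTerm NI), (∃ (a : NI) (e : Set.Icc (0 : ℚ) 1), r ≤ (e : ℚ) ∧
      RTerm.Takes h t a ∧ Assertion.concept (.ex (.inv P)) a e ∈ L) ↔
      Entry L (RTerm.Takes h) r 2 (Encodable.encode P) [t] := by
    intro P t
    constructor
    · rintro ⟨a, e, he, ht, hA⟩
      exact ⟨_, hA, ⟨rfl, rfl⟩, .cons ht .nil, he⟩
    · rintro ⟨⟨A' | P' | P', a, e⟩ | ⟨P', a, b, e⟩, hβ, ⟨hk, hc⟩, hf, he⟩ <;> cases hk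
      obtain rfl := Encodable.encode_injective hc
      cases hf with | cons ht _ => exact ⟨a, e, he, ht, hβ⟩
  have h3 : ∀ (P : NR) (s t : RTerm NI), (∃ (a b : NI) (e : Set.Icc (0 : ℚ) 1), r ≤ (e : ℚ) ∧
      RTerm.Takes h s a ∧ RTerm.Takes h t b ∧ Assertion.role P a b e ∈ L) ↔
      Entry L (RTerm.Takes h) r 3 (Encodable.encode P) [s, t] := by
    intro P s t
    constructor
    · rintro ⟨a, b, e, he, hs, ht, hA⟩
      exact ⟨_, hA, ⟨rfl, rfl⟩, .cons hs (.cons ht .nil), he⟩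
    · rintro ⟨⟨A' | P' | P', a, e⟩ | ⟨P', a, b, e⟩, hβ, ⟨hk, hc⟩, hf, he⟩ <;> cases hk
      obtain rfl := Encodable.encode_injective hc
      cases hf with | cons hs hf => cases hf with | cons ht _ => exact ⟨a, b, e, he, hs, ht, hβ⟩
  rcases α with ⟨A, t⟩ | ⟨P, s, t⟩
  · exact (hcon _ t).trans (h0 A t)
  · exact or_congr ((hrol P s t).trans (h3 P s t)) (or_congr
      (and_congr_right fun _ => (hcon _ s).trans (h1 P s))
      (and_congr_right fun _ => (hcon _ t).trans (h2 P t)))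

variable [Encodable NI]

/-- The encoding of a list of individual names. -/
def encodeArgs (l : List NI) : List Bool :=
  l.flatMap fun a => encodeNat (Encodable.encode a)

theorem noStart_encodeArgs (l : List NI) : NoStart (encodeArgs l) :=
  .flatMap l fun _ => noStart_encodeNat _

/-- The encoding of an assertion, without the start mark. -/
def assertionTail (β : Assertion NC NR NI (Set.Icc (0 : ℚ) 1)) : List Bool :=
  encodeNat β.kind ++ (encodeNat β.code ++ (encodeArgs β.args ++ encodeDegree β.degree))

theorem encodeAssertion_eq (β : Assertion NC NR NI (Set.Icc (0 : ℚ) 1)) :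
    encodeAssertion β = false :: true :: assertionTail β := by
  rcases β with ⟨A | P | P, a, d⟩ | ⟨P, a, b, d⟩ <;>
    simp [encodeAssertion, assertionTail, encodeArgs, Assertion.kind, Assertion.code,
      Assertion.args, Assertion.degree]

theorem noStart_assertionTail (β : Assertion NC NR NI (Set.Icc (0 : ℚ) 1)) :
    NoStart (assertionTail β) :=
  (noStart_encodeNat _).append ((noStart_encodeNat _).append ((noStart_encodeArgs _).append
    ((noStart_encodeNat _).append (noStart_encodeNat _))))

theorem encodeInput_eq (a : Fin k → NI) (L : List (Assertion NC NR NI (Set.Icc (0 : ℚ) 1))) :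
    encodeInput a L =
      encodeArgs (List.ofFn a) ++ L.flatMap fun β => false :: true :: assertionTail β := by
  simp only [encodeInput, encodeArgs]
  congr 2
  exact funext encodeAssertion_eq

theorem exists_assertion_of_start {x : ℕ} (hx : Even x)
    (h : (encodeInput a L)[x]? = some false) (h' : (encodeInput a L)[x + 1]? = some true) :
    ∃ β ∈ L, (false :: true :: assertionTail β) <+: (encodeInput a L).drop x := by
  rw [encodeInput_eq] at h h' ⊢
  exact exists_prefix_of_start noStart_assertionTail L _ (noStart_encodeArgs _) x hx h h'

theorem exists_start_of_assertion {β : Assertion NC NR NI (Set.Icc (0 : ℚ) 1)} (hβ : β ∈ L) :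
    ∃ x, Even x ∧ (false :: true :: assertionTail β) <+: (encodeInput a L).drop x := by
  rw [encodeInput_eq]
  exact exists_start_of_mem noStart_assertionTail (noStart_encodeArgs _) hβ

theorem eq_of_encodeArgs_prefix {W : List Bool} {l l' : List NI} (hl : l.length = l'.length)
    {s : ℕ} (h : encodeArgs l <+: W.drop s) (h' : encodeArgs l' <+: W.drop s) : l = l' := by
  induction l generalizing l' s with
  | nil => exact (List.length_eq_zero_iff.1 hl.symm).symm
  | cons a l ih =>
    rcases l' with _ | ⟨a', l'⟩
    · cases hl
    · rw [encodeArgs, List.flatMap_cons, append_prefix_drop] at h h'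
      obtain rfl : a = a' := Encodable.encode_injective (eq_of_encodeNat_prefix h.1 h'.1)
      rw [ih (by simpa using hl) h.2 h'.2]

/-- Decoding proceeds field by field, each field being prefix-free. The kind fixes the number of
individual names, and rationals have a unique reduced numerator and denominator. -/
theorem eq_of_assertionTail_prefix {W : List Bool}
    {β β' : Assertion NC NR NI (Set.Icc (0 : ℚ) 1)} {s : ℕ}
    (h : assertionTail β <+: W.drop s) (h' : assertionTail β' <+: W.drop s) : β = β' := by
  obtain ⟨h1, h⟩ := append_prefix_drop.1 h
  obtain ⟨h1', h'⟩ := append_prefix_drop.1 h'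
  have hkind := eq_of_encodeNat_prefix h1 h1'
  rw [← hkind] at h'
  obtain ⟨h2, h⟩ := append_prefix_drop.1 h
  obtain ⟨h2', h'⟩ := append_prefix_drop.1 h'
  have hcode := eq_of_encodeNat_prefix h2 h2'
  rw [← hcode] at h'
  obtain ⟨h3, h⟩ := append_prefix_drop.1 h
  obtain ⟨h3', h'⟩ := append_prefix_drop.1 h'
  have hargs := eq_of_encodeArgs_prefix (by rw [β.length_args, β'.length_args, hkind]) h3 h3'
  rw [← hargs] at h'
  obtain ⟨h4, h⟩ := append_prefix_drop.1 h
  obtain ⟨h4', h'⟩ := append_prefix_drop.1 h'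
  have hnum := eq_of_encodeNat_prefix h4 h4'
  rw [← hnum] at h'
  have hden := eq_of_encodeNat_prefix h h'
  have hdeg : β.degree = β'.degree := by
    refine Subtype.ext (Rat.ext ?_ hden)
    have e1 := Int.natAbs_of_nonneg (Rat.num_nonneg.2 β.degree.2.1)
    have e2 := Int.natAbs_of_nonneg (Rat.num_nonneg.2 β'.degree.2.1)
    rw [← e1, ← e2, hnum]
  clear h h' h1 h1' h2 h2' h3 h3' h4 h4' hnum hden
  rcases β with ⟨A | P | P, a, d⟩ | ⟨P, a, b, d⟩ <;>
    rcases β' with ⟨A' | P' | P', a', d'⟩ | ⟨P', a', b', d'⟩ <;>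
    simp_all [Assertion.kind, Assertion.code, Assertion.args, Assertion.degree]

/-- The input determines the tuple and the set of assertions. -/
theorem encodeInput_inj {a' : Fin k → NI}
    {L' : List (Assertion NC NR NI (Set.Icc (0 : ℚ) 1))}
    (h : encodeInput a L = encodeInput a' L') : a = a' ∧ ∀ β, β ∈ L ↔ β ∈ L' := by
  constructor
  · have h1 : encodeArgs (List.ofFn a) <+: (encodeInput a L).drop 0 := by
      rw [encodeInput_eq]; exact List.prefix_append _ _
    have h2 : encodeArgs (List.ofFn a') <+: (encodeInput a L).drop 0 := by
      rw [h, encodeInput_eq]; exact List.prefix_append _ _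
    exact List.ofFn_injective (eq_of_encodeArgs_prefix (by simp) h1 h2)
  · have key : ∀ {a a' : Fin k → NI} {L L' : List (Assertion NC NR NI (Set.Icc (0 : ℚ) 1))},
        encodeInput a L = encodeInput a' L' → ∀ β ∈ L, β ∈ L' := by
      intro a a' L L' h β hβ
      obtain ⟨x, hx, hp⟩ := exists_start_of_assertion (a := a) hβ
      obtain ⟨h0, h1, h2⟩ : _ ∧ _ ∧ _ := by simpa only [cons_prefix_drop] using hp
      rw [h] at h0 h1
      obtain ⟨β', hβ', hp'⟩ := exists_assertion_of_start hx h0 h1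
      rw [← h] at hp'
      obtain ⟨-, -, h2'⟩ : _ ∧ _ ∧ _ := by simpa only [cons_prefix_drop] using hp'
      rwa [eq_of_assertionTail_prefix h2 h2']
    exact fun β => ⟨key h β, key h.symm β⟩

/-! ### Query evaluation on words -/

/-- The number at position `s` is a possible value of the term, where the value of the variable
`v` is the number at position `y v`. -/
def TermAt (W : List Bool) (y : ℕ → ℕ) : RTerm NI → ℕ → Prop
  | none, _ => True
  | some (.ind b), s => encodeNat (Encodable.encode b) <+: W.drop s
  | some (.var v), s => SameNumber W (y v) s

/-- At position `s` there starts a sequence of numbers that are possible values of the terms, and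
its end satisfies `K`. -/
def ArgsAt (W : List Bool) (y : ℕ → ℕ) (K : ℕ → Prop) : List (RTerm NI) → ℕ → Prop
  | [], s => K s
  | t :: ts, s => TermAt W y t s ∧
      ∃ l < W.length, NumberAt W s l ∧ ArgsAt W y K ts (s + 2 * l + 2)

/-- The individual name is a possible value of the term, where the value of the variable `v` is
the number at position `y v`. -/
def TermVal (W : List Bool) (y : ℕ → ℕ) : RTerm NI → NI → Prop
  | none, _ => True
  | some (.ind b), a => b = a
  | some (.var v), a => encodeNat (Encodable.encode a) <+: W.drop (y v)

theorem termAt_iff {W : List Bool} {y : ℕ → ℕ} {t : RTerm NI} {a : NI} {s : ℕ}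
    (h : encodeNat (Encodable.encode a) <+: W.drop s) : TermAt W y t s ↔ TermVal W y t a := by
  rcases t with _ | b | v
  · exact Iff.rfl
  · constructor
    · intro hb
      exact Encodable.encode_injective (eq_of_encodeNat_prefix hb h)
    · rintro rfl
      exact h
  · show SameNumber W (y v) s ↔ _
    rw [sameNumber_comm, sameNumber_iff h]
    rfl

/-- The condition `K` is a continuation tested behind the last argument. The quantified digit counts
are forced, since at most one number starts at each position. -/
theorem argsAt_iff {W : List Bool} {y : ℕ → ℕ} {K : ℕ → Prop} {ts : List (RTerm NI)}
    {args : List NI} (hl : ts.length = args.length) {s : ℕ}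
    (h : encodeArgs args <+: W.drop s) :
    ArgsAt W y K ts s ↔
      List.Forall₂ (TermVal W y) ts args ∧ K (s + (encodeArgs args).length) := by
  induction ts generalizing args s with
  | nil =>
    obtain rfl := List.length_eq_zero_iff.1 hl.symm
    simp [ArgsAt, encodeArgs]
  | cons t ts ih =>
    rcases args with _ | ⟨a, args⟩
    · cases hl
    · have e : encodeArgs (a :: args) = encodeNat (Encodable.encode a) ++ encodeArgs args := rfl
      rw [e, append_prefix_drop] at h
      obtain ⟨h1, h2⟩ := h
      have hn := (encodeNat_prefix_iff.1 h1).1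
      have hlt := hn.lt_length
      rw [length_encodeNat, ← add_assoc] at h2
      rw [ArgsAt, termAt_iff h1, List.forall₂_cons, and_assoc, e, List.length_append,
        length_encodeNat, ← add_assoc, ← add_assoc, ← ih (by simpa using hl) h2]
      refine and_congr_right fun _ => ⟨?_, fun h => ⟨_, by omega, hn, h⟩⟩
      rintro ⟨l, -, hl, h⟩
      obtain rfl := hl.unique hn
      exact h

/-- There is an entry of the given kind and name, with arguments that are possible values of the
terms and a degree of at least `r`. -/
def PatternAt (W : List Bool) (y : ℕ → ℕ) (r : ℚ) (κ c : ℕ) (ts : List (RTerm NI)) : Prop :=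
  ∃ x < W.length, Even x ∧ (false :: true :: (encodeNat κ ++ encodeNat c)) <+: W.drop x ∧
    ArgsAt W y (DegreeAt W r) ts (x + (false :: true :: (encodeNat κ ++ encodeNat c)).length)

/-- A start mark at an even position exposes a genuine entry; the fixed header then identifies its
kind and name by unique decoding, after which arguments and degree are read off. -/
theorem patternAt_iff {r : ℚ} (hr : 0 ≤ r) (hden : 2 * r.den ≤ (encodeInput a L).length)
    (hnum : 2 * r.num.natAbs ≤ (encodeInput a L).length) {y : ℕ → ℕ} {κ c : ℕ}
    {ts : List (RTerm NI)} (hts : ts.length = kindArity κ) :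
    PatternAt (encodeInput a L) y r κ c ts ↔ Entry L (TermVal (encodeInput a L) y) r κ c ts := by
  have key : ∀ (β : Assertion NC NR NI (Set.Icc (0 : ℚ) 1)) (x : ℕ),
      ts.length = kindArity β.kind →
      (false :: true :: assertionTail β) <+: (encodeInput a L).drop x →
      ((false :: true :: (encodeNat β.kind ++ encodeNat β.code)) <+: (encodeInput a L).drop x ∧
      (ArgsAt (encodeInput a L) y (DegreeAt (encodeInput a L) r) ts
          (x + (false :: true :: (encodeNat β.kind ++ encodeNat β.code)).length) ↔
        List.Forall₂ (TermVal (encodeInput a L) y) ts β.args ∧ r ≤ (β.degree : ℚ))) := by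
    intro β x hl hp
    have e : false :: true :: assertionTail β =
        (false :: true :: (encodeNat β.kind ++ encodeNat β.code)) ++
          (encodeArgs β.args ++ encodeDegree β.degree) := by
      simp [assertionTail]
    rw [e, append_prefix_drop] at hp
    obtain ⟨hp1, hp2⟩ := hp
    obtain ⟨hp2, hp3⟩ := append_prefix_drop.1 hp2
    refine ⟨hp1, ?_⟩
    rw [argsAt_iff (by rw [hl, β.length_args]) hp2, degreeAt_iff hr hp3 hden hnum]
  constructor
  · rintro ⟨x, -, hx, hp, hargs⟩
    obtain ⟨h0, h1, h2⟩ : _ ∧ _ ∧ _ := by simpa only [cons_prefix_drop] using hp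
    obtain ⟨β, hβ, hβp⟩ := exists_assertion_of_start hx h0 h1
    obtain ⟨-, -, h3⟩ : _ ∧ _ ∧ _ := by simpa only [cons_prefix_drop] using hβp
    obtain ⟨h2, h2'⟩ := append_prefix_drop.1 h2
    obtain ⟨h3, h3'⟩ := append_prefix_drop.1 h3
    obtain rfl := eq_of_encodeNat_prefix h2 h3
    obtain rfl := eq_of_encodeNat_prefix h2' (append_prefix_drop.1 h3').1
    exact ⟨β, hβ, ⟨rfl, rfl⟩, (key β x hts hβp).2.1 hargs⟩
  · rintro ⟨β, hβ, ⟨rfl, rfl⟩, h⟩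
    obtain ⟨x, hx, hp⟩ := exists_start_of_assertion (a := a) hβ
    obtain ⟨k1, k2⟩ := key β x hts hp
    refine ⟨x, ?_, hx, k1, k2.2 h⟩
    by_contra hlt
    have := (cons_prefix_drop.1 hp).1
    rw [List.getElem?_eq_none (not_lt.1 hlt)] at this
    cases this

end FuzzyDLLite

/-! ### Evaluation of rewritten queries on encoded inputs. -/

namespace FuzzyDLLite

variable {NC NR NI : Type u} {k : ℕ}

/-- The rational number that is equal to a given real number, if there is one. -/
noncomputable def ratOf (d : ℝ) : ℚ := Classical.epsilon fun r : ℚ => (r : ℝ) = d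

theorem ratOf_eq {d : ℝ} (h : ∃ r : ℚ, (r : ℝ) = d) : (ratOf d : ℝ) = d :=
  Classical.epsilon_spec h

/-- Raising uses only rational operations, so rational inputs keep every threshold of the rewriting
rational and comparable by integer arithmetic. -/
theorem RaiseClosure.exists_rat {tn : TNorm} {D E : Set ℝ} (hD : ∀ d ∈ D, ∃ r : ℚ, (r : ℝ) = d)
    (hE : ∀ e ∈ E, ∃ r : ℚ, (r : ℝ) = e) {d : ℝ} (h : RaiseClosure tn D E d) :
    ∃ r : ℚ, (r : ℝ) = d := by
  induction h with
  | base h => exact hD _ h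
  | step _ he _ ih =>
    obtain ⟨r, rfl⟩ := ih
    obtain ⟨s, rfl⟩ := hE _ he
    cases tn
    · exact ⟨r, rfl⟩
    · exact ⟨min 1 (r + 1 - s), by simp [TNorm.raise]⟩
    · exact ⟨r / s, by simp [TNorm.raise]⟩

theorem forall₂_imp_mem {ι κ : Type*} {V V' : ι → κ → Prop} {l : List ι} {l' : List κ}
    (h : List.Forall₂ V l l') (hV : ∀ x ∈ l, ∀ y ∈ l', V x y → V' x y) :
    List.Forall₂ V' l l' := by
  induction h with
  | nil => exact .nil
  | cons h _ ih =>
    exact .cons (hV _ (by simp) _ (by simp) h) (ih fun x hx y hy =>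
      hV x (List.mem_cons_of_mem _ hx) y (List.mem_cons_of_mem _ hy))

theorem forall₂_ofFn {ι κ : Type*} {V : ι → κ → Prop} {m : ℕ} {f : Fin m → ι} {g : Fin m → κ} :
    List.Forall₂ V (List.ofFn f) (List.ofFn g) ↔ ∀ i, V (f i) (g i) := by
  induction m with
  | zero => simp
  | succ m ih =>
    rw [List.ofFn_succ, List.ofFn_succ, List.forall₂_cons, Fin.forall_fin_succ, ih]

/-- All variables of the query are less than `N`. -/
def RQuery.VarsLt (N : ℕ) (p : RQuery NC NR NI k) : Prop :=
  (∀ i v, p.head i = .var v → v < N) ∧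
    ∀ γ ∈ p.body, ∀ b v, γ.1.arg b = some (.var v) → v < N

theorem RQuery.exists_varsLt {S : Set (RQuery NC NR NI k)} (hS : S.Finite) :
    ∃ N, ∀ p ∈ S, p.VarsLt N := by
  have hfin : (⋃ p ∈ S, ({v | ∃ i, p.head i = .var v} ∪
      ⋃ γ ∈ (p.body : Set (RAtom NC NR NI × ℝ)), ⋃ b, {v | γ.1.arg b = some (.var v)})).Finite := by
    refine hS.biUnion fun p _ => Set.Finite.union ?_ (p.body.finite_toSet.biUnion fun γ _ =>
      Set.finite_iUnion fun b => Set.Subsingleton.finite fun v hv w hw => ?_)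
    · refine ((Set.finite_range p.head).preimage (f := Term.var) fun v _ w _ h => ?_).subset ?_
      · cases h; rfl
      · rintro v ⟨i, hi⟩
        exact ⟨i, hi⟩
    · have := hv.symm.trans hw
      cases this
      rfl
  obtain ⟨N, hN⟩ := hfin.bddAbove
  refine ⟨N + 1, fun p hp => ⟨fun i v hv => Nat.lt_succ_of_le (hN ?_),
    fun γ hγ b v hv => Nat.lt_succ_of_le (hN ?_)⟩⟩
  · exact Set.mem_biUnion hp (Or.inl ⟨i, hv⟩)
  · exact Set.mem_biUnion hp (Or.inr (Set.mem_biUnion hγ (Set.mem_iUnion.2 ⟨b, hv⟩)))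

/-- Atoms with threshold zero can be dropped from a query. -/
theorem certainAnswers_filter_pos (tn : TNorm) (T : TBox NC NR) (A : ABox NC NR NI)
    (q : TQ NC NR NI k) [DecidablePred fun γ : Atom NC NR NI × unitInterval => 0 < γ.2] :
    ({ answerVars := q.answerVars, body := q.body.filter fun γ => 0 < γ.2 } :
      TQ NC NR NI k).certainAnswers tn T A = q.certainAnswers tn T A := by
  ext a
  refine forall₂_congr fun I _ => exists_congr fun π => and_congr_right fun _ => ?_
  constructor
  · intro h γ hγ
    by_cases hpos : 0 < γ.2
    · exact h γ (Finset.mem_filter.2 ⟨hγ, hpos⟩)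
    · have h0 : (γ.2 : ℝ) ≤ 0 := not_lt.1 hpos
      refine h0.trans ?_
      rcases γ.1 with ⟨B, t⟩ | ⟨P, s, t⟩
      · exact (I.basicConcept_mem_Icc B _).1
      · exact (I.rol P _ _).2.1
  · exact fun h γ hγ => h γ (Finset.mem_of_mem_filter γ hγ)

theorem Entry.mono [Encodable NC] [Encodable NR]
    {L : List (Assertion NC NR NI (Set.Icc (0 : ℚ) 1))} {V V' : RTerm NI → NI → Prop} {r : ℚ} {κ c : ℕ} {ts : List (RTerm NI)}
    (h : Entry L V r κ c ts) (hV : ∀ t ∈ ts, ∀ β ∈ L, ∀ b ∈ β.args, V t b → V' t b) :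
    Entry L V' r κ c ts := by
  obtain ⟨β, hβ, hk, hf, hr⟩ := h
  exact ⟨β, hβ, hk, forall₂_imp_mem hf fun t ht b hb => hV t ht β hβ b hb, hr⟩

variable [Encodable NC] [Encodable NR] [Encodable NI]

/-- The query is satisfied by the input, where the value of the variable `v` is the number at
position `y v`. -/
def RQuery.HoldsAt (W : List Bool) (y : ℕ → ℕ) (p : RQuery NC NR NI k) : Prop :=
  ArgsAt W y (fun _ => True) (List.ofFn fun i => some (p.head i)) 0 ∧
    ∀ γ ∈ (p.body : Set (RAtom NC NR NI × ℝ)), γ.1.Patterns (PatternAt W y (ratOf γ.2))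

variable {a : Fin k → NI} {L : List (Assertion NC NR NI (Set.Icc (0 : ℚ) 1))}

theorem exists_position_of_mem_args {W : List Bool} {l : List NI} {s : ℕ}
    (h : encodeArgs l <+: W.drop s) {b : NI} (hb : b ∈ l) :
    ∃ s', encodeNat (Encodable.encode b) <+: W.drop s' := by
  induction l generalizing s with
  | nil => cases hb
  | cons c l ih =>
    rw [encodeArgs, List.flatMap_cons, append_prefix_drop] at h
    rcases List.mem_cons.1 hb with rfl | hb
    · exact ⟨s, h.1⟩
    · exact ih h.2 hb

theorem encodeArgs_prefix_encodeInput :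
    encodeArgs (List.ofFn a) <+: (encodeInput a L).drop 0 := by
  rw [encodeInput_eq]
  exact List.prefix_append _ _

theorem exists_position_of_mem_assertion {β : Assertion NC NR NI (Set.Icc (0 : ℚ) 1)}
    (hβ : β ∈ L) {b : NI} (hb : b ∈ β.args) :
    ∃ s, encodeNat (Encodable.encode b) <+: (encodeInput a L).drop s := by
  obtain ⟨x, -, hp⟩ := exists_start_of_assertion (a := a) hβ
  obtain ⟨-, -, hp⟩ : _ ∧ _ ∧ _ := by simpa only [cons_prefix_drop] using hp
  obtain ⟨-, hp⟩ := append_prefix_drop.1 hp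
  obtain ⟨-, hp⟩ := append_prefix_drop.1 hp
  exact exists_position_of_mem_args (append_prefix_drop.1 hp).1 hb

/-- Evaluation of a query on the encoding of the input, provided that it is long enough. -/
theorem exists_holdsAt_iff [Nonempty NI] {p : RQuery NC NR NI k} {N : ℕ} (hN : p.VarsLt N)
    (hrat : ∀ γ ∈ p.body, ∃ r : ℚ, (r : ℝ) = γ.2) (hpos : ∀ γ ∈ p.body, 0 < γ.2)
    (h0 : 0 < (encodeInput a L).length)
    (hlen : ∀ γ ∈ p.body, 2 * (ratOf γ.2).den ≤ (encodeInput a L).length ∧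
      2 * (ratOf γ.2).num.natAbs ≤ (encodeInput a L).length) :
    (∃ y : ℕ → ℕ, (∀ v, y v < (encodeInput a L).length ∧ (N ≤ v → y v = 0)) ∧
        p.HoldsAt (encodeInput a L) y) ↔
      ∃ h : ℕ → NI, (∀ i, (p.head i).eval id h = a i) ∧
        ∀ γ ∈ p.body, DBSat (aboxOfList L) h γ := by
  classical
  set W := encodeInput a L with hW
  have hr : ∀ γ ∈ p.body, 0 ≤ ratOf γ.2 := by
    intro γ hγ
    have := (hpos γ hγ).le
    rw [← ratOf_eq (hrat γ hγ)] at this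
    exact_mod_cast this
  have hhead : ∀ y, ArgsAt W y (fun _ => True) (List.ofFn fun i => some (p.head i)) 0 ↔
      ∀ i, TermVal W y (some (p.head i)) (a i) := by
    intro y
    rw [argsAt_iff (args := List.ofFn a) (by simp) encodeArgs_prefix_encodeInput, forall₂_ofFn]
    exact and_iff_left trivial
  have hbody : ∀ y, ∀ γ ∈ p.body, γ.1.Patterns (PatternAt W y (ratOf γ.2)) ↔
      γ.1.Patterns (Entry L (TermVal W y) (ratOf γ.2)) := by
    intro y γ hγ
    exact ⟨RAtom.Patterns.mono fun κ c ts _ hts =>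
        (patternAt_iff (hr γ hγ) (hlen γ hγ).1 (hlen γ hγ).2 hts).1,
      RAtom.Patterns.mono fun κ c ts _ hts =>
        (patternAt_iff (hr γ hγ) (hlen γ hγ).1 (hlen γ hγ).2 hts).2⟩
  constructor
  · rintro ⟨y, -, hh, hb⟩
    -- The name written at position `y v`. If no name starts there the value is arbitrary, and no
    -- satisfied constraint mentions `v`.
    let h : ℕ → NI := fun v =>
      Classical.epsilon fun b => encodeNat (Encodable.encode b) <+: W.drop (y v)
    have hval : ∀ t b, TermVal W y t b → RTerm.Takes h t b := by
      rintro (_ | b' | v) b ht s hs <;> cases hs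
      · exact ht
      · exact Encodable.encode_injective (eq_of_encodeNat_prefix
          (Classical.epsilon_spec (p := fun b => encodeNat (Encodable.encode b) <+: W.drop (y v))
            ⟨b, ht⟩) ht)
    refine ⟨h, fun i => hval _ _ ((hhead y).1 hh i) _ rfl, fun γ hγ => ?_⟩
    refine (dbSat_aboxOfList_iff (ratOf_eq (hrat γ hγ))).2 ?_
    exact ((hbody y γ hγ).1 (hb γ hγ)).mono fun κ c ts _ _ he =>
      he.mono fun t _ β _ b _ => hval t b
  · rintro ⟨h, hh, hb⟩
    -- Some position of the value of `v`, with default `0` if that name does not occur in the word.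
    -- A variable that is matched by an entry or the answer tuple has its value written there.
    let y : ℕ → ℕ := fun v =>
      if hv : v < N ∧ ∃ s, encodeNat (Encodable.encode (h v)) <+: W.drop s
      then hv.2.choose else 0
    have hy : ∀ v, v < N → (∃ s, encodeNat (Encodable.encode (h v)) <+: W.drop s) →
        encodeNat (Encodable.encode (h v)) <+: W.drop (y v) := by
      intro v hv hs
      have : v < N ∧ ∃ s, encodeNat (Encodable.encode (h v)) <+: W.drop s := ⟨hv, hs⟩
      simp only [y, dif_pos this]
      exact this.2.choose_spec
    have hval : ∀ t b, (∀ v, t = some (.var v) → v < N) →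
        (∃ s, encodeNat (Encodable.encode b) <+: W.drop s) → RTerm.Takes h t b →
          TermVal W y t b := by
      rintro (_ | b' | v) b hv hs ht
      · trivial
      · exact ht _ rfl
      · have hb : h v = b := ht _ rfl
        subst hb
        exact hy v (hv v rfl) hs
    refine ⟨y, fun v => ⟨?_, fun hv => dif_neg fun h => absurd h.1 (not_lt.2 hv)⟩,
      (hhead y).2 fun i => ?_, fun γ hγ => (hbody y γ hγ).2 ?_⟩
    · simp only [y]
      split_ifs with hv
      · have := (encodeNat_prefix_iff.1 hv.2.choose_spec).1.lt_length
        omega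
      · exact h0
    · refine hval _ _ (fun v hv => hN.1 i v (Option.some_inj.1 hv)) ?_ ?_
      · exact exists_position_of_mem_args (l := List.ofFn a)
          encodeArgs_prefix_encodeInput (by simp)
      · rintro s ⟨⟩
        exact hh i
    · refine ((dbSat_aboxOfList_iff (ratOf_eq (hrat γ hγ))).1 (hb γ hγ)).mono
        fun κ c ts hts _ he => he.mono fun t ht β hβ b hb => ?_
      obtain ⟨c, rfl⟩ := hts t ht
      exact hval _ _ (hN.2 γ hγ c) (exists_position_of_mem_assertion hβ hb)

/-! ### Definability of query evaluation -/

section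

variable {m : ℕ} {Y : ∀ n, (Fin m → Fin n) → ℕ → ℕ}

theorem definable_termAt (hY : ∀ v, IsTerm fun n u => Y n u v) (t : RTerm NI)
    {s : ∀ n, (Fin m → Fin n) → ℕ} (hs : IsTerm s) :
    Definable fun n w u => TermAt (List.ofFn w) (Y n u) t (s n u) := by
  rcases t with _ | b | v
  · exact .const True
  · exact definable_prefix hs _
  · exact definable_sameNumber (hY v) hs

theorem definable_argsAt (hY : ∀ v, IsTerm fun n u => Y n u v) {K : List Bool → ℕ → Prop}
    (hK : ∀ {m : ℕ} {s : ∀ n, (Fin m → Fin n) → ℕ}, IsTerm s →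
      Definable fun n w u => K (List.ofFn w) (s n u)) (ts : List (RTerm NI))
    {s : ∀ n, (Fin m → Fin n) → ℕ} (hs : IsTerm s) :
    Definable fun n w u => ArgsAt (List.ofFn w) (Y n u) (K (List.ofFn w)) ts (s n u) := by
  induction ts generalizing m with
  | nil => exact hK hs
  | cons t ts ih =>
    exact (definable_termAt hY t hs).and (.exists_pos
      ((definable_numberAt hs.initial (.proj _)).and
        (ih (fun v => (hY v).initial)
          ((hs.initial.add (IsVar.proj _).isTerm.two_mul).add (.const 2)))))

theorem definable_patternAt (hY : ∀ v, IsTerm fun n u => Y n u v) (r : ℚ) (κ c : ℕ)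
    (ts : List (RTerm NI)) :
    Definable fun n w u => PatternAt (List.ofFn w) (Y n u) r κ c ts :=
  .exists_pos ((definable_even (.proj _)).and
    ((definable_prefix (IsVar.proj _).isTerm _).and
      (definable_argsAt (fun v => (hY v).initial) (K := fun W => DegreeAt W r)
        (definable_degreeAt r) ts ((IsVar.proj _).isTerm.add (.const _)))))

theorem definable_holdsAt (hY : ∀ v, IsTerm fun n u => Y n u v) (p : RQuery NC NR NI k) :
    Definable fun n w u => p.HoldsAt (List.ofFn w) (Y n u) := by
  refine (definable_argsAt hY (K := fun _ _ => True) (fun _ => .const True) _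
    (.const 0)).and (.forall_finite p.body.finite_toSet fun γ _ => ?_)
  rcases γ with ⟨A | ⟨P, s, t⟩, d⟩
  · exact definable_patternAt hY _ _ _ _
  · exact (definable_patternAt hY _ _ _ _).or
      (((Definable.const _).and (definable_patternAt hY _ _ _ _)).or
        ((Definable.const _).and (definable_patternAt hY _ _ _ _)))

end

theorem definable_exists_holdsAt (N : ℕ) (p : RQuery NC NR NI k) :
    Definable fun n w (_ : Fin 0 → Fin n) => ∃ y : ℕ → ℕ,
      (∀ v, y v < (List.ofFn w).length ∧ (N ≤ v → y v = 0)) ∧ p.HoldsAt (List.ofFn w) y := by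
  let Y : ∀ n, (Fin N → Fin n) → ℕ → ℕ := fun n u v => if h : v < N then u ⟨v, h⟩ else 0
  have hY : ∀ v, IsTerm fun n u => Y n u v := by
    intro v
    by_cases h : v < N
    · simp only [Y, dif_pos h]
      exact (IsVar.proj _).isTerm
    · simp only [Y, dif_neg h]
      exact .const 0
  -- The default value `0` must be a position; this excludes the empty word.
  have hpos : Definable fun n w (_ : Fin 0 → Fin n) => ∃ x < (List.ofFn w).length, True :=
    .exists_pos (.const True)
  refine (hpos.and (Definable.exists_tuple (definable_holdsAt hY p))).congr fun n w _ => ?_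
  constructor
  · rintro ⟨⟨x, hx, -⟩, u, hu⟩
    refine ⟨Y n u, fun v => ⟨?_, fun h => dif_neg (not_lt.2 h)⟩, hu⟩
    simp only [Y]
    split_ifs
    · rw [List.length_ofFn]; exact (u _).2
    · omega
  · rintro ⟨y, hy, h⟩
    refine ⟨⟨_, (hy 0).1, trivial⟩, fun i => ⟨y i, by simpa using (hy i).1⟩, ?_⟩
    convert h using 1
    funext v
    simp only [Y]
    split_ifs with hv
    · rfl
    · exact ((hy v).2 (not_lt.1 hv)).symm

/-- Evaluation of a finite union of queries with positive rational thresholds is in AC⁰. -/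
theorem exists_formula_dbAnswers [Nonempty NI] {S : Set (RQuery NC NR NI k)} (hS : S.Finite)
    (hrat : ∀ p ∈ S, ∀ γ ∈ p.body, ∃ r : ℚ, (r : ℝ) = γ.2)
    (hpos : ∀ p ∈ S, ∀ γ ∈ p.body, 0 < γ.2) :
    ∃ φ : WordFormula 0, ∀ (a : Fin k → NI) (L : List (Assertion NC NR NI (Set.Icc (0 : ℚ) 1))),
      φ.Holds (encodeInput a L).get Fin.elim0 ↔ a ∈ dbAnswers (aboxOfList L) S := by
  obtain ⟨N, hN⟩ := RQuery.exists_varsLt hS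
  -- From this length on, products of written numbers with the constants of the thresholds fit into
  -- the word.
  obtain ⟨M, hM⟩ : ∃ M, ∀ p ∈ S, ∀ γ ∈ p.body,
      2 * (ratOf γ.2).den ≤ M ∧ 2 * (ratOf γ.2).num.natAbs ≤ M := by
    have hfin : ((fun γ : RAtom NC NR NI × ℝ => 2 * (ratOf γ.2).den + 2 * (ratOf γ.2).num.natAbs) ''
        ⋃ p ∈ S, (p.body : Set (RAtom NC NR NI × ℝ))).Finite :=
      (hS.biUnion fun p _ => p.body.finite_toSet).image _
    obtain ⟨M, hM⟩ := hfin.bddAbove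
    refine ⟨M, fun p hp γ hγ => ?_⟩
    have := hM ⟨γ, Set.mem_biUnion hp hγ, rfl⟩
    simp only at this
    omega
  -- Words of length at most `M` are answered from a finite table. The table is well defined because
  -- the encoding determines the tuple and the set of assertions.
  let Z : Set (List Bool) := {W | ∃ (a : Fin k → NI)
    (L : List (Assertion NC NR NI (Set.Icc (0 : ℚ) 1))), W = encodeInput a L ∧
      a ∈ dbAnswers (aboxOfList L) S}
  obtain ⟨φ, hφ⟩ := (Definable.short (k := 0) (M + 1) Z).or
    ((Definable.short (k := 0) (M + 1) Set.univ).not.and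
      (Definable.exists_finite hS fun p _ => definable_exists_holdsAt N p))
  refine ⟨φ, fun a L => ?_⟩
  simp only [hφ, List.ofFn_get]
  by_cases hlt : (encodeInput a L).length < M + 1
  · simp only [hlt, Set.mem_univ, true_and, and_self, not_true_eq_false, false_and, or_false]
    constructor
    · rintro ⟨a', L', h, hmem⟩
      obtain ⟨rfl, hL⟩ := encodeInput_inj h
      have : aboxOfList L = aboxOfList L' := by
        ext β
        simp only [mem_aboxOfList, hL]
      rwa [this]
    · exact fun h => ⟨a, L, rfl, h⟩
  · simp only [hlt, false_and, not_false_eq_true, true_and, false_or]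
    refine exists_congr fun p => and_congr_right fun hp => ?_
    have hle : M ≤ (encodeInput a L).length := by omega
    exact exists_holdsAt_iff (hN p hp) (hrat p hp) (hpos p hp) (by omega) fun γ hγ =>
      ⟨(hM p hp γ hγ).1.trans hle, (hM p hp γ hγ).2.trans hle⟩

theorem answeringInAC0_of_pos [Nonempty NI] {tn : TNorm} {T : TBox NC NR} {q : TQ NC NR NI k}
    (hpos : ∀ γ ∈ q.body, 0 < γ.2) (hT : ∀ α ∈ T, IsRat α.degree)
    (hq : ∀ γ ∈ q.body, IsRat γ.2) : AnsweringInAC0 tn T q := by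
  obtain ⟨n, -, hfin, hans⟩ := perfectRef_correct tn T hpos
  obtain ⟨φ, hφ⟩ := exists_formula_dbAnswers hfin
    (fun p hp γ hγ => (thresholds_perfectRef n p hp γ hγ).exists_rat
      (by rintro _ ⟨γ, hγ, rfl⟩; obtain ⟨r, hr⟩ := hq γ hγ; exact ⟨r, hr.symm⟩)
      (by rintro _ ⟨α, hα, rfl⟩; obtain ⟨r, hr⟩ := hT α hα; exact ⟨r, hr.symm⟩))
    (fun p hp γ hγ => ((thresholds_perfectRef n p hp γ hγ).mem_Ioc
      (by rintro _ ⟨γ, hγ, rfl⟩; exact ⟨hpos γ hγ, γ.2.2.2⟩) T.degrees_subset).1)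
  refine inAC0_of_formula φ ?_ ?_
  · rintro w ⟨a, L, rfl, hcons, ha⟩
    rw [hφ, ← hans _ hcons]
    exact ha.2 trivial
  · rintro w ⟨a, L, rfl, hcons, ha⟩
    rw [hφ, ← hans _ hcons]
    exact ha.1

/-- Atoms with threshold zero hold under every assignment, and dropping them leaves the certain
answers unchanged, so the positive case applies; answer variables left without atoms do no harm. -/
theorem answeringInAC0 [Nonempty NI] {tn : TNorm} {T : TBox NC NR} {q : TQ NC NR NI k}
    (hT : ∀ α ∈ T, IsRat α.degree) (hq : ∀ γ ∈ q.body, IsRat γ.2) :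
    AnsweringInAC0 tn T q := by
  classical
  have h := answeringInAC0_of_pos (tn := tn) (T := T)
    (q := { answerVars := q.answerVars, body := q.body.filter fun γ => 0 < γ.2 })
    (fun γ hγ => (Finset.mem_filter.1 hγ).2) hT
    fun γ hγ => hq γ (Finset.mem_of_mem_filter γ hγ)
  simpa only [AnsweringInAC0, instances, certainAnswers_filter_pos] using h

end FuzzyDLLite

theorem mainTheorem5 {NC NR NI : Type u} [Nonempty NI] (tn : FuzzyDLLite.TNorm)
    (T : FuzzyDLLite.TBox NC NR) {k : ℕ} (q : FuzzyDLLite.TQ NC NR NI k) :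
    ((∀ γ ∈ q.body, 0 < γ.2) →
      ∃ n : ℕ,
        FuzzyDLLite.perfectRef tn T q (n + 1) = FuzzyDLLite.perfectRef tn T q n ∧
        (FuzzyDLLite.perfectRef tn T q n).Finite ∧
        ∀ A : FuzzyDLLite.ABox NC NR NI, FuzzyDLLite.Consistent tn T A →
          q.certainAnswers tn T A =
            FuzzyDLLite.dbAnswers A (FuzzyDLLite.perfectRef tn T q n)) ∧
    ∀ [Encodable NC] [Encodable NR] [Encodable NI],
      (∀ α ∈ T, FuzzyDLLite.IsRat α.degree) →
      (∀ γ ∈ q.body, FuzzyDLLite.IsRat γ.2) →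
      FuzzyDLLite.AnsweringInAC0 tn T q := by
  refine ⟨fun hpos => FuzzyDLLite.perfectRef_correct tn T hpos, ?_⟩
  intro _ _ _ hT hq
  exact FuzzyDLLite.answeringInAC0 hT hq
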